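/- All graphs are finite and simple. For a graph $G$, $\lambda_2(G)$ is the second largest eigenvalue (with multiplicity) of its adjacency matrix, and $\kappa(G)$ is its vertex-connectivity, i.e. the least number of vertices whose deletion leaves a graph that is disconnected or has at most one vertex. Let $K_n$ be the complete graph and $M_n$ ($n$ even) the perfect matching on $n$ vertices, let $\mathcal C_n$ ($n\ge 3$) denote any union of disjoint cycles (each of length at least $3$) with $n$ vertices in total, and let $\overline{H}$ be the complement of $H$. The sequential join $G_1\vee\cdots\vee G_k$ consists of disjoint copies of $G_1,\dots,G_k$ together with all edges between $G_i$ and $G_{i+1}$ for $1\le i\le k-1$. For $d\ge 3$ put $c^*=1$ if $d=3$, $c^*=2\lfloor d/4\rfloor$ if $d\ge 4$ is even, and $c^*=(d-1)/2$ if $d\ge 5$ is odd. With $c=c^*$ let $$G_{d,c}=\begin{cases} K_2\vee\overline{M_2}\vee K_1\vee K_1\vee\overline{M_2}\vee K_2 & \text{if } d=3,\\ K_{d+1-c}\vee\overline{M_c}\vee K_1\vee\overline{M_{d-c}}\vee K_{c+1} & \text{if } d\ge 4 \text{ is even},\\ \overline{M_{d+2-c}}\vee\overline{\mathcal C_c}\vee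 K_1\vee\overline{M_{d-c}}\vee K_{c+1} & \text{if } d\ge 5 \text{ is odd and } c \text{ is odd},\\ K_{d+1-c}\vee\overline{M_c}\vee K_1\vee\overline{\mathcal C_{d-c}}\vee\overline{M_{c+2}} & \text{if } d\ge 5 \text{ is odd and } c \text{ is even}. \end{cases}$$ In the last two cases $G_{d,c^*}$ stands for a nonempty family of graphs, one for each choice of the union of cycles. **Theorem.** Let $d\ge 3$. (1) All graphs $G_{d,c^*}$ have the same second largest eigenvalue, denoted $\lambda_2(G_{d,c^*})$. If $G$ is a connected $d$-regular graph with $\lambda_2(G)\le\lambda_2(G_{d,c^*})$ that is not isomorphic to any of the graphs $G_{d,c^*}$, then $\kappa(G)\ge 2$, and $G$ has no cut vertex. (2) The bound is sharp: every graph $G_{d,c^*}$ is connected and $d$-regular, has a cut vertex, and has $\kappa(G_{d,c^*})=1$. -/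

import Mathlib

/-- The second largest eigenvalue `λ₂(G)` of the adjacency matrix of a finite graph `G`, the
eigenvalues being listed in non-increasing order with multiplicity (`eigenvalues₀`, indexed from
`0`).  It only makes sense for graphs with at least two vertices; otherwise the value is `0`. -/
noncomputable def lambda2 {V : Type*} [Fintype V] (G : SimpleGraph V) : ℝ := by
  classical
  exact if h : 1 < Fintype.card V then (G.isHermitian_adjMatrix ℝ).eigenvalues₀ ⟨1, h⟩ else 0

/-- The graph `G - S`. -/
def deleteVertices {V : Type*} (G : SimpleGraph V) (S : Set V) : SimpleGraph {v : V | v ∉ S} :=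
  G.induce {v : V | v ∉ S}

/-- The vertex-connectivity `κ(G)`: the least number of vertices whose deletion leaves a graph
that is disconnected or has at most one vertex. -/
noncomputable def vertexConnectivity {V : Type*} [Fintype V] (G : SimpleGraph V) : ℕ :=
  sInf {k : ℕ | ∃ S : Finset V, S.card = k ∧
    (¬ (deleteVertices G (S : Set V)).Preconnected ∨ {v : V | v ∉ (S : Set V)}.Subsingleton)}

/-- `u` is a cut vertex of the connected graph `G`: `G - u` is disconnected. -/
def IsCutVertex {V : Type*} (G : SimpleGraph V) (u : V) : Prop :=
  ¬ (deleteVertices G {u}).Preconnected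

/-- A graph on a standard vertex set `{0, …, n - 1}`, bundled with its order `n`. -/
abbrev FinGraph : Type := Σ n : ℕ, SimpleGraph (Fin n)

/-- The sequential join `G₁ ∨ ⋯ ∨ G_k` of a list of graphs: disjoint copies of the graphs, where
moreover every vertex of `G_i` is joined to every vertex of `G_{i+1}`. -/
def seqJoin (L : List FinGraph) : SimpleGraph (Σ i : Fin L.length, Fin (L.get i).1) where
  Adj x y :=
    (∃ (i : Fin L.length) (a b : Fin (L.get i).1),
      x = ⟨i, a⟩ ∧ y = ⟨i, b⟩ ∧ (L.get i).2.Adj a b) ∨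
    (x.1 : ℕ) + 1 = (y.1 : ℕ) ∨ (y.1 : ℕ) + 1 = (x.1 : ℕ)
  symm := ⟨by
    rintro x y (⟨i, a, b, hx, hy, h⟩ | h | h)
    · exact Or.inl ⟨i, b, a, hy, hx, h.symm⟩
    · exact Or.inr (Or.inr h)
    · exact Or.inr (Or.inl h)⟩
  loopless := ⟨by
    rintro x (⟨i, a, b, rfl, hy, h⟩ | h | h)
    · obtain rfl : a = b := by simpa using hy
      exact h.ne rfl
    · omega
    · omega⟩

/-- The complete graph `K_n`. -/
def completeG (n : ℕ) : FinGraph := ⟨n, ⊤⟩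

/-- The perfect matching `M_n` on `n` vertices (`n` even), with edges `{0,1}, {2,3}, …`. -/
def matchingGraph (n : ℕ) : SimpleGraph (Fin n) where
  Adj i j := i ≠ j ∧ (i : ℕ) / 2 = (j : ℕ) / 2
  symm := ⟨fun _ _ h => ⟨h.1.symm, h.2.symm⟩⟩
  loopless := ⟨fun _ h => h.1 rfl⟩

/-- The complement of the perfect matching `M_n`. -/
def coMatching (n : ℕ) : FinGraph := ⟨n, (matchingGraph n)ᶜ⟩

/-- `G` is a union of disjoint cycles: each component is a cycle `C_n` with `n ≥ 3`. -/
def IsUnionOfCycles {V : Type*} (G : SimpleGraph V) : Prop :=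
  ∀ C : G.ConnectedComponent, ∃ n : ℕ, 3 ≤ n ∧
    Nonempty (C.toSimpleGraph ≃g SimpleGraph.cycleGraph n)

/-- The complements of the graphs `𝒞_c`, i.e. of the unions of disjoint cycles on `c` vertices
in total. -/
def coCycles (c : ℕ) : Set FinGraph :=
  {X | ∃ C : SimpleGraph (Fin c), IsUnionOfCycles C ∧ X = ⟨c, Cᶜ⟩}

/-- The sequences of graphs whose sequential joins are the graphs `G_{d,c}`.  For odd `d` and
`2 ≤ c ≤ d - 2` there is one sequence for every choice of the union of cycles. -/
def joinSequences (d c : ℕ) : Set (List FinGraph) :=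
  if Even d then
    {[completeG (d + 1 - c), coMatching c, completeG 1, coMatching (d - c), completeG (c + 1)]}
  else if c = 1 ∨ c = d - 1 then
    {[completeG 2, coMatching (d - 1), completeG 1, completeG 1, coMatching (d - 1), completeG 2]}
  else if Odd c then
    {L | ∃ X ∈ coCycles c,
      L = [coMatching (d + 2 - c), X, completeG 1, coMatching (d - c), completeG (c + 1)]}
  else
    {L | ∃ X ∈ coCycles (d - c),
      L = [completeG (d + 1 - c), coMatching c, completeG 1, X, coMatching (c + 2)]}

/-- The extremal parameter `c*`. -/
def cStar (d : ℕ) : ℕ :=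
  if d = 3 then 1 else if Even d then 2 * (d / 4) else (d - 1) / 2

/-! Let `u` be a cut vertex of a connected `d`-regular graph, with sides of `n` and `n'` vertices of
which `c` and `c'` are adjacent to `u`, so `c + c' = d`. Fix `θ = d - δ`. On the first side take the
vector equal to `h = n + 1 - δ` away from `u` and `h - 1` next to `u`. If every vertex away from `u`
is joined to every vertex next to `u` (`IsFullJoin`), the adjacency matrix minus `θ` sends this
vector to a constant on the side; if some such edge is missing, the form of the vector only grows.
These two side vectors and the constant vector span a space on which the sign of the determinant of
the form is governed by `c c' (h + h' - 1) - (d - δ) δ h h'` (`cut_determinant`). When this is at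
most `0`, with strictness there or a missing join edge, `λ₂ > d - δ`
(`IsCutDecomposition.lt_lambda2`).

Conversely, suppose both joins are complete, the quantity vanishes and the sides have at most `d +
2` vertices. Vectors vanishing at `u` and summing to zero on each side complement the above space
and are orthogonal to it for the form. A vertex has at most two non-neighbours in its side, so the
form of such a vector is at most its squared norm, and `λ₂ ≤ d - δ`
(`IsCutDecomposition.lambda2_le`).

What remains is optimization. Since `(h + h' - 1) / (h h') = 1 - (1 - 1/h)(1 - 1/h')`, smaller sides
and a larger product `c c'` are better (`determinant_mono`). Degree parity gives `n ≥ d + 1`,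
improved to `d + 2` when `d` and `c` are odd, and forces `c` to be even when `d` is. Hence `c c'` is
largest at `c*`. Equality in every estimate makes the complement regular of degree `0`, `1` or `2`
on each cell, so the cells are complete graphs, complements of matchings and complements of unions
of cycles.

For `d = 3` one of the contact numbers is `1`, and a side with a single contact cannot be fully
joined: it has at least five vertices, while its contact has only two neighbours inside. Here the
cut vertex lies on a bridge, and both halves get a three-valued test vector built from the root of
`θ³ - 7θ - 2` in `(11/4, 3)`. The upper bound comes from a positive vector that is an eigenvector up
to a correction at the bridge. -/

open Classical in
/-- The sum of `x` over the neighbours of `v`. -/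
noncomputable def nbrSum {V : Type*} [Fintype V] (G : SimpleGraph V) (x : V → ℝ) (v : V) : ℝ :=
  ∑ w, if G.Adj v w then x w else 0

/-! ### Variational bounds for the second eigenvalue -/

section Spectral

variable {V : Type*} [Fintype V] (G : SimpleGraph V)

open Classical in
theorem mulVec_adjMatrix_eq_nbrSum (x : V → ℝ) : (G.adjMatrix ℝ).mulVec x = nbrSum G x := by
  funext v
  simp [nbrSum, Matrix.mulVec, dotProduct, SimpleGraph.adjMatrix_apply]

open Classical in
/-- The coordinates of a vector in the eigenbasis diagonalize the adjacency form. -/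
theorem adjForm_eq_sum_eigenvalues (x : V → ℝ) :
    ∑ v, x v * nbrSum G x v = ∑ i, (G.isHermitian_adjMatrix ℝ).eigenvalues i *
      (∑ v, (G.isHermitian_adjMatrix ℝ).eigenvectorBasis i v * x v) ^ 2 ∧
    ∑ v, x v ^ 2 =
      ∑ i, (∑ v, (G.isHermitian_adjMatrix ℝ).eigenvectorBasis i v * x v) ^ 2 := by
  set hA := G.isHermitian_adjMatrix ℝ
  set b := hA.eigenvectorBasis
  have hin (y z : V → ℝ) : inner ℝ (WithLp.toLp 2 y) (WithLp.toLp 2 z) = ∑ v, y v * z v := by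
    simp [PiLp.inner_apply, mul_comm]
  have hb (i : V) (z : V → ℝ) : inner ℝ (b i) (WithLp.toLp 2 z) = ∑ v, b i v * z v := by
    simp [PiLp.inner_apply, mul_comm]
  have hb' (i : V) (z : V → ℝ) : inner ℝ (WithLp.toLp 2 z) (b i) = ∑ v, b i v * z v := by
    simp [PiLp.inner_apply]
  have key (i : V) : ∑ v, b i v * nbrSum G x v = hA.eigenvalues i * ∑ v, b i v * x v := by
    have h1 := hA.mulVec_eigenvectorBasis i
    have h2 : dotProduct (b i) ((G.adjMatrix ℝ).mulVec x) =
        dotProduct ((G.adjMatrix ℝ).mulVec (b i)) x := by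
      rw [Matrix.dotProduct_mulVec, ← Matrix.mulVec_transpose, G.transpose_adjMatrix]
    rw [mulVec_adjMatrix_eq_nbrSum, h1] at h2
    simpa [dotProduct, Finset.mul_sum, mul_assoc] using h2
  constructor
  · have := b.sum_inner_mul_inner (WithLp.toLp 2 x) (WithLp.toLp 2 (nbrSum G x))
    rw [hin] at this
    rw [← this]
    refine Finset.sum_congr rfl fun i _ => ?_
    rw [hb, hb', key]
    ring
  · have := b.sum_inner_mul_inner (WithLp.toLp 2 x) (WithLp.toLp 2 x)
    rw [hin] at this
    simp_rw [sq]
    rw [← this]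
    refine Finset.sum_congr rfl fun i _ => ?_
    rw [hb, hb']

open Classical in
/-- Two distinct indices of the eigenbasis carrying the two largest eigenvalues. -/
theorem exists_top_eigenvalue_indices (hV : 1 < Fintype.card V) :
    ∃ i₀ i₁ : V, i₀ ≠ i₁ ∧ lambda2 G ≤ (G.isHermitian_adjMatrix ℝ).eigenvalues i₀ ∧
      lambda2 G = (G.isHermitian_adjMatrix ℝ).eigenvalues i₁ ∧
      ∀ i, i ≠ i₀ → (G.isHermitian_adjMatrix ℝ).eigenvalues i ≤ lambda2 G := by
  set hA := G.isHermitian_adjMatrix ℝ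
  -- `eigenvalues` is by definition the sorted list `eigenvalues₀` carried along this equivalence,
  -- so the positions `0` and `1` name the two vertices.
  let e : Fin (Fintype.card V) ≃ V := Fintype.equivOfCardEq (Fintype.card_fin _)
  have hev (i) : hA.eigenvalues i = hA.eigenvalues₀ (e.symm i) := rfl
  have hl : lambda2 G = hA.eigenvalues₀ ⟨1, hV⟩ := by
    simp only [lambda2, hV, dite_true]
  refine ⟨e ⟨0, by omega⟩, e ⟨1, hV⟩, by simp, ?_, ?_, fun i hi => ?_⟩
  · rw [hl, hev, e.symm_apply_apply]
    exact hA.eigenvalues₀_antitone (by simp [Fin.le_def])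
  · rw [hl, hev, e.symm_apply_apply]
  · rw [hl, hev]
    refine hA.eigenvalues₀_antitone ?_
    rw [Fin.le_def]
    by_contra hc
    apply hi
    rw [← e.symm_apply_eq]
    ext
    simp only at hc ⊢
    omega

/-- If the adjacency form is at most `θ` on a hyperplane, then `λ₂ ≤ θ`. -/
theorem lambda2_le_of_hyperplane (hV : 1 < Fintype.card V) (l : V → ℝ) (θ : ℝ)
    (h : ∀ x : V → ℝ, ∑ v, l v * x v = 0 → ∑ v, x v * nbrSum G x v ≤ θ * ∑ v, x v ^ 2) :
    lambda2 G ≤ θ := by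
  classical
  obtain ⟨i₀, i₁, hne, h0, h1, -⟩ := exists_top_eigenvalue_indices G hV
  set hA := G.isHermitian_adjMatrix ℝ
  by_contra! hlt
  have hcoord (i j : V) : ∑ v, hA.eigenvectorBasis i v * hA.eigenvectorBasis j v =
      if i = j then 1 else 0 := by
    have := orthonormal_iff_ite.mp hA.eigenvectorBasis.orthonormal i j
    simpa [PiLp.inner_apply, mul_comm] using this
  -- Courant-Fischer: the span of the two top eigenvectors meets every hyperplane in a nonzero
  -- vector.
  have main : ∃ a b : ℝ, (a ≠ 0 ∨ b ≠ 0) ∧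
      a * (∑ v, l v * hA.eigenvectorBasis i₀ v) + b * (∑ v, l v * hA.eigenvectorBasis i₁ v) = 0 := by
    by_cases hz : ∑ v, l v * hA.eigenvectorBasis i₀ v = 0
    · exact ⟨1, 0, by simp, by simp [hz]⟩
    · exact ⟨- ∑ v, l v * hA.eigenvectorBasis i₁ v, ∑ v, l v * hA.eigenvectorBasis i₀ v,
        Or.inr hz, by ring⟩
  obtain ⟨a, b, hab, hl⟩ := main
  let x : V → ℝ := fun v => a * hA.eigenvectorBasis i₀ v + b * hA.eigenvectorBasis i₁ v
  have hx : ∑ v, l v * x v = 0 := by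
    rw [← hl, Finset.mul_sum, Finset.mul_sum, ← Finset.sum_add_distrib]
    exact Finset.sum_congr rfl fun v _ => by ring
  have hc (i : V) : ∑ v, hA.eigenvectorBasis i v * x v =
      a * (if i = i₀ then 1 else 0) + b * (if i = i₁ then 1 else 0) := by
    rw [← hcoord, ← hcoord, Finset.mul_sum, Finset.mul_sum, ← Finset.sum_add_distrib]
    exact Finset.sum_congr rfl fun v _ => by ring
  have hform := h x hx
  obtain ⟨e1, e2⟩ := adjForm_eq_sum_eigenvalues G x
  rw [e1, e2, Finset.mul_sum] at hform
  have hpos : 0 < ∑ i, (hA.eigenvalues i - θ) * (∑ v, hA.eigenvectorBasis i v * x v) ^ 2 := by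
    have hterm (i : V) : 0 ≤ (hA.eigenvalues i - θ) *
        (∑ v, hA.eigenvectorBasis i v * x v) ^ 2 := by
      rw [hc]
      by_cases hi0 : i = i₀
      · subst hi0
        exact mul_nonneg (by linarith) (sq_nonneg _)
      by_cases hi1 : i = i₁
      · subst hi1
        exact mul_nonneg (by linarith) (sq_nonneg _)
      simp [hi0, hi1]
    refine Finset.sum_pos' (fun i _ => hterm i) ?_
    rcases hab with ha | hb
    · refine ⟨i₀, Finset.mem_univ _, ?_⟩
      rw [hc]
      simp only [if_true, hne, if_false, mul_one, mul_zero, add_zero]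
      exact mul_pos (by linarith) (by positivity)
    · refine ⟨i₁, Finset.mem_univ _, ?_⟩
      rw [hc]
      simp only [if_true, hne.symm, if_false, mul_one, mul_zero, zero_add]
      exact mul_pos (by linarith) (by positivity)
  simp_rw [sub_mul, Finset.sum_sub_distrib] at hpos
  linarith

/-- If the adjacency form exceeds `θ` on a plane, then `λ₂ > θ`. -/
theorem lt_lambda2_of_plane (hV : 1 < Fintype.card V) (x z : V → ℝ) (θ : ℝ)
    (h : ∀ a b : ℝ, (a ≠ 0 ∨ b ≠ 0) → θ * ∑ v, (a * x v + b * z v) ^ 2 <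
      ∑ v, (a * x v + b * z v) * nbrSum G (fun w => a * x w + b * z w) v) :
    θ < lambda2 G := by
  classical
  obtain ⟨i₀, i₁, hne, h0, h1, h2⟩ := exists_top_eigenvalue_indices G hV
  set hA := G.isHermitian_adjMatrix ℝ
  by_contra! hlt
  -- Dually, the given plane contains a nonzero combination orthogonal to the top eigenvector.
  have main : ∃ a b : ℝ, (a ≠ 0 ∨ b ≠ 0) ∧
      a * (∑ v, hA.eigenvectorBasis i₀ v * x v) + b * (∑ v, hA.eigenvectorBasis i₀ v * z v) = 0 := by
    by_cases hz : ∑ v, hA.eigenvectorBasis i₀ v * x v = 0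
    · exact ⟨1, 0, by simp, by simp [hz]⟩
    · exact ⟨- ∑ v, hA.eigenvectorBasis i₀ v * z v, ∑ v, hA.eigenvectorBasis i₀ v * x v,
        Or.inr hz, by ring⟩
  obtain ⟨a, b, hab, hl⟩ := main
  have hform := h a b hab
  obtain ⟨e1, e2⟩ := adjForm_eq_sum_eigenvalues G (fun v => a * x v + b * z v)
  simp only at e1 e2
  rw [e1, e2, Finset.mul_sum] at hform
  refine absurd hform (not_lt.mpr (Finset.sum_le_sum fun i _ => ?_))
  by_cases hi : i = i₀
  · subst hi
    have : ∑ v, hA.eigenvectorBasis i v * (a * x v + b * z v) = 0 := by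
      rw [← hl, Finset.mul_sum, Finset.mul_sum, ← Finset.sum_add_distrib]
      exact Finset.sum_congr rfl fun v _ => by ring
    rw [this]
    simp
  · exact mul_le_mul_of_nonneg_right ((h2 i hi).trans hlt) (sq_nonneg _)

end Spectral

/-! ### Sides of a vertex -/

section Side

open scoped Classical

variable {V : Type*} (G : SimpleGraph V)

/-- `A` is a union of components of `G - u`. -/
structure IsSide (u : V) (A : Finset V) : Prop where
  notMem : u ∉ A
  closed : ∀ v ∈ A, ∀ w, G.Adj v w → w ∈ A ∨ w = u

/-- The neighbours of `u` in `A`. -/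
noncomputable def contacts (u : V) (A : Finset V) : Finset V := A.filter (G.Adj u)

theorem mem_contacts {u : V} {A : Finset V} {v : V} : v ∈ contacts G u A ↔ v ∈ A ∧ G.Adj u v := by
  simp [contacts]

theorem contacts_subset (u : V) (A : Finset V) : contacts G u A ⊆ A := Finset.filter_subset _ _

end Side

/-! ### The adjacency form and its shift -/

section Form

open scoped Classical

variable {V : Type*} [Fintype V] (G : SimpleGraph V)

/-- The bilinear form of the adjacency matrix. -/
noncomputable def adjForm (x y : V → ℝ) : ℝ := ∑ v, x v * nbrSum G y v

/-- The quadratic form of the adjacency matrix minus `θ`. -/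
noncomputable def shiftedForm (θ : ℝ) (x : V → ℝ) : ℝ := adjForm G x x - θ * ∑ v, x v ^ 2

theorem nbrSum_add (x y : V → ℝ) (v : V) :
    nbrSum G (fun w => x w + y w) v = nbrSum G x v + nbrSum G y v := by
  simp only [nbrSum, ← Finset.sum_add_distrib]
  exact Finset.sum_congr rfl fun w _ => by split_ifs <;> simp

theorem nbrSum_mul (a : ℝ) (x : V → ℝ) (v : V) :
    nbrSum G (fun w => a * x w) v = a * nbrSum G x v := by
  simp only [nbrSum, Finset.mul_sum]
  exact Finset.sum_congr rfl fun w _ => by split_ifs <;> simp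

theorem adjForm_comm (x y : V → ℝ) : adjForm G x y = adjForm G y x := by
  simp only [adjForm, nbrSum, Finset.mul_sum]
  rw [Finset.sum_comm]
  refine Finset.sum_congr rfl fun v _ => Finset.sum_congr rfl fun w _ => ?_
  simp only [G.adj_comm w v]
  split_ifs <;> ring

/-- The cross term is kept as a pairing with the image of `y` under the adjacency matrix minus `θ`,
because in the applications that image is constant on each side or supported at few vertices. -/
theorem shiftedForm_add (θ : ℝ) (x y : V → ℝ) :
    shiftedForm G θ (fun v => x v + y v) = shiftedForm G θ x +
      2 * ∑ v, x v * (nbrSum G y v - θ * y v) + shiftedForm G θ y := by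
  have h : adjForm G y x = adjForm G x y := adjForm_comm G y x
  have h1 : adjForm G (fun v => x v + y v) (fun v => x v + y v) =
      adjForm G x x + adjForm G x y + adjForm G y x + adjForm G y y := by
    simp only [adjForm, nbrSum_add, ← Finset.sum_add_distrib]
    exact Finset.sum_congr rfl fun v _ => by ring
  have h2 : ∑ v, x v * (nbrSum G y v - θ * y v) = adjForm G x y - θ * ∑ v, x v * y v := by
    simp only [adjForm, Finset.mul_sum, ← Finset.sum_sub_distrib]
    exact Finset.sum_congr rfl fun v _ => by ring
  have h3 : ∑ v, (x v + y v) ^ 2 = ∑ v, x v ^ 2 + 2 * ∑ v, x v * y v + ∑ v, y v ^ 2 := by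
    simp only [Finset.mul_sum, ← Finset.sum_add_distrib]
    exact Finset.sum_congr rfl fun v _ => by ring
  rw [shiftedForm, h1, h2, h3, h, shiftedForm, shiftedForm]
  ring

theorem shiftedForm_mul (θ a : ℝ) (x : V → ℝ) :
    shiftedForm G θ (fun v => a * x v) = a ^ 2 * shiftedForm G θ x := by
  simp only [shiftedForm, adjForm, nbrSum_mul, mul_sub, Finset.mul_sum]
  congr 1 <;> exact Finset.sum_congr rfl fun v _ => by ring

/-- A vector whose form exceeds what its mean accounts for bounds `λ₂` from below. -/
theorem lt_lambda2_of_form {d : ℕ} (hreg : ∀ v, nbrSum G (fun _ => 1) v = d)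
    (hV : 1 < Fintype.card V) {θ : ℝ} (hθ : θ < d) (y : V → ℝ)
    (h : (d - θ) * (∑ v, y v) ^ 2 / Fintype.card V < shiftedForm G θ y) : θ < lambda2 G := by
  refine lt_lambda2_of_plane G hV y (fun _ => 1) θ fun a b hab => ?_
  have hN : (0 : ℝ) < Fintype.card V := by exact_mod_cast (by omega : 0 < Fintype.card V)
  have h1 := shiftedForm_add G θ (fun v => a * y v) (fun _ => b * 1)
  rw [shiftedForm_mul, shiftedForm_mul] at h1
  have h2 : shiftedForm G θ (fun _ : V => 1) = (d - θ) * Fintype.card V := by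
    simp [shiftedForm, adjForm, hreg]
    ring
  have h3 : ∑ v, a * y v * (nbrSum G (fun _ => b * 1) v - θ * (b * 1)) =
      a * b * (d - θ) * ∑ v, y v := by
    simp only [nbrSum_mul, hreg, Finset.mul_sum]
    exact Finset.sum_congr rfl fun v _ => by ring
  rw [h2, h3] at h1
  have h4 : 0 < shiftedForm G θ (fun v => a * y v + b * 1) := by
    rw [h1]
    set Y := ∑ v, y v
    set N : ℝ := (Fintype.card V : ℝ)
    -- Completing the square in `b`; the minimum over `b` is what the mean of `y` costs.
    have e : a ^ 2 * shiftedForm G θ y + 2 * (a * b * (d - θ) * Y) + b ^ 2 * ((d - θ) * N) =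
        a ^ 2 * (shiftedForm G θ y - (d - θ) * Y ^ 2 / N) + (d - θ) * N * (b + a * Y / N) ^ 2 := by
      field_simp
      ring
    rw [e]
    have hδ : 0 < (d : ℝ) - θ := by linarith
    by_cases ha : a = 0
    · have hb : b ≠ 0 := by tauto
      subst ha
      have : 0 < (d - θ) * N * b ^ 2 := by positivity
      simpa using this
    · have : 0 < a ^ 2 * (shiftedForm G θ y - (d - θ) * Y ^ 2 / N) :=
        mul_pos (by positivity) (by linarith)
      have : 0 ≤ (d - θ) * N * (b + a * Y / N) ^ 2 := by positivity
      linarith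
  rw [shiftedForm, adjForm] at h4
  linarith

/-- The indicator function of a finite set. -/
noncomputable def ind (A : Finset V) (v : V) : ℝ := if v ∈ A then 1 else 0

theorem sum_ind_mul (A : Finset V) (g : V → ℝ) : ∑ v, ind A v * g v = ∑ v ∈ A, g v := by
  simp [ind, Finset.sum_ite_mem]

theorem sum_ind (A : Finset V) : ∑ v, ind A v = A.card := by
  simp [ind]

theorem nbrSum_ind (A : Finset V) (v : V) : nbrSum G (ind A) v = (A.filter (G.Adj v)).card := by
  simp only [nbrSum, ind]
  rw [Finset.card_filter, Nat.cast_sum, ← Finset.sum_subset (Finset.subset_univ A)]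
  · exact Finset.sum_congr rfl fun w hw => by simp [hw]
  · intro w _ hw
    simp [hw]

end Form

/-! ### The test vector of a side -/

section SideVec

open scoped Classical

variable {V : Type*} {G : SimpleGraph V} {u : V} {A : Finset V}

/-- The test vector of a side: `h` away from `u`, `h - 1` next to `u`, and `0` off the side. -/
noncomputable def sideVec (G : SimpleGraph V) (u : V) (A : Finset V) (h : ℝ) (v : V) : ℝ :=
  h * ind A v + -1 * ind (contacts G u A) v

/-- Every vertex of `A` that is not next to `u` is adjacent to every vertex of `A` that is. -/
def IsFullJoin (G : SimpleGraph V) (u : V) (A : Finset V) : Prop :=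
  ∀ v ∈ A, ¬ G.Adj u v → ∀ w ∈ A, G.Adj u w → G.Adj v w

theorem sideVec_of_notMem {v : V} (hv : v ∉ A) (h : ℝ) : sideVec G u A h v = 0 := by
  simp [sideVec, ind, hv, mem_contacts]

theorem sideVec_of_mem {v : V} (hv : v ∈ A) (h : ℝ) :
    sideVec G u A h v = h - if G.Adj u v then 1 else 0 := by
  simp only [sideVec, ind, hv, mem_contacts, true_and, if_true]
  split_ifs <;> ring

/-- The number of vertices of `A` away from `u`. -/
theorem card_sdiff_contacts :
    ((A \ contacts G u A).card : ℝ) = A.card - (contacts G u A).card := by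
  rw [Finset.cast_card_sdiff (contacts_subset G u A)]

end SideVec

section Sides

open scoped Classical

variable {V : Type*} [Fintype V] {G : SimpleGraph V} {d : ℕ} {u : V} {A B : Finset V}

theorem sum_sideVec (h : ℝ) :
    ∑ v, sideVec G u A h v = A.card * h - (contacts G u A).card := by
  simp only [sideVec, Finset.sum_add_distrib, ← Finset.mul_sum, sum_ind]
  ring

/-- The only neighbour that a vertex of a side can have outside the side is `u`. -/
theorem IsSide.nbrSum_ind_of_mem (hA : IsSide G u A)
    (hreg : ∀ v, nbrSum G (fun _ => 1) v = d) {v : V} (hv : v ∈ A) :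
    nbrSum G (ind A) v = d - if G.Adj u v then 1 else 0 := by
  rw [eq_sub_iff_add_eq, ← hreg v]
  have : (if G.Adj u v then (1 : ℝ) else 0) = ∑ w, if G.Adj v w then ind {u} w else 0 := by
    rw [Finset.sum_eq_single u]
    · simp [ind, G.adj_comm]
    · intro w _ hw
      simp [ind, hw]
    · simp
  rw [this, nbrSum, nbrSum, ← Finset.sum_add_distrib]
  refine Finset.sum_congr rfl fun w _ => ?_
  by_cases hvw : G.Adj v w
  · simp only [hvw, if_true, ind, Finset.mem_singleton]
    rcases hA.closed v hv w hvw with hw | rfl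
    · have : w ≠ u := fun e => hA.notMem (e ▸ hw)
      simp [hw, this]
    · simp [hA.notMem]
  · simp [hvw]

theorem IsSide.nbrSum_sideVec_off (hA : IsSide G u A) {v : V} (hv : v ∉ A) (hvu : v ≠ u) (h : ℝ) :
    nbrSum G (sideVec G u A h) v = 0 := by
  refine Finset.sum_eq_zero fun w _ => ?_
  split_ifs with hvw
  · have hw : w ∉ A := fun hw => (hA.closed w hw v hvw.symm).elim hv hvu
    simp [sideVec, ind, hw, mem_contacts]
  · rfl

theorem IsSide.nbrSum_ind_contacts (hA : IsSide G u A)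
    (hreg : ∀ v, nbrSum G (fun _ => 1) v = d) {v : V} (hv : v ∈ contacts G u A) :
    nbrSum G (ind (contacts G u A)) v = d - 1 - nbrSum G (ind (A \ contacts G u A)) v := by
  have h := hA.nbrSum_ind_of_mem hreg (mem_contacts G |>.mp hv).1
  rw [if_pos (mem_contacts G |>.mp hv).2] at h
  rw [← h, eq_sub_iff_add_eq, ← nbrSum_add]
  congr 1
  funext w
  by_cases hw : w ∈ contacts G u A
  · simp [ind, hw, contacts_subset G u A hw]
  · simp [ind, hw]

theorem nbrSum_ind_le (v : V) : nbrSum G (ind A) v ≤ A.card := by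
  rw [nbrSum_ind]
  exact_mod_cast Finset.card_filter_le _ _

/-- The form of the test vector in terms of the number of edges among the contacts. -/
theorem IsSide.shiftedForm_sideVec (hA : IsSide G u A)
    (hreg : ∀ v, nbrSum G (fun _ => 1) v = d) (θ h : ℝ) :
    shiftedForm G θ (sideVec G u A h) =
      h ^ 2 * (d * A.card - (contacts G u A).card) - 2 * h * (d - 1) * (contacts G u A).card +
      adjForm G (ind (contacts G u A)) (ind (contacts G u A)) -
      θ * (h ^ 2 * A.card - 2 * h * (contacts G u A).card + (contacts G u A).card) := by
  set C := contacts G u A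
  have hCA : C ⊆ A := contacts_subset G u A
  unfold sideVec
  rw [shiftedForm_add, shiftedForm_mul, shiftedForm_mul]
  have hsq (D : Finset V) : ∑ v, ind D v ^ 2 = D.card := by
    rw [← sum_ind]
    refine Finset.sum_congr rfl fun v _ => ?_
    unfold ind
    split_ifs <;> simp
  have hAA : adjForm G (ind A) (ind A) = d * A.card - C.card := by
    rw [adjForm, sum_ind_mul, Finset.sum_congr rfl fun v hv => hA.nbrSum_ind_of_mem hreg hv,
      Finset.sum_sub_distrib, Finset.sum_const, ← Finset.sum_filter]
    simp [C, contacts, mul_comm]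
  have hCC : adjForm G (ind C) (ind A) = (d - 1) * C.card := by
    rw [adjForm, sum_ind_mul, Finset.sum_congr rfl fun v hv => hA.nbrSum_ind_of_mem hreg (hCA hv),
      Finset.sum_congr rfl fun v hv => by rw [if_pos ((mem_contacts G).mp hv).2]]
    simp only [Finset.sum_const, nsmul_eq_mul]
    ring
  have hAC : ∑ v, ind A v * ind C v = C.card := by
    rw [sum_ind_mul, ← Finset.sum_subset hCA fun v _ hv => by simp [ind, hv]]
    simp +contextual [ind]
  have hmix : ∑ v, h * ind A v * (nbrSum G (fun w => -1 * ind C w) v - θ * (-1 * ind C v)) =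
      -h * (adjForm G (ind C) (ind A) - θ * ∑ v, ind A v * ind C v) := by
    rw [adjForm_comm]
    simp only [adjForm, nbrSum_mul, Finset.mul_sum, ← Finset.sum_sub_distrib]
    exact Finset.sum_congr rfl fun v _ => by ring
  rw [hmix, hCC, hAC]
  simp only [shiftedForm, hAA, hsq]
  ring

/-- A contact has `d - 1` neighbours in `A`, and at most `|A| - c` of them are not contacts.
Equality at every contact means precisely that no join edge is missing, which is where the rigidity
of the extremal graphs originates. -/
theorem IsSide.le_adjForm_contacts (hA : IsSide G u A)
    (hreg : ∀ v, nbrSum G (fun _ => 1) v = d) :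
    (contacts G u A).card * ((d : ℝ) - 1 - (A.card - (contacts G u A).card)) ≤
      adjForm G (ind (contacts G u A)) (ind (contacts G u A)) ∧
    (¬ IsFullJoin G u A →
      (contacts G u A).card * ((d : ℝ) - 1 - (A.card - (contacts G u A).card)) <
      adjForm G (ind (contacts G u A)) (ind (contacts G u A))) := by
  rw [adjForm, sum_ind_mul, ← card_sdiff_contacts, ← nsmul_eq_mul, ← Finset.sum_const]
  have hle : ∀ v ∈ contacts G u A, (d : ℝ) - 1 - (A \ contacts G u A).card ≤
      nbrSum G (ind (contacts G u A)) v := fun v hv => by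
    rw [hA.nbrSum_ind_contacts hreg hv]
    linarith [nbrSum_ind_le (G := G) (A := A \ contacts G u A) v]
  refine ⟨Finset.sum_le_sum hle, fun hnot => Finset.sum_lt_sum hle ?_⟩
  simp only [IsFullJoin, not_forall] at hnot
  obtain ⟨v, hv, huv, w, hw, huw, hvw⟩ := hnot
  have hwC : w ∈ contacts G u A := (mem_contacts G).mpr ⟨hw, huw⟩
  refine ⟨w, hwC, ?_⟩
  rw [hA.nbrSum_ind_contacts hreg hwC, nbrSum_ind]
  have : ((A \ contacts G u A).filter (G.Adj w)).card < (A \ contacts G u A).card := by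
    refine Finset.card_lt_card (Finset.filter_ssubset.mpr ⟨v, ?_, fun h => hvw h.symm⟩)
    simp [hv, huv, mem_contacts]
  have : (((A \ contacts G u A).filter (G.Adj w)).card : ℝ) < (A \ contacts G u A).card := by
    exact_mod_cast this
  linarith

/-- The bound for the form of the test vector with `h = |A| + 1 - δ`. -/
theorem IsSide.le_shiftedForm_sideVec (hA : IsSide G u A)
    (hreg : ∀ v, nbrSum G (fun _ => 1) v = d) {θ δ h : ℝ} (hδ : θ = d - δ)
    (hh : h = A.card + 1 - δ) :
    -(((contacts G u A).card - δ * h) * (A.card * h - (contacts G u A).card)) ≤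
      shiftedForm G θ (sideVec G u A h) ∧
    (¬ IsFullJoin G u A →
      -(((contacts G u A).card - δ * h) * (A.card * h - (contacts G u A).card)) <
      shiftedForm G θ (sideVec G u A h)) := by
  obtain ⟨h1, h2⟩ := hA.le_adjForm_contacts hreg
  rw [hA.shiftedForm_sideVec hreg]
  set c : ℝ := ((contacts G u A).card : ℝ)
  set n : ℝ := (A.card : ℝ)
  set e := adjForm G (ind (contacts G u A)) (ind (contacts G u A))
  have id : h ^ 2 * (d * n - c) - 2 * h * (d - 1) * c + e - θ * (h ^ 2 * n - 2 * h * c + c) =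
      -((c - δ * h) * (n * h - c)) + (e - c * (d - 1 - (n - c))) := by
    subst hδ hh
    ring
  rw [id]
  exact ⟨by linarith, fun hn => by linarith [h2 hn]⟩

/-- On a fully joined side the test vector solves the eigenvalue equation up to a constant. -/
theorem IsSide.nbrSum_sideVec (hA : IsSide G u A) (hfull : IsFullJoin G u A)
    (hreg : ∀ v, nbrSum G (fun _ => 1) v = d) {θ δ h : ℝ} (hδ : θ = d - δ)
    (hh : h = A.card + 1 - δ) {v : V} (hv : v ∈ A) :
    nbrSum G (sideVec G u A h) v - θ * sideVec G u A h v = δ * h - (contacts G u A).card := by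
  rw [sideVec_of_mem hv]
  unfold sideVec
  rw [nbrSum_add, nbrSum_mul, nbrSum_mul, hA.nbrSum_ind_of_mem hreg hv]
  by_cases huv : G.Adj u v
  · have hvC : v ∈ contacts G u A := (mem_contacts G).mpr ⟨hv, huv⟩
    rw [hA.nbrSum_ind_contacts hreg hvC, nbrSum_ind, Finset.filter_true_of_mem,
      card_sdiff_contacts, if_pos huv, hδ]
    -- The value of `h` matters only at contacts: it is the one for which the constant there agrees
    -- with the constant away from `u`.
    · rw [hh]
      ring
    · intro w hw
      rw [Finset.mem_sdiff, mem_contacts] at hw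
      exact (hfull w hw.1 (fun h => hw.2 ⟨hw.1, h⟩) v hv huv).symm
  · rw [if_neg huv, nbrSum_ind, Finset.filter_true_of_mem, hδ]
    · ring
    · intro w hw
      rw [mem_contacts] at hw
      exact hfull v hv huv w hw.1 hw.2

/-- Every vertex of `A` has at most two non-neighbours in `A`, so the form of a vector that
sums to zero on `A` is at most its squared norm. -/
theorem IsSide.adjForm_le_of_sum_eq_zero (hA : IsSide G u A)
    (hreg : ∀ v, nbrSum G (fun _ => 1) v = d) (hn : A.card ≤ d + 2) (w : V → ℝ)
    (hw : ∀ v ∉ A, w v = 0) (hsum : ∑ v, w v = 0) : adjForm G w w ≤ ∑ v, w v ^ 2 := by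
  -- Dropping the product of a non-adjacent pair costs at most half the two squares, because `(w v +
  -- w v')² ≥ 0`. The last term corrects the diagonal, where the right side would otherwise be too
  -- large by `2 * w v ^ 2`. The full products add up to `(∑ w)² = 0`.
  have hpt (v v' : V) : w v * (if G.Adj v v' then w v' else 0) ≤ w v * w v' +
      ((if G.Adj v v' then 0 else ind A v' * w v ^ 2) +
        (if G.Adj v' v then 0 else ind A v * w v' ^ 2)) / 2
      - if v = v' then 2 * w v ^ 2 else 0 := by
    by_cases hvA : v ∈ A
    swap
    · rw [hw v hvA]
      have : 0 ≤ (if G.Adj v' v then 0 else ind A v * w v' ^ 2) := by simp [ind, hvA]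
      simp only [zero_mul]
      split_ifs at * <;> simp [ind, hvA]
    by_cases hvA' : v' ∈ A
    swap
    · rw [hw v' hvA']
      have : v ≠ v' := fun e => hvA' (e ▸ hvA)
      simp [this, ind, hvA']
    by_cases e : v = v'
    · subst e
      simp [ind, hvA]
      nlinarith
    by_cases hadj : G.Adj v v'
    · simp [hadj, hadj.symm, e]
    · have hadj' : ¬ G.Adj v' v := fun h => hadj h.symm
      simp [hadj, hadj', e, ind, hvA, hvA']
      nlinarith [sq_nonneg (w v + w v')]
  -- The vertex `v` counts among its own non-neighbours, hence three and not two.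
  have hcount (v : V) : ∑ v', (if G.Adj v v' then 0 else ind A v' * w v ^ 2) ≤ 3 * w v ^ 2 := by
    by_cases hvA : v ∈ A
    · have h1 : ∑ v', (if G.Adj v v' then 0 else ind A v' * w v ^ 2) =
          (∑ v', ind A v' - nbrSum G (ind A) v) * w v ^ 2 := by
        rw [nbrSum, ← Finset.sum_sub_distrib, Finset.sum_mul]
        exact Finset.sum_congr rfl fun v' _ => by split_ifs <;> simp
      rw [h1, sum_ind, hA.nbrSum_ind_of_mem hreg hvA]
      refine mul_le_mul_of_nonneg_right ?_ (sq_nonneg _)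
      have : (A.card : ℝ) ≤ d + 2 := by exact_mod_cast hn
      split_ifs <;> linarith
    · simp [hw v hvA]
  have htot : adjForm G w w ≤ ∑ v, ∑ v', (w v * w v' +
      ((if G.Adj v v' then 0 else ind A v' * w v ^ 2) +
        (if G.Adj v' v then 0 else ind A v * w v' ^ 2)) / 2
      - if v = v' then 2 * w v ^ 2 else 0) := by
    simp only [adjForm, nbrSum, Finset.mul_sum]
    exact Finset.sum_le_sum fun v _ => Finset.sum_le_sum fun v' _ => hpt v v'
  refine htot.trans ?_
  have hcomm : ∑ v, ∑ v', (if G.Adj v' v then 0 else ind A v * w v' ^ 2) =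
      ∑ v, ∑ v', (if G.Adj v v' then 0 else ind A v' * w v ^ 2) := Finset.sum_comm
  simp only [Finset.sum_sub_distrib, Finset.sum_add_distrib, ← Finset.sum_div, hcomm]
  have hs := Finset.sum_le_sum fun v (_ : v ∈ Finset.univ) => hcount v
  rw [← Finset.mul_sum] at hs
  simp only [Finset.sum_ite_eq, Finset.mem_univ, if_true, ← Finset.mul_sum, hsum,
    mul_zero, Finset.sum_const_zero]
  linarith

end Sides

/-- A binary quadratic form that dominates an indefinite or degenerate one, strictly somewhere,
takes a positive value. -/
theorem exists_form_pos {p q p' q' r : ℝ} (hp : p ≤ p') (hq : q ≤ q') (hr : r ≠ 0)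
    (hdet : p * q ≤ r ^ 2) (hstrict : p * q < r ^ 2 ∨ p < p' ∨ q < q') :
    ∃ a b : ℝ, 0 < p' * a ^ 2 + 2 * r * a * b + q' * b ^ 2 := by
  by_contra! h
  have h1 : p' ≤ 0 := by simpa using h 1 0
  have h2 : q' ≤ 0 := by simpa using h 0 1
  have hr2 : 0 < r ^ 2 := by positivity
  -- The value at `(-r, p')` is `p' (p' q' - r²)`.
  have h3 : p' * (p' * q' - r ^ 2) ≤ 0 := by
    have := h (-r) p'
    nlinarith
  have hp' : p' < 0 := by
    refine lt_of_le_of_ne h1 fun e => ?_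
    -- For `p' = 0` the value at this point is exactly `r²`.
    have h4 := h ((1 - q') / 2) r
    rw [e] at h4
    linarith
  have h4 : r ^ 2 ≤ p' * q' := by nlinarith
  have hq' : q' < 0 := by
    refine lt_of_le_of_ne h2 fun e => ?_
    subst e
    linarith
  have h5 : p' * q' ≤ p * q := by nlinarith
  rcases hstrict with hs | hs | hs
  · linarith
  · nlinarith
  · nlinarith

/-! ### Lower and upper bounds for `λ₂` at a cut vertex -/

section Decomposition

open scoped Classical

/-- `A` and `B` are the two sides of the cut vertex `u`. -/
structure IsCutDecomposition {V : Type*} (G : SimpleGraph V) (u : V) (A B : Finset V) : Prop where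
  left : IsSide G u A
  right : IsSide G u B
  disj : Disjoint A B
  cover : ∀ v, v ∈ A ∨ v ∈ B ∨ v = u

theorem IsCutDecomposition.symm {V : Type*} {G : SimpleGraph V} {u : V} {A B : Finset V}
    (h : IsCutDecomposition G u A B) : IsCutDecomposition G u B A :=
  ⟨h.right, h.left, h.disj.symm, fun v => by have := h.cover v; tauto⟩

variable {V : Type*} [Fintype V] {G : SimpleGraph V} {d : ℕ} {u : V} {A B : Finset V}

theorem IsCutDecomposition.card (h : IsCutDecomposition G u A B) :
    Fintype.card V = A.card + B.card + 1 := by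
  have : (Finset.univ : Finset V) = insert u (A ∪ B) := by
    ext v
    have := h.cover v
    simp only [Finset.mem_univ, Finset.mem_insert, Finset.mem_union, true_iff]
    tauto
  rw [← Finset.card_univ, this, Finset.card_insert_of_notMem, Finset.card_union_of_disjoint h.disj]
  simp [h.left.notMem, h.right.notMem]

theorem IsCutDecomposition.card_contacts (h : IsCutDecomposition G u A B)
    (hreg : ∀ v, nbrSum G (fun _ => 1) v = d) :
    (contacts G u A).card + (contacts G u B).card = d := by
  have h1 : nbrSum G (fun _ => 1) u = nbrSum G (ind A) u + nbrSum G (ind B) u := by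
    rw [← nbrSum_add]
    refine Finset.sum_congr rfl fun v _ => ?_
    split_ifs with hv
    · have hne : v ≠ u := hv.ne'
      rcases h.cover v with hA | hB | rfl
      · simp [ind, hA, Finset.disjoint_left.mp h.disj hA]
      · simp [ind, hB, Finset.disjoint_right.mp h.disj hB]
      · exact absurd rfl hne
    · rfl
  rw [hreg, nbrSum_ind, nbrSum_ind] at h1
  exact_mod_cast h1.symm

/-- The determinant of the two test vectors and the constant vector. -/
theorem cut_determinant {n n' c c' d δ h h' : ℝ} (hd : c + c' = d) (hh : h = n + 1 - δ)
    (hh' : h' = n' + 1 - δ) :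
    (n + n' + 1) * ((c - δ * h) * (c' - δ * h')) +
      δ * ((n * h - c) * (c' - δ * h') + (n' * h' - c') * (c - δ * h)) =
    c * c' * (h + h' - 1) - (d - δ) * δ * (h * h') := by
  subst hd
  obtain rfl : n = h - 1 + δ := by linarith
  obtain rfl : n' = h' - 1 + δ := by linarith
  ring

/-- The lower bound for `λ₂` in the presence of a cut vertex. -/
theorem IsCutDecomposition.lt_lambda2 (hcut : IsCutDecomposition G u A B)
    (hreg : ∀ v, nbrSum G (fun _ => 1) v = d) {δ h h' : ℝ} (hδ0 : 0 < δ) (hδ1 : δ < 1)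
    (hA0 : A.Nonempty) (hB0 : B.Nonempty)
    (hh : h = A.card + 1 - δ) (hh' : h' = B.card + 1 - δ)
    (hle : (contacts G u A).card * (contacts G u B).card * (h + h' - 1) ≤
      (d - δ) * δ * (h * h'))
    (hstrict : (contacts G u A).card * (contacts G u B).card * (h + h' - 1) <
      (d - δ) * δ * (h * h') ∨ ¬ IsFullJoin G u A ∨ ¬ IsFullJoin G u B) :
    d - δ < lambda2 G := by
  have hcard := hcut.card
  have hsum : ((contacts G u A).card : ℝ) + (contacts G u B).card = d := by
    exact_mod_cast hcut.card_contacts hreg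
  have hnA : (1 : ℝ) ≤ A.card := by exact_mod_cast hA0.card_pos
  have hnB : (1 : ℝ) ≤ B.card := by exact_mod_cast hB0.card_pos
  have hcA : ((contacts G u A).card : ℝ) ≤ A.card := by
    exact_mod_cast Finset.card_le_card (contacts_subset G u A)
  have hcB : ((contacts G u B).card : ℝ) ≤ B.card := by
    exact_mod_cast Finset.card_le_card (contacts_subset G u B)
  obtain ⟨qA, qA'⟩ := hcut.left.le_shiftedForm_sideVec hreg (rfl : (d : ℝ) - δ = d - δ) hh
  obtain ⟨qB, qB'⟩ := hcut.right.le_shiftedForm_sideVec hreg (rfl : (d : ℝ) - δ = d - δ) hh'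
  have hdet := cut_determinant hsum hh hh'
  have hS : 0 < A.card * h - (contacts G u A).card := by
    have := mul_lt_mul_of_pos_left (show 1 < h by linarith) (show (0 : ℝ) < A.card by linarith)
    linarith
  have hS' : 0 < B.card * h' - (contacts G u B).card := by
    have := mul_lt_mul_of_pos_left (show 1 < h' by linarith) (show (0 : ℝ) < B.card by linarith)
    linarith
  have hsA := sum_sideVec (G := G) (u := u) (A := A) h
  have hsB := sum_sideVec (G := G) (u := u) (A := B) h'
  set c : ℝ := ((contacts G u A).card : ℝ)
  set c' : ℝ := ((contacts G u B).card : ℝ)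
  set n : ℝ := (A.card : ℝ)
  set n' : ℝ := (B.card : ℝ)
  set S := n * h - c
  set S' := n' * h' - c'
  set QA := shiftedForm G (d - δ) (sideVec G u A h)
  set QB := shiftedForm G (d - δ) (sideVec G u B h')
  have hN : (Fintype.card V : ℝ) = n + n' + 1 := by
    rw [hcard]
    push_cast
    rfl
  have hNpos : 0 < n + n' + 1 := by linarith
  -- A combination `a f + b f'` beats its mean exactly when this binary form is positive; it is the
  -- condition of `lt_lambda2_of_form` multiplied by the number of vertices. There is no cross term
  -- apart from the one coming from the mean.
  have key : ∃ a b : ℝ, 0 < (QA * (n + n' + 1) - δ * S ^ 2) * a ^ 2 + 2 * (-(δ * S * S')) * a * b +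
      (QB * (n + n' + 1) - δ * S' ^ 2) * b ^ 2 := by
    -- With `QA` and `QB` replaced by their lower bounds, the determinant is a positive multiple of
    -- the quantity in `hle`.
    have e : (-((c - δ * h) * S) * (n + n' + 1) - δ * S ^ 2) *
        (-((c' - δ * h') * S') * (n + n' + 1) - δ * S' ^ 2) - (-(δ * S * S')) ^ 2 =
        S * S' * (n + n' + 1) * (c * c' * (h + h' - 1) - (d - δ) * δ * (h * h')) := by
      rw [← hdet]
      ring
    have hpos : 0 < S * S' * (n + n' + 1) := by positivity
    refine exists_form_pos (p := -((c - δ * h) * S) * (n + n' + 1) - δ * S ^ 2)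
      (q := -((c' - δ * h') * S') * (n + n' + 1) - δ * S' ^ 2)
      (sub_le_sub_right (mul_le_mul_of_nonneg_right qA hNpos.le) _)
      (sub_le_sub_right (mul_le_mul_of_nonneg_right qB hNpos.le) _)
      (neg_ne_zero.mpr (by positivity)) ?_ ?_
    · have := mul_nonneg hpos.le (sub_nonneg.mpr hle)
      linarith
    · rcases hstrict with hs | hs | hs
      · left
        have := mul_pos hpos (sub_pos.mpr hs)
        linarith
      · right; left
        exact sub_lt_sub_right (mul_lt_mul_of_pos_right (qA' hs) hNpos) _
      · right; right
        exact sub_lt_sub_right (mul_lt_mul_of_pos_right (qB' hs) hNpos) _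
  obtain ⟨a, b, hab⟩ := key
  refine lt_lambda2_of_form G hreg ?_ (by linarith)
    (fun v => a * sideVec G u A h v + b * sideVec G u B h' v) ?_
  · have := hA0.card_pos
    omega
  · have hcross : ∑ v, a * sideVec G u A h v * (nbrSum G (fun w => b * sideVec G u B h' w) v -
        (d - δ) * (b * sideVec G u B h' v)) = 0 := by
      refine Finset.sum_eq_zero fun v _ => ?_
      by_cases hv : v ∈ A
      · have hvB := Finset.disjoint_left.mp hcut.disj hv
        rw [nbrSum_mul, hcut.right.nbrSum_sideVec_off hvB (fun e => hcut.left.notMem (e ▸ hv)),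
          sideVec_of_notMem hvB]
        ring
      · rw [sideVec_of_notMem hv]
        ring
    rw [shiftedForm_add, shiftedForm_mul, shiftedForm_mul, hcross, Finset.sum_add_distrib,
      ← Finset.mul_sum, ← Finset.mul_sum, hsA, hsB, hN, div_lt_iff₀ hNpos]
    have e : ((d : ℝ) - (d - δ)) = δ := by ring
    rw [e]
    linarith

/-- The upper bound for `λ₂` when both sides are fully joined and small. -/
theorem IsCutDecomposition.lambda2_le (hcut : IsCutDecomposition G u A B)
    (hreg : ∀ v, nbrSum G (fun _ => 1) v = d) (hd : 2 ≤ d) {δ h h' : ℝ} (hδ0 : 0 < δ) (hδ1 : δ < 1)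
    (hA0 : A.Nonempty) (hB0 : B.Nonempty) (hfA : IsFullJoin G u A) (hfB : IsFullJoin G u B)
    (hnA : A.card ≤ d + 2) (hnB : B.card ≤ d + 2)
    (hh : h = A.card + 1 - δ) (hh' : h' = B.card + 1 - δ)
    (heq : (contacts G u A).card * (contacts G u B).card * (h + h' - 1) =
      (d - δ) * δ * (h * h'))
    (hD : δ * h' ≤ (contacts G u B).card) : lambda2 G ≤ d - δ := by
  have hcard := hcut.card
  have hsum : ((contacts G u A).card : ℝ) + (contacts G u B).card = d := by
    exact_mod_cast hcut.card_contacts hreg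
  have hnA1 : (1 : ℝ) ≤ A.card := by exact_mod_cast hA0.card_pos
  have hnB1 : (1 : ℝ) ≤ B.card := by exact_mod_cast hB0.card_pos
  have hcA : ((contacts G u A).card : ℝ) ≤ A.card := by
    exact_mod_cast Finset.card_le_card (contacts_subset G u A)
  have hcB : ((contacts G u B).card : ℝ) ≤ B.card := by
    exact_mod_cast Finset.card_le_card (contacts_subset G u B)
  have hd' : (2 : ℝ) ≤ d := by exact_mod_cast hd
  have eA (v) (hv : v ∈ A) := hcut.left.nbrSum_sideVec hfA hreg (rfl : (d : ℝ) - δ = d - δ) hh hv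
  have eB (v) (hv : v ∈ B) := hcut.right.nbrSum_sideVec hfB hreg (rfl : (d : ℝ) - δ = d - δ) hh' hv
  have hdet := cut_determinant hsum hh hh'
  have hS : 0 < A.card * h - (contacts G u A).card := by
    have := mul_lt_mul_of_pos_left (show 1 < h by linarith) (show (0 : ℝ) < A.card by linarith)
    linarith
  have hS' : 0 < B.card * h' - (contacts G u B).card := by
    have := mul_lt_mul_of_pos_left (show 1 < h' by linarith) (show (0 : ℝ) < B.card by linarith)
    linarith
  have hsA := sum_sideVec (G := G) (u := u) (A := A) h
  have hsB := sum_sideVec (G := G) (u := u) (A := B) h'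
  set c : ℝ := ((contacts G u A).card : ℝ)
  set c' : ℝ := ((contacts G u B).card : ℝ)
  set n : ℝ := (A.card : ℝ)
  set n' : ℝ := (B.card : ℝ)
  set S := n * h - c
  set S' := n' * h' - c'
  set f := sideVec G u A h
  set f' := sideVec G u B h'
  set θ : ℝ := d - δ
  have hN : (Fintype.card V : ℝ) = n + n' + 1 := by
    rw [hcard]
    push_cast
    rfl
  have hNpos : 0 < n + n' + 1 := by linarith
  refine lambda2_le_of_hyperplane G ?_ (fun _ => 1) _ fun x hx => ?_
  · have := hA0.card_pos
    omega
  simp only [one_mul] at hx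
  suffices hform : shiftedForm G θ x ≤ 0 by
    rw [shiftedForm, adjForm] at hform
    linarith
  set t := x u
  -- The vector `p` below lies in the span of the constant and the two side vectors and agrees with
  -- `x` at `u` and in its sums over `A` and `B`. These three conditions determine `t`, `a` and `b`.
  set a := (∑ v ∈ A, (x v - t)) / S
  set b := (∑ v ∈ B, (x v - t)) / S'
  let p : V → ℝ := fun v => (t * 1) + (a * f v + b * f' v)
  let w : V → ℝ := fun v => ind A v * (x v - t - a * f v)
  let w' : V → ℝ := fun v => ind B v * (x v - t - b * f' v)
  have hfoff (v) (hv : v ∉ A) : f v = 0 := sideVec_of_notMem hv h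
  have hfoff' (v) (hv : v ∉ B) : f' v = 0 := sideVec_of_notMem hv h'
  have hxp : x = fun v => (w v + w' v) + p v := by
    funext v
    simp only [p, w, w']
    rcases hcut.cover v with hv | hv | rfl
    · have hvB := Finset.disjoint_left.mp hcut.disj hv
      simp only [ind, hv, hvB, if_true, if_false, hfoff' v hvB]
      ring
    · have hvA := Finset.disjoint_right.mp hcut.disj hv
      simp only [ind, hv, hvA, if_true, if_false, hfoff v hvA]
      ring
    · simp [ind, hcut.left.notMem, hcut.right.notMem, hfoff v hcut.left.notMem,
        hfoff' v hcut.right.notMem, t]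
  have hsumf : ∑ v ∈ A, f v = S := by
    rw [← hsA]
    exact Finset.sum_subset (Finset.subset_univ _) fun v _ hv => hfoff v hv
  have hsumf' : ∑ v ∈ B, f' v = S' := by
    rw [← hsB]
    exact Finset.sum_subset (Finset.subset_univ _) fun v _ hv => hfoff' v hv
  have hw0 : ∑ v, w v = 0 := by
    simp only [w, sum_ind_mul, Finset.sum_sub_distrib (fun v => x v - t), ← Finset.mul_sum,
      hsumf, a]
    field_simp
    ring
  have hw0' : ∑ v, w' v = 0 := by
    simp only [w', sum_ind_mul, Finset.sum_sub_distrib (fun v => x v - t),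
      ← Finset.mul_sum, hsumf', b]
    field_simp
    ring
  have hwoff (v) (hv : v ∉ A) : w v = 0 := by simp [w, ind, hv]
  have hwoff' (v) (hv : v ∉ B) : w' v = 0 := by simp [w', ind, hv]
  have hp (v) : nbrSum G p v = t * d + (a * nbrSum G f v + b * nbrSum G f' v) := by
    simp only [p, nbrSum_add, nbrSum_mul, hreg]
  have hpA (v) (hv : v ∈ A) : nbrSum G p v - θ * p v = t * δ + a * (δ * h - c) := by
    have hvB := Finset.disjoint_left.mp hcut.disj hv
    rw [hp, hcut.right.nbrSum_sideVec_off hvB (fun e => hcut.left.notMem (e ▸ hv)), ← eA v hv]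
    simp only [p, hfoff' v hvB, θ]
    ring
  have hpB (v) (hv : v ∈ B) : nbrSum G p v - θ * p v = t * δ + b * (δ * h' - c') := by
    have hvA := Finset.disjoint_right.mp hcut.disj hv
    rw [hp, hcut.left.nbrSum_sideVec_off hvA (fun e => hcut.right.notMem (e ▸ hv)), ← eB v hv]
    simp only [p, hfoff v hvA, θ]
    ring
  -- The image of `p` under the adjacency matrix minus `θ` is constant on each side, where `w` and
  -- `w'` sum to zero, and both vanish at `u`.
  have hcross : ∑ v, (w v + w' v) * (nbrSum G p v - θ * p v) = 0 := by
    have : ∀ v, (w v + w' v) * (nbrSum G p v - θ * p v) =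
        (t * δ + a * (δ * h - c)) * w v + (t * δ + b * (δ * h' - c')) * w' v := fun v => by
      rcases hcut.cover v with hv | hv | rfl
      · rw [hpA v hv, hwoff' v (Finset.disjoint_left.mp hcut.disj hv)]
        ring
      · rw [hpB v hv, hwoff v (Finset.disjoint_right.mp hcut.disj hv)]
        ring
      · rw [hwoff v hcut.left.notMem, hwoff' v hcut.right.notMem]
        ring
    simp only [this, Finset.sum_add_distrib, ← Finset.mul_sum, hw0, hw0']
    ring
  have hcrossw : ∑ v, w v * (nbrSum G w' v - θ * w' v) = 0 := by
    refine Finset.sum_eq_zero fun v _ => ?_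
    by_cases hv : v ∈ A
    · have hvB := Finset.disjoint_left.mp hcut.disj hv
      have : nbrSum G w' v = 0 := by
        refine Finset.sum_eq_zero fun z _ => ?_
        split_ifs with hz
        · refine hwoff' z fun hzB => ?_
          rcases hcut.right.closed z hzB v hz.symm with h | h
          · exact hvB h
          · exact hcut.left.notMem (h ▸ hv)
        · rfl
      rw [this, hwoff' v hvB]
      ring
    · rw [hwoff v hv]
      ring
  have hformw : shiftedForm G θ w ≤ 0 := by
    have h1 := hcut.left.adjForm_le_of_sum_eq_zero hreg hnA w hwoff hw0
    have h2 : 0 ≤ ∑ v, w v ^ 2 := Finset.sum_nonneg fun v _ => sq_nonneg _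
    rw [shiftedForm]
    have := mul_le_mul_of_nonneg_right (show 1 ≤ θ by simp only [θ]; linarith) h2
    linarith
  have hformw' : shiftedForm G θ w' ≤ 0 := by
    have h1 := hcut.right.adjForm_le_of_sum_eq_zero hreg hnB w' hwoff' hw0'
    have h2 : 0 ≤ ∑ v, w' v ^ 2 := Finset.sum_nonneg fun v _ => sq_nonneg _
    rw [shiftedForm]
    have := mul_le_mul_of_nonneg_right (show 1 ≤ θ by simp only [θ]; linarith) h2
    linarith
  have hconstr : (n + n' + 1) * t + a * S + b * S' = 0 := by
    rw [← hx, hxp]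
    simp only [p, Finset.sum_add_distrib, hw0, hw0', ← Finset.mul_sum, hsA, hsB]
    simp [hN]
    ring
  have hformp : shiftedForm G θ p = -((n + n' + 1) * δ * t ^ 2) -
      a ^ 2 * ((c - δ * h) * S) - b ^ 2 * ((c' - δ * h') * S') := by
    have h1 : ∀ v, p v * (nbrSum G p v - θ * p v) =
        t * (nbrSum G p v - θ * p v) + (a * (t * δ + a * (δ * h - c)) * f v +
          b * (t * δ + b * (δ * h' - c')) * f' v) := fun v => by
      rcases hcut.cover v with hv | hv | rfl
      · rw [hpA v hv]
        simp only [p, hfoff' v (Finset.disjoint_left.mp hcut.disj hv)]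
        ring
      · rw [hpB v hv]
        simp only [p, hfoff v (Finset.disjoint_right.mp hcut.disj hv)]
        ring
      · simp only [p, hfoff v hcut.left.notMem, hfoff' v hcut.right.notMem]
        ring
    have h2 : shiftedForm G θ p = ∑ v, p v * (nbrSum G p v - θ * p v) := by
      simp only [shiftedForm, adjForm, Finset.mul_sum, ← Finset.sum_sub_distrib]
      exact Finset.sum_congr rfl fun v _ => by ring
    -- By regularity this sum is `(d - θ) ∑ p`, and `p` sums to zero along with `x`, `w` and `w'`.
    -- The value at `u` therefore never has to be computed.
    have h3 : ∑ v, (nbrSum G p v - θ * p v) = 0 := by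
      have h4 : ∑ v, nbrSum G p v = d * ∑ v, p v := by
        have := adjForm_comm G (fun _ => 1) p
        simp only [adjForm, hreg, one_mul, ← Finset.sum_mul] at this
        rw [this]
        ring
      have h5 : ∑ v, p v = 0 := by
        have : ∑ v, x v = ∑ v, ((w v + w' v) + p v) := by rw [← hxp]
        rw [hx, Finset.sum_add_distrib, Finset.sum_add_distrib, hw0, hw0'] at this
        linarith
      rw [Finset.sum_sub_distrib, ← Finset.mul_sum, h4, h5]
      ring
    simp only [h2, h1, Finset.sum_add_distrib, ← Finset.mul_sum, hsA, hsB, h3]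
    linear_combination (t * δ) * hconstr
  rw [hxp, shiftedForm_add, shiftedForm_add, hcross, hcrossw, hformp]
  suffices 0 ≤ (n + n' + 1) * δ * t ^ 2 + a ^ 2 * ((c - δ * h) * S) +
      b ^ 2 * ((c' - δ * h') * S') by linarith
  -- This is the coefficient of `b²` once `t` is eliminated; `hD` provides its sign. As the
  -- determinant vanishes by `hdet0`, the form in `a` and `b` is then a square divided by a positive
  -- number.
  have hM : 0 < (n + n' + 1) * ((c' - δ * h') * S') + δ * S' ^ 2 := by
    have h7 := mul_nonneg hNpos.le (mul_nonneg (sub_nonneg.mpr hD) hS'.le)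
    have h8 := mul_pos hδ0 (pow_pos hS' 2)
    linarith
  have hdet0 : (n + n' + 1) * ((c - δ * h) * (c' - δ * h')) +
      δ * (S * (c' - δ * h') + S' * (c - δ * h)) = 0 := by
    rw [hdet, heq]
    ring
  have e : ((n + n' + 1) * ((c' - δ * h') * S') + δ * S' ^ 2) * ((n + n' + 1) *
      ((n + n' + 1) * δ * t ^ 2 + a ^ 2 * ((c - δ * h) * S) + b ^ 2 * ((c' - δ * h') * S'))) =
      (((n + n' + 1) * ((c' - δ * h') * S') + δ * S' ^ 2) * b + δ * S * S' * a) ^ 2 := by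
    have ht : (n + n' + 1) * t = -(a * S + b * S') := by linarith
    have ht2 : (n + n' + 1) * ((n + n' + 1) * δ * t ^ 2) = δ * (a * S + b * S') ^ 2 := by
      rw [show (n + n' + 1) * ((n + n' + 1) * δ * t ^ 2) = δ * ((n + n' + 1) * t) ^ 2 by ring, ht]
      ring
    linear_combination ((n + n' + 1) * ((c' - δ * h') * S') + δ * S' ^ 2) * ht2 +
      a ^ 2 * S * S' * (n + n' + 1) * hdet0
  have h6 : 0 ≤ (n + n' + 1) *
      ((n + n' + 1) * δ * t ^ 2 + a ^ 2 * ((c - δ * h) * S) + b ^ 2 * ((c' - δ * h') * S')) := by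
    refine nonneg_of_mul_nonneg_right (a := _) ?_ hM
    rw [e]
    exact sq_nonneg _
  exact nonneg_of_mul_nonneg_right h6 hNpos

end Decomposition

/-! ### The gap equation and its monotonicity -/

/-- The equation that determines the gap `δ = d - λ₂` of the extremal graphs has a root for which
the larger side dominates. -/
theorem exists_gap {d c c' k k' : ℝ} (hd : c + c' = d) (hc : 1 ≤ c) (hcc : c ≤ c')
    (hk : 0 ≤ k) (hk' : 0 ≤ k') (hkk : k' - k ≤ c' - c) :
    ∃ δ : ℝ, 0 < δ ∧ δ < 1 ∧
      c * c' * ((d + 2 + k - δ) + (d + 2 + k' - δ) - 1) =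
        (d - δ) * δ * ((d + 2 + k - δ) * (d + 2 + k' - δ)) ∧
      δ * (d + 2 + k' - δ) ≤ c' := by
  -- At `δ₀` the second diagonal factor `c' - δ h'` vanishes, so the sign of the determinant can be
  -- read off there.
  obtain ⟨δ₀, ⟨h0, h1⟩, hφ⟩ : ∃ δ₀ ∈ Set.Icc (0 : ℝ) 1, δ₀ * (d + 2 + k' - δ₀) = c' := by
    refine intermediate_value_Icc zero_le_one (f := fun δ : ℝ => δ * (d + 2 + k' - δ))
      (by fun_prop) ⟨?_, ?_⟩
    · simp only [zero_mul]
      linarith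
    · simp only [one_mul]
      linarith
  have hδ₀ : δ₀ < 1 := by
    refine lt_of_le_of_ne h1 fun e => ?_
    rw [e] at hφ
    linarith
  -- Since `δ₀ h' = c'`, the left side equals `(c - c') + δ₀ (k' - k)`.
  have hD : c - δ₀ * (d + 2 + k - δ₀) ≤ 0 := by
    have : δ₀ * (k' - k) ≤ c' - c := by
      by_cases h : 0 ≤ k' - k
      · nlinarith
      · nlinarith
    linarith
  have hS : 0 ≤ (d + 1 + k') * (d + 2 + k' - δ₀) - c' := by nlinarith
  have hdet := cut_determinant (n := d + 1 + k) (n' := d + 1 + k') (δ := δ₀)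
    (h := d + 2 + k - δ₀) (h' := d + 2 + k' - δ₀) hd (by ring) (by ring)
  rw [hφ] at hdet
  have hΨ : c * c' * ((d + 2 + k - δ₀) + (d + 2 + k' - δ₀) - 1) -
      (d - δ₀) * δ₀ * ((d + 2 + k - δ₀) * (d + 2 + k' - δ₀)) ≤ 0 := by
    rw [← hdet]
    have := mul_nonneg h0 (mul_nonneg hS (neg_nonneg.mpr hD))
    linarith
  -- The determinant is positive at `0` and at most `0` at `δ₀`; a root no larger than `δ₀` keeps `δ
  -- h' ≤ c'`.
  obtain ⟨δ, ⟨g0, g1⟩, hδ⟩ : ∃ δ ∈ Set.Icc (0 : ℝ) δ₀,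
      c * c' * ((d + 2 + k - δ) + (d + 2 + k' - δ) - 1) -
      (d - δ) * δ * ((d + 2 + k - δ) * (d + 2 + k' - δ)) = 0 := by
    refine intermediate_value_Icc' h0 (f := fun δ : ℝ =>
      c * c' * ((d + 2 + k - δ) + (d + 2 + k' - δ) - 1) -
      (d - δ) * δ * ((d + 2 + k - δ) * (d + 2 + k' - δ))) (by fun_prop) ⟨hΨ, ?_⟩
    have : 0 ≤ c * c' * ((d + 2 + k) + (d + 2 + k') - 1) :=
      mul_nonneg (by nlinarith) (by linarith)
    simpa using this
  refine ⟨δ, lt_of_le_of_ne g0 fun e => ?_, by linarith, by linarith, ?_⟩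
  · subst e
    have : 0 < c * c' * ((d + 2 + k) + (d + 2 + k') - 1) :=
      mul_pos (by nlinarith) (by linarith)
    simp only [sub_zero, mul_zero, zero_mul] at hδ
    linarith
  -- The function `t (d + 2 + k' - t)` increases on `[0, 1]` and equals `c'` at `δ₀`.
  · nlinarith

/-- Monotonicity of the determinant condition in the sizes of the sides and in the product of the
numbers of contacts. -/
theorem determinant_mono {P P₀ h h' h₀ h₀' X : ℝ} (hP0 : 0 < P) (hP : P ≤ P₀) (hh₀ : 1 < h₀)
    (hh₀' : 1 < h₀') (hh : h₀ ≤ h) (hh' : h₀' ≤ h')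
    (heq : P₀ * (h₀ + h₀' - 1) = X * (h₀ * h₀')) :
    P * (h + h' - 1) ≤ X * (h * h') ∧
    ((P < P₀ ∨ h₀ < h ∨ h₀' < h') → P * (h + h' - 1) < X * (h * h')) := by
  -- This is `1 - 1/h₀ ≤ 1 - 1/h` with denominators cleared; the product of the two such
  -- inequalities gives `hg`.
  have e1 : (h₀ - 1) * h ≤ (h - 1) * h₀ := by linarith
  have e2 : (h₀' - 1) * h' ≤ (h' - 1) * h₀' := by linarith
  have p0 : 0 < h₀ * h₀' := by nlinarith
  have p1 : 0 < h * h' := by nlinarith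
  have q1 : 0 < (h₀ - 1) * h := mul_pos (by linarith) (by linarith)
  have q2 : 0 < (h₀' - 1) * h' := mul_pos (by linarith) (by linarith)
  have m : (h₀ - 1) * h * ((h₀' - 1) * h') ≤ (h - 1) * h₀ * ((h' - 1) * h₀') :=
    mul_le_mul e1 e2 q2.le (q1.le.trans e1)
  have hg : (h + h' - 1) * (h₀ * h₀') ≤ (h₀ + h₀' - 1) * (h * h') := by linarith
  have gpos : 0 < (h₀ + h₀' - 1) * (h * h') := mul_pos (by linarith) p1
  have hmain : P * ((h + h' - 1) * (h₀ * h₀')) ≤ P₀ * ((h₀ + h₀' - 1) * (h * h')) :=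
    mul_le_mul hP hg (mul_nonneg (by linarith) p0.le) (hP0.le.trans hP)
  have eX : X * (h * h') * (h₀ * h₀') = P₀ * ((h₀ + h₀' - 1) * (h * h')) := by
    linear_combination (-(h * h')) * heq
  constructor
  · refine le_of_mul_le_mul_right ?_ p0
    rw [eX]
    linarith
  · intro hs
    refine lt_of_mul_lt_mul_right ?_ p0.le
    rw [eX]
    rcases hs with hs | hs | hs
    · have := mul_lt_mul_of_pos_right hs gpos
      have := mul_le_mul_of_nonneg_left hg hP0.le
      linarith
    · have h1 : (h₀ - 1) * h < (h - 1) * h₀ := by linarith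
      have h2 := mul_lt_mul_of_pos_right h1 q2
      have h3 := mul_le_mul_of_nonneg_left e2 (q1.le.trans e1)
      have h4 : (h + h' - 1) * (h₀ * h₀') < (h₀ + h₀' - 1) * (h * h') := by linarith
      have := mul_lt_mul_of_pos_left h4 hP0
      have := mul_le_mul_of_nonneg_right hP gpos.le
      linarith
    · have h1 : (h₀' - 1) * h' < (h' - 1) * h₀' := by linarith
      have h2 := mul_lt_mul_of_pos_left h1 q1
      have h3 := mul_le_mul_of_nonneg_right e1 (q2.le.trans e2)
      have h4 : (h + h' - 1) * (h₀ * h₀') < (h₀ + h₀' - 1) * (h * h') := by linarith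
      have := mul_lt_mul_of_pos_left h4 hP0
      have := mul_le_mul_of_nonneg_right hP gpos.le
      linarith

/-! ### Parity and sizes of the sides, and cut vertices -/

section Sizes

open scoped Classical

variable {V : Type*} [Fintype V] {G : SimpleGraph V} {d : ℕ} {u : V} {A B : Finset V}

theorem nbrSum_one (v : V) : nbrSum G (fun _ => 1) v = G.degree v := by
  simp [nbrSum, ← SimpleGraph.card_neighborFinset_eq_degree, SimpleGraph.neighborFinset_eq_filter]

theorem IsSide.sum_card_filter (hA : IsSide G u A) (hreg : ∀ v, nbrSum G (fun _ => 1) v = d) :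
    ∑ v ∈ A, (A.filter (G.Adj v)).card + (contacts G u A).card = d * A.card := by
  have : ∀ v ∈ A, (A.filter (G.Adj v)).card + (if G.Adj u v then 1 else 0) = d := fun v hv => by
    have h := hA.nbrSum_ind_of_mem hreg hv
    rw [nbrSum_ind, eq_sub_iff_add_eq] at h
    exact_mod_cast h
  have h := Finset.sum_congr rfl this
  rw [Finset.sum_add_distrib, ← Finset.card_filter, Finset.sum_const, smul_eq_mul, mul_comm] at h
  exact h

theorem even_sum_card_filter (A : Finset V) : Even (∑ v ∈ A, (A.filter (G.Adj v)).card) := by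
  let H : SimpleGraph V :=
    { Adj := fun v w => G.Adj v w ∧ v ∈ A ∧ w ∈ A
      symm := ⟨fun v w h => ⟨h.1.symm, h.2.2, h.2.1⟩⟩
      loopless := ⟨fun v h => h.1.ne rfl⟩ }
  have h := H.sum_degrees_eq_twice_card_edges
  have h2 : ∑ v, H.degree v = ∑ v ∈ A, (A.filter (G.Adj v)).card := by
    rw [← Finset.sum_subset (Finset.subset_univ A)]
    · refine Finset.sum_congr rfl fun v hv => ?_
      rw [← SimpleGraph.card_neighborFinset_eq_degree, SimpleGraph.neighborFinset_eq_filter]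
      congr 1
      ext w
      simp [H, hv, and_comm]
    · intro v _ hv
      rw [← SimpleGraph.card_neighborFinset_eq_degree, SimpleGraph.neighborFinset_eq_filter]
      simp [H, hv]
  rw [← h2, h]
  exact even_two_mul _

/-- The degrees inside `A` sum to `d |A| - c`, which is twice the number of edges inside `A`. -/
theorem IsSide.even_add (hA : IsSide G u A) (hreg : ∀ v, nbrSum G (fun _ => 1) v = d) :
    Even (d * A.card + (contacts G u A).card) := by
  have h1 := hA.sum_card_filter hreg
  have h2 := even_sum_card_filter (G := G) A
  rw [← h1]
  have : Even ((contacts G u A).card + (contacts G u A).card) := ⟨_, rfl⟩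
  rw [add_assoc]
  exact h2.add this

theorem card_filter_adj_lt {v : V} (hv : v ∈ A) : (A.filter (G.Adj v)).card < A.card :=
  Finset.card_lt_card (Finset.filter_ssubset.mpr ⟨v, hv, fun h => h.ne rfl⟩)

/-- A side has more than `d` vertices. -/
theorem IsSide.lt_card (hA : IsSide G u A) (hreg : ∀ v, nbrSum G (fun _ => 1) v = d)
    (hA0 : A.Nonempty) (hc : (contacts G u A).card < d) : d < A.card := by
  have hnb (v) (hv : v ∈ A) : (A.filter (G.Adj v)).card + (if G.Adj u v then 1 else 0) = d := by
    have h := hA.nbrSum_ind_of_mem hreg hv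
    rw [nbrSum_ind, eq_sub_iff_add_eq] at h
    exact_mod_cast h
  -- A vertex away from `u` has all its `d` neighbours in `A`. If there is none, then `A` consists
  -- of contacts, each with `d - 1` neighbours in `A`, so there are at least `d` contacts, against
  -- `hc`.
  by_cases h : ∃ v ∈ A, ¬ G.Adj u v
  · obtain ⟨v, hv, huv⟩ := h
    have h1 := hnb v hv
    have h2 := card_filter_adj_lt (G := G) hv
    rw [if_neg huv] at h1
    omega
  · push Not at h
    obtain ⟨v, hv⟩ := hA0
    have h1 := hnb v hv
    have h2 := card_filter_adj_lt (G := G) hv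
    rw [if_pos (h v hv)] at h1
    have : contacts G u A = A := Finset.filter_true_of_mem h
    rw [this] at hc
    omega

/-- A connected graph has an edge from the cut vertex to each side. -/
theorem IsSide.contacts_card_pos (hA : IsSide G u A) (hconn : G.Connected) (hA0 : A.Nonempty) :
    0 < (contacts G u A).card := by
  rw [Finset.card_pos]
  by_contra hne
  rw [Finset.not_nonempty_iff_eq_empty] at hne
  obtain ⟨a, ha⟩ := hA0
  -- Without contacts no walk can leave `A`, and so none reaches `u`.
  have key : ∀ v w, G.Walk v w → v ∈ A → w ∈ A := by
    intro v w p
    induction p with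
    | nil => exact id
    | cons hadj _ ih =>
      intro hv
      refine ih ((hA.closed _ hv _ hadj).resolve_right fun e => ?_)
      subst e
      have : _ ∈ contacts G _ A := (mem_contacts G).mpr ⟨hv, hadj.symm⟩
      rw [hne] at this
      simp at this
  obtain ⟨p⟩ := hconn.preconnected a u
  exact hA.notMem (key a u p ha)

/-- A cut vertex splits the graph into two nonempty sides. -/
theorem IsCutVertex.exists_decomposition (h : IsCutVertex G u) :
    ∃ A B : Finset V, IsCutDecomposition G u A B ∧ A.Nonempty ∧ B.Nonempty := by
  unfold IsCutVertex SimpleGraph.Preconnected at h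
  push Not at h
  obtain ⟨a, b, hab⟩ := h
  -- One side is the component of `a` in `G - u`; all other components together form the second
  -- side.
  let A : Finset V := Finset.univ.filter fun v =>
    ∃ hv : v ∉ ({u} : Set V), (deleteVertices G {u}).Reachable a ⟨v, hv⟩
  let B : Finset V := Finset.univ.filter fun v =>
    ∃ hv : v ∉ ({u} : Set V), ¬ (deleteVertices G {u}).Reachable a ⟨v, hv⟩
  have hstep {v w : V} (hv : v ∉ ({u} : Set V)) (hw : w ∉ ({u} : Set V)) (hvw : G.Adj v w) :
      (deleteVertices G {u}).Reachable ⟨v, hv⟩ ⟨w, hw⟩ := by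
    refine SimpleGraph.Adj.reachable ?_
    exact hvw
  refine ⟨A, B, ⟨⟨by simp [A], ?_⟩, ⟨by simp [B], ?_⟩, ?_, ?_⟩, ⟨a.1, ?_⟩, ⟨b.1, ?_⟩⟩
  · intro v hv w hvw
    simp only [A, Finset.mem_filter, Finset.mem_univ, true_and] at hv ⊢
    obtain ⟨hv, hr⟩ := hv
    by_cases hw : w ∈ ({u} : Set V)
    · exact Or.inr hw
    · exact Or.inl ⟨hw, hr.trans (hstep hv hw hvw)⟩
  · intro v hv w hvw
    simp only [B, Finset.mem_filter, Finset.mem_univ, true_and] at hv ⊢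
    obtain ⟨hv, hr⟩ := hv
    by_cases hw : w ∈ ({u} : Set V)
    · exact Or.inr hw
    · exact Or.inl ⟨hw, fun h => hr (h.trans (hstep hw hv hvw.symm))⟩
  · rw [Finset.disjoint_left]
    intro v hv hv'
    simp only [A, B, Finset.mem_filter, Finset.mem_univ, true_and] at hv hv'
    obtain ⟨_, hr⟩ := hv
    obtain ⟨_, hr'⟩ := hv'
    exact hr' hr
  · intro v
    by_cases hv : v = u
    · simp [hv]
    · by_cases hr : (deleteVertices G {u}).Reachable a ⟨v, hv⟩
      · exact Or.inl (by simpa [A] using ⟨hv, hr⟩)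
      · exact Or.inr (Or.inl (by simpa [B] using ⟨hv, hr⟩))
  · simp only [A, Finset.mem_filter, Finset.mem_univ, true_and]
    exact ⟨a.2, SimpleGraph.Reachable.refl _⟩
  · simp only [B, Finset.mem_filter, Finset.mem_univ, true_and]
    exact ⟨b.2, hab⟩

/-- Two nonempty sides make a cut vertex. -/
theorem IsCutDecomposition.isCutVertex (h : IsCutDecomposition G u A B) (hA0 : A.Nonempty)
    (hB0 : B.Nonempty) : IsCutVertex G u := by
  intro hpre
  obtain ⟨a, ha⟩ := hA0
  obtain ⟨b, hb⟩ := hB0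
  have hau : a ∉ ({u} : Set V) := fun e => h.left.notMem (Set.mem_singleton_iff.mp e ▸ ha)
  have hbu : b ∉ ({u} : Set V) := fun e => h.right.notMem (Set.mem_singleton_iff.mp e ▸ hb)
  have key : ∀ v w, (deleteVertices G {u}).Walk v w → v.1 ∈ A → w.1 ∈ A := by
    intro v w p
    induction p with
    | nil => exact id
    | @cons x y z hadj _ ih =>
      intro hv
      exact ih ((h.left.closed _ hv _ hadj).resolve_right y.2)
  obtain ⟨p⟩ := hpre ⟨a, hau⟩ ⟨b, hbu⟩
  exact Finset.disjoint_left.mp h.disj (key _ _ p ha) hb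

end Sizes

/-! ### Graphs regular of degree two or one -/

section TwoRegular

variable {V : Type*}

theorem ncard_neighborSet_cycleGraph {n : ℕ} (hn : 3 ≤ n) (v : Fin n) :
    ((SimpleGraph.cycleGraph n).neighborSet v).ncard = 2 := by
  obtain ⟨m, rfl⟩ := Nat.exists_eq_add_of_le' hn
  have h := SimpleGraph.cycleGraph_degree_three_le (v := v)
  rw [← h, ← SimpleGraph.card_neighborSet_eq_degree, ← Nat.card_coe_set_eq, Nat.card_eq_fintype_card]

/-- A connected `2`-regular graph is a cycle. -/
theorem SimpleGraph.Connected.exists_iso_cycleGraph [Finite V] {H : SimpleGraph V}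
    (hconn : H.Connected) (h2 : ∀ v, (H.neighborSet v).ncard = 2) :
    ∃ n : ℕ, 3 ≤ n ∧ Nonempty (H ≃g SimpleGraph.cycleGraph n) := by
  obtain ⟨v⟩ := hconn.nonempty
  have hcyc : H.IsCycles := fun v _ => h2 v
  have hne : (H.neighborSet v).Nonempty := by
    rw [← Set.ncard_pos, h2]
    norm_num
  obtain ⟨p, hp, -⟩ := hcyc.exists_cycle_toSubgraph_verts_eq_connectedComponentSupp
    (c := H.connectedComponentMk v) rfl hne
  have hn := hp.three_le_length
  obtain ⟨φ⟩ := (SimpleGraph.cycleGraph_isContained_iff hn).mpr ⟨v, p, hp, rfl⟩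
  refine ⟨p.length, hn, ?_⟩
  set n := p.length
  -- Both neighbourhoods have two elements, so the cycle fills the neighbourhood of each of its
  -- vertices. With connectedness this makes `φ` surjective, and it also rules out chords.
  have himage (i : Fin n) : φ.toHom '' (SimpleGraph.cycleGraph n).neighborSet i =
      H.neighborSet (φ.toHom i) := by
    refine Set.eq_of_subset_of_ncard_le ?_ ?_
    · rintro _ ⟨j, hj, rfl⟩
      exact φ.toHom.map_adj hj
    · rw [h2, Set.ncard_image_of_injective _ φ.injective', ncard_neighborSet_cycleGraph hn]
  have hsurj : Function.Surjective φ.toHom := by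
    have key : ∀ x y, H.Walk x y → x ∈ Set.range φ.toHom → y ∈ Set.range φ.toHom := by
      intro x y q
      induction q with
      | nil => exact id
      | cons hadj _ ih =>
        rintro ⟨i, rfl⟩
        apply ih
        have hmem : _ ∈ H.neighborSet (φ.toHom i) := hadj
        rw [← himage] at hmem
        obtain ⟨j, -, hj⟩ := hmem
        exact ⟨j, hj⟩
    intro y
    obtain ⟨q⟩ := hconn.preconnected (φ.toHom ⟨0, by omega⟩) y
    exact key _ _ q ⟨_, rfl⟩
  let e := Equiv.ofBijective φ.toHom ⟨φ.injective', hsurj⟩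
  refine ⟨SimpleGraph.Iso.symm ⟨e, fun {i j} => ⟨fun hij => ?_, fun hij => φ.toHom.map_adj hij⟩⟩⟩
  have hmem : φ.toHom j ∈ H.neighborSet (φ.toHom i) := hij
  rw [← himage] at hmem
  obtain ⟨k, hk, hkj⟩ := hmem
  exact φ.injective' hkj ▸ hk

theorem SimpleGraph.Iso.ncard_neighborSet {W : Type*} {G : SimpleGraph V} {H : SimpleGraph W}
    (e : G ≃g H) (v : V) : (H.neighborSet (e v)).ncard = (G.neighborSet v).ncard := by
  rw [← Set.ncard_image_of_injective _ e.injective]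
  congr 1
  ext w
  constructor
  · intro hw
    refine ⟨e.symm w, ?_, by simp⟩
    rw [SimpleGraph.mem_neighborSet, ← e.map_adj_iff]
    simpa using hw
  · rintro ⟨x, hx, rfl⟩
    exact e.map_adj_iff.mpr hx

theorem ncard_neighborSet_component {H : SimpleGraph V} (C : H.ConnectedComponent) (v : C) :
    (C.toSimpleGraph.neighborSet v).ncard = (H.neighborSet v.1).ncard := by
  rw [← Set.ncard_image_of_injective _ Subtype.val_injective]
  congr 1
  ext w
  constructor
  · rintro ⟨x, hx, rfl⟩
    exact hx
  · intro hw
    have hwC : w ∈ C.supp := (C.mem_supp_congr_adj hw).mp v.2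
    exact ⟨⟨w, hwC⟩, hw, rfl⟩

/-- This reduces the cycle structure to a count of neighbours, the only information that equality in
the spectral bounds supplies. -/
theorem isUnionOfCycles_iff [Finite V] {H : SimpleGraph V} :
    IsUnionOfCycles H ↔ ∀ v, (H.neighborSet v).ncard = 2 := by
  constructor
  · intro h v
    obtain ⟨n, hn, ⟨e⟩⟩ := h (H.connectedComponentMk v)
    have h1 := ncard_neighborSet_component (H.connectedComponentMk v) ⟨v, rfl⟩
    rw [← h1, ← e.ncard_neighborSet, ncard_neighborSet_cycleGraph hn]
  · intro h C
    exact C.connected_toSimpleGraph.exists_iso_cycleGraph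
      fun v => (ncard_neighborSet_component C v).trans (h v)

end TwoRegular

section OneRegular

variable {V : Type*} [Fintype V]

/-- A `1`-regular graph is a perfect matching. -/
theorem nonempty_iso_matchingGraph {H : SimpleGraph V} (h1 : ∀ v, ∃! w, H.Adj v w) {n : ℕ}
    (hn : Fintype.card V = n) : Nonempty (H ≃g matchingGraph n) := by
  classical
  choose m hm huniq using h1
  have hmm (v) : m (m v) = v := (huniq (m v) v (hm v).symm).symm
  have hne (v) : m v ≠ v := (hm v).ne'
  have hadj {v w} : H.Adj v w ↔ w = m v := ⟨huniq v w, fun e => e ▸ hm v⟩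
  let k : V ≃ Fin (Fintype.card V) := Fintype.equivFin V
  let R : Type _ := {v : V // k v < k (m v)}
  have hlt (v) (hv : ¬ k v < k (m v)) : k (m v) < k (m (m v)) := by
    rw [hmm]
    exact lt_of_le_of_ne (not_lt.mp hv) fun e => hne v (k.injective e)
  -- A vertex is coded by the endpoint of its edge with the smaller number and by a bit telling
  -- whether it is the other endpoint. Halving `2 * pair + bit` recovers the edge.
  let f : V ≃ R × Fin 2 :=
    { toFun := fun v => if hv : k v < k (m v) then (⟨v, hv⟩, 0) else (⟨m v, hlt v hv⟩, 1)
      invFun := fun p => if p.2 = 0 then p.1.1 else m p.1.1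
      left_inv := fun v => by
        by_cases hv : k v < k (m v)
        · simp [hv]
        · simp [hv, hmm]
      right_inv := fun p => by
        obtain ⟨⟨v, hv⟩, i⟩ := p
        fin_cases i
        · simp [hv]
        · simp [hmm, hv.not_gt] }
  have hcard : n = Fintype.card R * 2 :=
    hn.symm.trans ((Fintype.card_congr f).trans (by simp))
  let r : R ≃ Fin (Fintype.card R) := Fintype.equivFin R
  let e : V ≃ Fin n := (f.trans (r.prodCongr (Equiv.refl _))).trans
    (finProdFinEquiv.trans (finCongr hcard.symm))
  have hval (v) : (e v : ℕ) = (f v).2 + 2 * (r (f v).1) := by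
    simp [e, finProdFinEquiv]
  have hdiv (v) : (e v : ℕ) / 2 = r (f v).1 := by
    have := (f v).2.isLt
    rw [hval]
    omega
  have hf (v w) : (f v).1 = (f w).1 ↔ w = v ∨ w = m v := by
    have hfv (v) : ((f v).1 : V) = v ∨ ((f v).1 : V) = m v := by
      simp only [f, Equiv.coe_fn_mk]
      split_ifs <;> simp
    constructor
    · intro h
      have h' : ((f v).1 : V) = (f w).1 := by rw [h]
      rcases hfv v with h2 | h2 <;> rcases hfv w with h3 | h3
      · exact Or.inl (by rw [← h3, ← h', h2])
      · right
        rw [← hmm w, ← h3, ← h', h2]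
      · right
        rw [← h3, ← h', h2]
      · left
        rw [← hmm w, ← h3, ← h', h2, hmm]
    · rintro (rfl | rfl)
      · rfl
      · by_cases hv : k v < k (m v)
        · simp [f, hv, hmm, hv.not_gt]
        · have := hlt v hv
          rw [hmm] at this
          simp [f, hv, hmm, this]
  refine ⟨⟨e, fun {v w} => ?_⟩⟩
  change (e v ≠ e w ∧ (e v : ℕ) / 2 = (e w : ℕ) / 2) ↔ _
  rw [hdiv, hdiv, ← Fin.ext_iff, r.apply_eq_iff_eq, hf, hadj, Ne, e.apply_eq_iff_eq]
  constructor
  · rintro ⟨h1, rfl | h2⟩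
    · exact absurd rfl h1
    · exact h2
  · rintro rfl
    exact ⟨(hne v).symm, Or.inr rfl⟩

end OneRegular

/-! ### Recognizing the cells and the sequential join -/

section Cells

open scoped Classical

variable {V : Type*} [Fintype V] {G : SimpleGraph V}

/-- The number of non-neighbours of `v` in `s`, apart from `v` itself. -/
noncomputable def coDegree (G : SimpleGraph V) (s : Finset V) (v : V) : ℕ :=
  (s.filter fun w => w ≠ v ∧ ¬ G.Adj v w).card

theorem SimpleGraph.Iso.compl_symm_adj {W : Type*} {H : SimpleGraph V} {K : SimpleGraph W}
    (e : Hᶜ ≃g K) : Nonempty (H ≃g Kᶜ) := by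
  refine ⟨⟨e.toEquiv, fun {v w} => ?_⟩⟩
  have := e.map_adj_iff (v := v) (w := w)
  change (e v ≠ e w ∧ ¬ K.Adj (e v) (e w)) ↔ _
  rw [this, Ne, e.injective.eq_iff, SimpleGraph.compl_adj]
  refine ⟨fun h => ?_, fun h => ⟨h.ne, fun h' => h'.2 h⟩⟩
  by_contra hH
  exact h.2 ⟨h.1, hH⟩

theorem coDegree_add {s : Finset V} {v : V} (hv : v ∈ s) :
    coDegree G s v + (s.filter (G.Adj v)).card + 1 = s.card := by
  have h1 := Finset.card_filter_add_card_filter_not (s := s) (G.Adj v)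
  have h2 : s.filter (fun w => ¬ G.Adj v w) = insert v (s.filter fun w => w ≠ v ∧ ¬ G.Adj v w) := by
    ext w
    by_cases hw : w = v
    · subst hw
      simp [hv]
    · simp [hw]
  rw [h2, Finset.card_insert_of_notMem (by simp)] at h1
  rw [coDegree]
  omega

theorem nonempty_iso_completeG {s : Finset V} {n : ℕ} (hn : s.card = n)
    (h : ∀ v ∈ s, coDegree G s v = 0) : Nonempty (G.induce (s : Set V) ≃g (completeG n).2) := by
  refine ⟨⟨s.equivFinOfCardEq hn, fun {v w} => ?_⟩⟩
  change s.equivFinOfCardEq hn v ≠ s.equivFinOfCardEq hn w ↔ G.Adj v.1 w.1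
  rw [Ne, Equiv.apply_eq_iff_eq]
  refine ⟨fun hvw => ?_, fun hvw e => hvw.ne (by rw [e])⟩
  by_contra hG
  have h0 := h v.1 v.2
  rw [coDegree, Finset.card_eq_zero] at h0
  have : w.1 ∈ (s.filter fun w => w ≠ v.1 ∧ ¬ G.Adj v.1 w) := by
    simp only [Finset.mem_filter]
    exact ⟨w.2, fun e => hvw (Subtype.ext e.symm), hG⟩
  rw [h0] at this
  simp at this

theorem ncard_compl_induce {s : Finset V} (v : (s : Set V)) :
    ((G.induce (s : Set V))ᶜ.neighborSet v).ncard = coDegree G s v.1 := by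
  rw [← Set.ncard_image_of_injective _ Subtype.val_injective, coDegree, ← Set.ncard_coe_finset]
  congr 1
  ext w
  simp only [Set.mem_image, SimpleGraph.mem_neighborSet, SimpleGraph.compl_adj, Finset.coe_filter,
    Set.mem_ofPred_eq]
  constructor
  · rintro ⟨x, ⟨h1, h2⟩, rfl⟩
    exact ⟨x.2, fun e => h1 (Subtype.ext e.symm), h2⟩
  · rintro ⟨hw, h1, h2⟩
    exact ⟨⟨w, hw⟩, ⟨fun e => h1 (by rw [e]), h2⟩, rfl⟩

theorem nonempty_iso_coMatching {s : Finset V} {n : ℕ} (hn : s.card = n)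
    (h : ∀ v ∈ s, coDegree G s v = 1) : Nonempty (G.induce (s : Set V) ≃g (coMatching n).2) := by
  have h1 : ∀ v : (s : Set V), ∃! w, (G.induce (s : Set V))ᶜ.Adj v w := fun v => by
    have h2 := ncard_compl_induce (G := G) v
    rw [h v.1 v.2, Set.ncard_eq_one] at h2
    obtain ⟨w, hw⟩ := h2
    refine ⟨w, ?_, fun y hy => ?_⟩
    · have : w ∈ (G.induce (s : Set V))ᶜ.neighborSet v := by rw [hw]; rfl
      exact this
    · have : y ∈ (G.induce (s : Set V))ᶜ.neighborSet v := hy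
      rw [hw] at this
      exact this
  obtain ⟨e⟩ := nonempty_iso_matchingGraph h1 (n := n) (by simpa using hn)
  exact e.compl_symm_adj

/-- The cycle type is not determined by the count of non-neighbours, hence an existential over
`coCycles n` in place of one fixed graph. -/
theorem exists_iso_coCycles {s : Finset V} {n : ℕ} (hn : s.card = n)
    (h : ∀ v ∈ s, coDegree G s v = 2) :
    ∃ X ∈ coCycles n, Nonempty (G.induce (s : Set V) ≃g X.2) := by
  let e := s.equivFinOfCardEq hn
  let C : SimpleGraph (Fin n) := (G.induce (s : Set V))ᶜ.comap e.symm
  let φ : C ≃g (G.induce (s : Set V))ᶜ := ⟨e.symm, Iff.rfl⟩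
  refine ⟨⟨n, Cᶜ⟩, ⟨C, ?_, rfl⟩, φ.symm.compl_symm_adj⟩
  rw [isUnionOfCycles_iff]
  intro v
  rw [← φ.ncard_neighborSet, ncard_compl_induce]
  exact h _ (φ v).2

/-- A partition into cells that induce the given graphs, with consecutive cells fully joined and no
other edges between cells, identifies a graph with a sequential join. -/
theorem nonempty_iso_seqJoin {L : List FinGraph} (f : V → Fin L.length)
    (hcell : ∀ i, Nonempty (G.induce {v | f v = i} ≃g (L.get i).2))
    (hadj : ∀ v w, f v ≠ f w → (G.Adj v w ↔ (f v : ℕ) + 1 = f w ∨ (f w : ℕ) + 1 = f v)) :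
    Nonempty (G ≃g seqJoin L) := by
  have φ (i) := (hcell i).some
  let e : V ≃ Σ i : Fin L.length, Fin (L.get i).1 :=
    (Equiv.sigmaFiberEquiv f).symm.trans (Equiv.sigmaCongrRight fun i => (φ i).toEquiv)
  have he (v) : e v = ⟨f v, φ (f v) ⟨v, rfl⟩⟩ := rfl
  -- Relabels the cell of `w` as `i`, so that two vertices of the same cell can be compared inside
  -- one fibre.
  have hmk (w) (i) (hi : f w = i) :
      (⟨f w, φ (f w) ⟨w, rfl⟩⟩ : Σ i : Fin L.length, Fin (L.get i).1) = ⟨i, φ i ⟨w, hi⟩⟩ := by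
    subst hi
    rfl
  refine ⟨⟨e, fun {v w} => ?_⟩⟩
  rw [he, he]
  by_cases hvw : f v = f w
  · constructor
    · rintro (⟨i, a, b, h1, h2, hab⟩ | h | h)
      · obtain ⟨rfl, h1⟩ := Sigma.mk.inj_iff.mp h1
        obtain ⟨h2, h3⟩ := Sigma.mk.inj_iff.mp h2
        have hb : φ (f v) ⟨w, hvw.symm⟩ = b := by
          have := (hmk w _ hvw.symm).symm.trans (Sigma.mk.inj_iff.mpr ⟨h2, h3⟩)
          simpa using this
        rw [← eq_of_heq h1, ← hb, (φ (f v)).map_adj_iff] at hab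
        exact hab
      · simp only [hvw] at h
        omega
      · simp only [hvw] at h
        omega
    · intro h
      left
      refine ⟨f v, φ (f v) ⟨v, rfl⟩, φ (f v) ⟨w, hvw.symm⟩, rfl, hmk w _ hvw.symm, ?_⟩
      · exact (φ (f v)).map_adj_iff.mpr h
  · rw [hadj v w hvw]
    constructor
    · rintro (⟨i, a, b, h1, h2, -⟩ | h | h)
      · exact absurd ((Sigma.mk.inj_iff.mp h1).1.trans (Sigma.mk.inj_iff.mp h2).1.symm) hvw
      · exact Or.inl h
      · exact Or.inr h
    · rintro (h | h)
      · exact Or.inr (Or.inl h)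
      · exact Or.inr (Or.inr h)

end Cells

/-! ### Degrees, connectedness and cuts of sequential joins -/

section SeqJoin

open scoped Classical

theorem seqJoin_adj_same {L : List FinGraph} {i : Fin L.length} {a b : Fin (L.get i).1} :
    (seqJoin L).Adj ⟨i, a⟩ ⟨i, b⟩ ↔ (L.get i).2.Adj a b := by
  constructor
  · rintro (⟨j, a', b', h1, h2, hab⟩ | h | h)
    · obtain ⟨rfl, h1⟩ := Sigma.mk.inj_iff.mp h1
      obtain ⟨-, h2⟩ := Sigma.mk.inj_iff.mp h2
      rw [eq_of_heq h1, eq_of_heq h2]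
      exact hab
    · simp only at h
      omega
    · simp only at h
      omega
  · intro h
    exact Or.inl ⟨i, a, b, rfl, rfl, h⟩

theorem seqJoin_adj_of_ne {L : List FinGraph} {x y : Σ i : Fin L.length, Fin (L.get i).1}
    (h : x.1 ≠ y.1) :
    (seqJoin L).Adj x y ↔ (x.1 : ℕ) + 1 = (y.1 : ℕ) ∨ (y.1 : ℕ) + 1 = (x.1 : ℕ) := by
  constructor
  · rintro (⟨j, a', b', rfl, rfl, -⟩ | h')
    · exact absurd rfl h
    · exact h'
  · exact Or.inr

theorem seqJoin_adj_fst {L : List FinGraph} {x y : Σ i : Fin L.length, Fin (L.get i).1}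
    (h : (seqJoin L).Adj x y) :
    (x.1 : ℕ) = y.1 ∨ (x.1 : ℕ) + 1 = y.1 ∨ (y.1 : ℕ) + 1 = x.1 := by
  by_cases hxy : x.1 = y.1
  · exact Or.inl (by rw [hxy])
  · exact Or.inr ((seqJoin_adj_of_ne hxy).mp h)

/-- Neighbour sums of functions that are constant on the cells of a sequential join. -/
theorem nbrSum_seqJoin {L : List FinGraph} (r F : Fin L.length → ℝ)
    (hr : ∀ i a, nbrSum (L.get i).2 (fun _ => 1) a = r i)
    (x : Σ i : Fin L.length, Fin (L.get i).1) :
    nbrSum (seqJoin L) (fun y => F y.1) x =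
      ∑ j, if x.1 = j then F j * r j
        else if (x.1 : ℕ) + 1 = j ∨ (j : ℕ) + 1 = x.1 then F j * (L.get j).1 else 0 := by
  obtain ⟨i, a⟩ := x
  rw [nbrSum, Fintype.sum_sigma]
  refine Finset.sum_congr rfl fun j _ => ?_
  by_cases hij : i = j
  · subst hij
    rw [if_pos rfl, ← hr i a, nbrSum, Finset.mul_sum]
    exact Finset.sum_congr rfl fun b _ => by simp only [seqJoin_adj_same, mul_ite, mul_one, mul_zero]
  · rw [if_neg hij]
    have : ∀ b, (seqJoin L).Adj ⟨i, a⟩ ⟨j, b⟩ ↔ (i : ℕ) + 1 = j ∨ (j : ℕ) + 1 = i :=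
      fun b => seqJoin_adj_of_ne hij
    simp only [this]
    split_ifs <;> simp [mul_comm]

theorem card_filter_fst {L : List FinGraph} (p : Fin L.length → Prop) [DecidablePred p] :
    (Finset.univ.filter fun x : Σ i : Fin L.length, Fin (L.get i).1 => p x.1).card =
      ∑ i, if p i then (L.get i).1 else 0 := by
  rw [Finset.card_filter, Fintype.sum_sigma]
  refine Finset.sum_congr rfl fun i _ => ?_
  split_ifs <;> simp

/-- A sequential join of at least two nonempty graphs is connected. -/
theorem seqJoin_connected {L : List FinGraph} (hL : 2 ≤ L.length) (hpos : ∀ i, 0 < (L.get i).1) :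
    (seqJoin L).Connected := by
  let r : Σ i : Fin L.length, Fin (L.get i).1 := ⟨⟨0, by omega⟩, ⟨0, hpos _⟩⟩
  have key : ∀ (n : ℕ) (hn : n < L.length) (a), (seqJoin L).Reachable r ⟨⟨n, hn⟩, a⟩ := by
    intro n
    induction n with
    | zero =>
      intro hn a
      -- The first graph may be disconnected, so its vertices are linked through the second one.
      let s : Σ i : Fin L.length, Fin (L.get i).1 := ⟨⟨1, by omega⟩, ⟨0, hpos _⟩⟩
      have h1 : (seqJoin L).Adj r s := Or.inr (Or.inl rfl)
      have h2 : (seqJoin L).Adj s ⟨⟨0, hn⟩, a⟩ := Or.inr (Or.inr rfl)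
      exact h1.reachable.trans h2.reachable
    | succ n ih =>
      intro hn a
      have h2 : (seqJoin L).Adj ⟨⟨n, by omega⟩, ⟨0, hpos _⟩⟩ ⟨⟨n + 1, hn⟩, a⟩ :=
        Or.inr (Or.inl rfl)
      exact (ih (by omega) _).trans h2.reachable
  have : Nonempty (Σ i : Fin L.length, Fin (L.get i).1) := ⟨r⟩
  exact ⟨fun x y => (key x.1.1 x.1.2 x.2).symm.trans (key y.1.1 y.1.2 y.2)⟩

theorem nbrSum_compl {V : Type*} [Fintype V] (H : SimpleGraph V) (v : V) :
    nbrSum Hᶜ (fun _ => 1) v = Fintype.card V - 1 - nbrSum H (fun _ => 1) v := by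
  have h : nbrSum Hᶜ (fun _ => 1) v + nbrSum H (fun _ => 1) v + ∑ w, (if w = v then (1 : ℝ) else 0)
      = ∑ _w : V, (1 : ℝ) := by
    rw [nbrSum, nbrSum, ← Finset.sum_add_distrib, ← Finset.sum_add_distrib]
    refine Finset.sum_congr rfl fun w _ => ?_
    by_cases hw : w = v
    · subst hw
      simp
    · by_cases hH : H.Adj v w
      · simp [hw, hH]
      · simp [hw, hH, Ne.symm hw]
  simp at h
  linarith

theorem nbrSum_completeG (n : ℕ) (a : Fin (completeG n).1) :
    nbrSum (completeG n).2 (fun _ => 1) a = n - 1 := by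
  have h (a : Fin n) : nbrSum (⊤ : SimpleGraph (Fin n)) (fun _ => 1) a = n - 1 := by
    rw [← compl_bot, nbrSum_compl]
    simp [nbrSum]
  exact h a

theorem nbrSum_matchingGraph {n : ℕ} (hn : Even n) (a : Fin n) :
    nbrSum (matchingGraph n) (fun _ => 1) a = 1 := by
  have ha : (a : ℕ) < n := a.isLt
  -- The partner of an even vertex is its successor, which exists because `n` is even.
  let b : Fin n := if h : (a : ℕ) % 2 = 0 then ⟨a + 1, by obtain ⟨m, hm⟩ := hn; omega⟩
    else ⟨a - 1, by omega⟩
  have hb (w : Fin n) : (matchingGraph n).Adj a w ↔ w = b := by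
    change (¬ a = w ∧ (a : ℕ) / 2 = (w : ℕ) / 2) ↔ _
    rw [Fin.ext_iff, Fin.ext_iff]
    have hbv : (b : ℕ) = if (a : ℕ) % 2 = 0 then (a : ℕ) + 1 else a - 1 := by
      simp only [b]
      split_ifs <;> rfl
    rw [hbv]
    split_ifs <;> omega
  simp [nbrSum, hb]

theorem nbrSum_coMatching {n : ℕ} (hn : Even n) (a : Fin (coMatching n).1) :
    nbrSum (coMatching n).2 (fun _ => 1) a = n - 2 := by
  have h (a : Fin n) : nbrSum (matchingGraph n)ᶜ (fun _ => 1) a = n - 2 := by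
    rw [nbrSum_compl, Fintype.card_fin, nbrSum_matchingGraph hn]
    ring
  exact h a

theorem nbrSum_coCycles {n : ℕ} {X : FinGraph} (hX : X ∈ coCycles n) (a : Fin X.1) :
    X.1 = n ∧ nbrSum X.2 (fun _ => 1) a = n - 3 := by
  obtain ⟨C, hC, rfl⟩ := hX
  have h (a : Fin n) : nbrSum Cᶜ (fun _ => 1) a = n - 3 := by
    have h := isUnionOfCycles_iff.mp hC a
    rw [nbrSum_compl, nbrSum_one, ← SimpleGraph.card_neighborSet_eq_degree,
      ← Nat.card_eq_fintype_card (α := C.neighborSet a), Nat.card_coe_set_eq, h, Fintype.card_fin]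
    push_cast
    ring
  exact ⟨rfl, h a⟩

theorem coCycles_fst {n : ℕ} {X : FinGraph} (hX : X ∈ coCycles n) : X.1 = n := by
  obtain ⟨C, hC, rfl⟩ := hX
  rfl

theorem coCycles_nonempty {n : ℕ} (hn : 3 ≤ n) : (coCycles n).Nonempty :=
  ⟨_, SimpleGraph.cycleGraph n, isUnionOfCycles_iff.mpr (ncard_neighborSet_cycleGraph hn), rfl⟩

/-- The left side of the middle vertex of a sequential join of five graphs. -/
noncomputable def leftSide (L : List FinGraph) (k : ℕ) :
    Finset (Σ i : Fin L.length, Fin (L.get i).1) :=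
  Finset.univ.filter fun x => (x.1 : ℕ) < k

/-- The right side of the middle vertex of a sequential join. -/
noncomputable def rightSide (L : List FinGraph) (k : ℕ) :
    Finset (Σ i : Fin L.length, Fin (L.get i).1) :=
  Finset.univ.filter fun x => k < (x.1 : ℕ)

variable {L : List FinGraph}

/-- An edge changes the cell index by at most one, so a passage from lower to higher indices must
use the only vertex of the cell of `u`. -/
theorem seqJoin_decomposition (u : Σ i : Fin L.length, Fin (L.get i).1)
    (hu : (L.get u.1).1 = 1) :
    IsCutDecomposition (seqJoin L) u (leftSide L u.1) (rightSide L u.1) := by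
  have huniq (w : Σ i : Fin L.length, Fin (L.get i).1) (hw : (w.1 : ℕ) = u.1) : w = u := by
    obtain ⟨i, a⟩ := u
    obtain ⟨j, b⟩ := w
    obtain rfl : j = i := Fin.ext hw
    have ha := a.isLt
    have hb := b.isLt
    simp only at hu
    congr 1
    ext
    omega
  refine ⟨⟨by simp [leftSide], ?_⟩, ⟨by simp [rightSide], ?_⟩, ?_, ?_⟩
  · intro v hv w hvw
    simp only [leftSide, Finset.mem_filter, Finset.mem_univ, true_and] at hv ⊢
    have := seqJoin_adj_fst hvw
    by_cases hw : (w.1 : ℕ) = u.1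
    · exact Or.inr (huniq w hw)
    · left
      omega
  · intro v hv w hvw
    simp only [rightSide, Finset.mem_filter, Finset.mem_univ, true_and] at hv ⊢
    have := seqJoin_adj_fst hvw
    by_cases hw : (w.1 : ℕ) = u.1
    · exact Or.inr (huniq w hw)
    · left
      omega
  · rw [Finset.disjoint_left]
    intro v hv hv'
    simp only [leftSide, rightSide, Finset.mem_filter, Finset.mem_univ, true_and] at hv hv'
    omega
  · intro v
    simp only [leftSide, rightSide, Finset.mem_filter, Finset.mem_univ, true_and]
    by_cases hw : (v.1 : ℕ) = u.1
    · exact Or.inr (Or.inr (huniq v hw))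
    · omega

end SeqJoin

/-! ### Joins of five graphs with a single vertex in the middle -/

section FiveCells

open scoped Classical

variable (X₀ X₁ X₃ X₄ : FinGraph)

/-- The middle vertex of a sequential join of five graphs with a single vertex in the middle. -/
def middle : Σ i : Fin [X₀, X₁, completeG 1, X₃, X₄].length,
    Fin ([X₀, X₁, completeG 1, X₃, X₄].get i).1 :=
  ⟨⟨2, by simp⟩, ⟨0, Nat.one_pos⟩⟩

variable {X₀ X₁ X₃ X₄}

theorem sum_five {M : Type*} [AddCommMonoid M]
    (F : Fin [X₀, X₁, completeG 1, X₃, X₄].length → M) :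
    ∑ i, F i = F ⟨0, by simp⟩ + F ⟨1, by simp⟩ + F ⟨2, by simp⟩ + F ⟨3, by simp⟩ +
      F ⟨4, by simp⟩ :=
  Fin.sum_univ_five F

theorem forall_five {P : Fin [X₀, X₁, completeG 1, X₃, X₄].length → Prop}
    (h0 : P ⟨0, by simp⟩) (h1 : P ⟨1, by simp⟩) (h2 : P ⟨2, by simp⟩) (h3 : P ⟨3, by simp⟩)
    (h4 : P ⟨4, by simp⟩) : ∀ i, P i := by
  rintro ⟨i, hi⟩
  have hi' : i < 5 := hi
  interval_cases i
  exacts [h0, h1, h2, h3, h4]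

/-- The equations `e0` to `e4` say that each row of the quotient matrix sums to `d`; the middle row
involves only its two neighbouring cells. -/
theorem nbrSum_five {d : ℕ} {r₀ r₁ r₃ r₄ : ℝ}
    (h0 : ∀ a, nbrSum X₀.2 (fun _ => 1) a = r₀) (h1 : ∀ a, nbrSum X₁.2 (fun _ => 1) a = r₁)
    (h3 : ∀ a, nbrSum X₃.2 (fun _ => 1) a = r₃) (h4 : ∀ a, nbrSum X₄.2 (fun _ => 1) a = r₄)
    (e0 : r₀ + X₁.1 = d) (e1 : X₀.1 + r₁ + 1 = d) (e2 : (X₁.1 : ℝ) + X₃.1 = d)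
    (e3 : 1 + r₃ + X₄.1 = d) (e4 : X₃.1 + r₄ = d) (x) :
    nbrSum (seqJoin [X₀, X₁, completeG 1, X₃, X₄]) (fun _ => 1) x = d := by
  let r : Fin [X₀, X₁, completeG 1, X₃, X₄].length → ℝ := ![r₀, r₁, 0, r₃, r₄]
  rw [nbrSum_seqJoin r fun _ => 1]
  · rw [sum_five]
    obtain ⟨i, a⟩ := x
    revert i
    refine forall_five ?_ ?_ ?_ ?_ ?_ <;> intro a <;> simp [r, completeG] <;> linarith
  · refine forall_five h0 h1 ?_ h3 h4
    intro a
    have := nbrSum_completeG 1 a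
    rw [Nat.cast_one, sub_self] at this
    exact this

theorem card_left_five :
    (leftSide [X₀, X₁, completeG 1, X₃, X₄] 2).card = X₀.1 + X₁.1 ∧
    (rightSide [X₀, X₁, completeG 1, X₃, X₄] 2).card = X₃.1 + X₄.1 := by
  constructor
  · rw [leftSide, card_filter_fst (L := [X₀, X₁, completeG 1, X₃, X₄]) (fun i => (i : ℕ) < 2),
      sum_five]
    simp
  · rw [rightSide, card_filter_fst (L := [X₀, X₁, completeG 1, X₃, X₄]) (fun i => 2 < (i : ℕ)),
      sum_five]
    simp

theorem middle_adj (x) : (seqJoin [X₀, X₁, completeG 1, X₃, X₄]).Adj (middle X₀ X₁ X₃ X₄) x ↔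
    (x.1 : ℕ) = 1 ∨ (x.1 : ℕ) = 3 := by
  obtain ⟨i, a⟩ := x
  revert i
  refine forall_five ?_ ?_ ?_ ?_ ?_ <;> intro a
  · rw [seqJoin_adj_of_ne] <;> simp [middle]
  · rw [seqJoin_adj_of_ne] <;> simp [middle]
  · have ha : a = ⟨0, Nat.one_pos⟩ := Fin.ext (Nat.lt_one_iff.mp a.isLt)
    subst ha
    have := (seqJoin [X₀, X₁, completeG 1, X₃, X₄]).irrefl (v := middle X₀ X₁ X₃ X₄)
    simp [middle] at this ⊢
  · rw [seqJoin_adj_of_ne] <;> simp [middle]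
  · rw [seqJoin_adj_of_ne] <;> simp [middle]

theorem card_contacts_five :
    (contacts (seqJoin [X₀, X₁, completeG 1, X₃, X₄]) (middle X₀ X₁ X₃ X₄)
      (leftSide [X₀, X₁, completeG 1, X₃, X₄] 2)).card = X₁.1 ∧
    (contacts (seqJoin [X₀, X₁, completeG 1, X₃, X₄]) (middle X₀ X₁ X₃ X₄)
      (rightSide [X₀, X₁, completeG 1, X₃, X₄] 2)).card = X₃.1 := by
  constructor
  · have : contacts (seqJoin [X₀, X₁, completeG 1, X₃, X₄]) (middle X₀ X₁ X₃ X₄)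
        (leftSide [X₀, X₁, completeG 1, X₃, X₄] 2) =
        Finset.univ.filter fun x => (x.1 : ℕ) = 1 := by
      ext x
      simp only [mem_contacts, middle_adj, leftSide, Finset.mem_filter, Finset.mem_univ, true_and]
      omega
    rw [this, card_filter_fst (L := [X₀, X₁, completeG 1, X₃, X₄]) (fun i => (i : ℕ) = 1), sum_five]
    simp
  · have : contacts (seqJoin [X₀, X₁, completeG 1, X₃, X₄]) (middle X₀ X₁ X₃ X₄)
        (rightSide [X₀, X₁, completeG 1, X₃, X₄] 2) =
        Finset.univ.filter fun x => (x.1 : ℕ) = 3 := by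
      ext x
      simp only [mem_contacts, middle_adj, rightSide, Finset.mem_filter, Finset.mem_univ, true_and]
      omega
    rw [this, card_filter_fst (L := [X₀, X₁, completeG 1, X₃, X₄]) (fun i => (i : ℕ) = 3), sum_five]
    simp

theorem isFullJoin_five :
    IsFullJoin (seqJoin [X₀, X₁, completeG 1, X₃, X₄]) (middle X₀ X₁ X₃ X₄)
      (leftSide [X₀, X₁, completeG 1, X₃, X₄] 2) ∧
    IsFullJoin (seqJoin [X₀, X₁, completeG 1, X₃, X₄]) (middle X₀ X₁ X₃ X₄)
      (rightSide [X₀, X₁, completeG 1, X₃, X₄] 2) := by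
  constructor
  · intro v hv huv w hw huw
    simp only [middle_adj, leftSide, Finset.mem_filter, Finset.mem_univ, true_and] at *
    rw [seqJoin_adj_of_ne (fun h => by rw [h] at huv; omega)]
    omega
  · intro v hv huv w hw huw
    have h5 : (v.1 : ℕ) < 5 := v.1.isLt
    have h5' : (w.1 : ℕ) < 5 := w.1.isLt
    simp only [middle_adj, rightSide, Finset.mem_filter, Finset.mem_univ, true_and] at *
    rw [seqJoin_adj_of_ne (fun h => by rw [h] at huv; omega)]
    omega

end FiveCells

/-! ### Vertex-connectivity one and two -/

section Connectivity

variable {V : Type*} [Fintype V] {G : SimpleGraph V}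

theorem deleteVertices_empty_preconnected (hG : G.Connected) :
    (deleteVertices G ((∅ : Finset V) : Set V)).Preconnected := by
  intro x y
  let φ : G →g deleteVertices G ((∅ : Finset V) : Set V) :=
    { toFun := fun v => ⟨v, by simp⟩
      map_rel' := fun h => h }
  exact (hG.preconnected x.1 y.1).map φ

theorem exists_not_subsingleton_of_card {S : Finset V} (h : S.card + 1 < Fintype.card V) :
    ¬ {v : V | v ∉ (S : Set V)}.Subsingleton := by
  classical
  intro hs
  have h1 : (Finset.univ \ S).card ≤ 1 := by
    rw [Finset.card_le_one]
    intro a ha b hb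
    exact hs (by simpa using ha) (by simpa using hb)
  rw [Finset.card_sdiff_of_subset (Finset.subset_univ S), Finset.card_univ] at h1
  omega

theorem vertexConnectivity_set_nonempty : {k : ℕ | ∃ S : Finset V, S.card = k ∧
    (¬ (deleteVertices G (S : Set V)).Preconnected ∨
      {v : V | v ∉ (S : Set V)}.Subsingleton)}.Nonempty :=
  ⟨_, Finset.univ, rfl, Or.inr fun x hx => by simp at hx⟩

theorem one_le_vertexConnectivity (hG : G.Connected) (hV : 1 < Fintype.card V) :
    1 ≤ vertexConnectivity G := by
  refine le_csInf vertexConnectivity_set_nonempty ?_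
  rintro k ⟨S, rfl, h⟩
  by_contra hk
  obtain rfl : S = ∅ := by
    rw [← Finset.card_eq_zero]
    omega
  rcases h with h | h
  · exact h (deleteVertices_empty_preconnected hG)
  · exact exists_not_subsingleton_of_card (by simpa using hV) h

theorem two_le_vertexConnectivity (hG : G.Connected) (hV : 2 < Fintype.card V)
    (hcut : ∀ u, ¬ IsCutVertex G u) : 2 ≤ vertexConnectivity G := by
  refine le_csInf vertexConnectivity_set_nonempty ?_
  rintro k ⟨S, rfl, h⟩
  by_contra hk
  rcases h with h | h
  · by_cases h0 : S.card = 0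
    · rw [Finset.card_eq_zero] at h0
      subst h0
      exact h (deleteVertices_empty_preconnected hG)
    · obtain ⟨u, rfl⟩ := Finset.card_eq_one.mp (by omega : S.card = 1)
      rw [Finset.coe_singleton] at h
      exact hcut u h
  · exact exists_not_subsingleton_of_card (by omega) h

theorem vertexConnectivity_eq_one (hG : G.Connected) (hV : 1 < Fintype.card V) {u : V}
    (hu : IsCutVertex G u) : vertexConnectivity G = 1 := by
  refine le_antisymm (Nat.sInf_le ⟨{u}, by simp, Or.inl ?_⟩) (one_le_vertexConnectivity hG hV)
  rw [Finset.coe_singleton]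
  exact hu

end Connectivity

/-! ### Cells of fully joined sides -/

section SideCells

open scoped Classical

variable {V : Type*} [Fintype V] {G : SimpleGraph V} {d k : ℕ} {u : V} {A B : Finset V}

theorem IsSide.card_filter_adj (hA : IsSide G u A) (hreg : ∀ v, nbrSum G (fun _ => 1) v = d) {v : V}
    (hv : v ∈ A) : (A.filter (G.Adj v)).card + (if G.Adj u v then 1 else 0) = d := by
  have h := hA.nbrSum_ind_of_mem hreg hv
  rw [nbrSum_ind, eq_sub_iff_add_eq] at h
  exact_mod_cast h

/-- Inside the two cells of a fully joined side of minimal size, the complement is regular. -/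
theorem IsSide.coDegree_eq (hA : IsSide G u A) (hfull : IsFullJoin G u A)
    (hreg : ∀ v, nbrSum G (fun _ => 1) v = d) (hn : A.card = d + 1 + k) :
    (∀ v ∈ A \ contacts G u A, coDegree G (A \ contacts G u A) v = k) ∧
    (∀ v ∈ contacts G u A, coDegree G (contacts G u A) v = k + 1) := by
  have hsplit (v : V) : (A.filter (G.Adj v)).card =
      ((A \ contacts G u A).filter (G.Adj v)).card + ((contacts G u A).filter (G.Adj v)).card := by
    rw [← Finset.card_union_of_disjoint, ← Finset.filter_union,
      Finset.sdiff_union_of_subset (contacts_subset G u A)]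
    exact Finset.disjoint_filter_filter Finset.sdiff_disjoint
  have hcard := Finset.card_sdiff_add_card_eq_card (contacts_subset G u A)
  constructor
  · intro v hv
    have h1 := coDegree_add (G := G) hv
    have h2 := hsplit v
    rw [Finset.mem_sdiff, mem_contacts] at hv
    have huv : ¬ G.Adj u v := fun h => hv.2 ⟨hv.1, h⟩
    have h3 := hA.card_filter_adj hreg hv.1
    rw [if_neg huv] at h3
    have h4 : (contacts G u A).filter (G.Adj v) = contacts G u A :=
      Finset.filter_true_of_mem fun w hw =>
        hfull v hv.1 huv w ((mem_contacts G).mp hw).1 ((mem_contacts G).mp hw).2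
    rw [h4] at h2
    omega
  · intro v hv
    have h1 := coDegree_add (G := G) hv
    have h2 := hsplit v
    rw [mem_contacts] at hv
    have h3 := hA.card_filter_adj hreg hv.1
    rw [if_pos hv.2] at h3
    have h4 : (A \ contacts G u A).filter (G.Adj v) = A \ contacts G u A := by
      refine Finset.filter_true_of_mem fun w hw => ?_
      rw [Finset.mem_sdiff, mem_contacts] at hw
      exact (hfull w hw.1 (fun h => hw.2 ⟨hw.1, h⟩) v hv.1 hv.2).symm
    rw [h4] at h2
    omega

/-- A graph with two fully joined sides is a sequential join of the graphs on its five cells. -/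
theorem IsCutDecomposition.nonempty_iso (hcut : IsCutDecomposition G u A B)
    (hfA : IsFullJoin G u A) (hfB : IsFullJoin G u B) {X₀ X₁ X₃ X₄ : FinGraph}
    (h0 : Nonempty (G.induce ((A \ contacts G u A : Finset V) : Set V) ≃g X₀.2))
    (h1 : Nonempty (G.induce ((contacts G u A : Finset V) : Set V) ≃g X₁.2))
    (h3 : Nonempty (G.induce ((contacts G u B : Finset V) : Set V) ≃g X₃.2))
    (h4 : Nonempty (G.induce ((B \ contacts G u B : Finset V) : Set V) ≃g X₄.2)) :
    Nonempty (G ≃g seqJoin [X₀, X₁, completeG 1, X₃, X₄]) := by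
  -- The cells from left to right: non-contacts of `A`, contacts of `A`, the vertex `u`, contacts of
  -- `B`, non-contacts of `B`.
  let g : V → ℕ := fun v => if v ∈ A then (if G.Adj u v then 1 else 0)
    else if v = u then 2 else if G.Adj u v then 3 else 4
  have hg (v) : g v < 5 := by
    simp only [g]
    split_ifs <;> norm_num
  let f : V → Fin [X₀, X₁, completeG 1, X₃, X₄].length := fun v => ⟨g v, hg v⟩
  have hAu := hcut.left.notMem
  have hBu := hcut.right.notMem
  have hBA {v} (hv : v ∈ B) : v ∉ A := Finset.disjoint_right.mp hcut.disj hv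
  have hBne {v} (hv : v ∈ B) : v ≠ u := fun e => hBu (e ▸ hv)
  have hBof {v} (hv : v ∉ A) (hne : v ≠ u) : v ∈ B := by
    rcases hcut.cover v with h | h | h
    exacts [absurd h hv, h, absurd h hne]
  have hset (i : ℕ) (hi : i < 5) (s : Finset V) (hs : ∀ v, g v = i ↔ v ∈ s) :
      {v | f v = ⟨i, hi⟩} = (s : Set V) := by
    ext v
    rw [Finset.mem_coe, ← hs]
    exact Fin.ext_iff
  refine nonempty_iso_seqJoin f ?_ ?_
  · refine forall_five ?_ ?_ ?_ ?_ ?_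
    · rw [hset 0 _ (A \ contacts G u A)]
      · exact h0
      · intro v
        simp only [g, Finset.mem_sdiff, mem_contacts]
        split_ifs <;> simp_all
    · rw [hset 1 _ (contacts G u A)]
      · exact h1
      · intro v
        simp only [g, mem_contacts]
        split_ifs <;> simp_all
    · rw [hset 2 _ {u}]
      · refine nonempty_iso_completeG (by simp) fun v hv => ?_
        rw [coDegree, Finset.card_eq_zero, Finset.filter_eq_empty_iff]
        intro w hw
        rw [Finset.mem_singleton] at hv hw
        simp [hv, hw]
      · intro v
        simp only [g, Finset.mem_singleton]
        split_ifs <;> simp_all <;> (rintro rfl; contradiction)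
    · rw [hset 3 _ (contacts G u B)]
      · exact h3
      · intro v
        simp only [g, mem_contacts]
        by_cases hA : v ∈ A
        · have : v ∉ B := Finset.disjoint_left.mp hcut.disj hA
          split_ifs <;> simp_all
        · by_cases hu : v = u
          · simp_all
          · simp [hA, hu, hBof hA hu]
    · rw [hset 4 _ (B \ contacts G u B)]
      · exact h4
      · intro v
        simp only [g, Finset.mem_sdiff, mem_contacts]
        by_cases hA : v ∈ A
        · have : v ∉ B := Finset.disjoint_left.mp hcut.disj hA
          split_ifs <;> simp_all
        · by_cases hu : v = u
          · simp_all
          · simp [hA, hu, hBof hA hu]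
  · have hcases (v) : (g v = 0 ∧ v ∈ A ∧ ¬ G.Adj u v) ∨ (g v = 1 ∧ v ∈ A ∧ G.Adj u v) ∨
        (g v = 2 ∧ v = u) ∨ (g v = 3 ∧ v ∈ B ∧ G.Adj u v) ∨ (g v = 4 ∧ v ∈ B ∧ ¬ G.Adj u v) := by
      simp only [g]
      by_cases hA : v ∈ A
      · by_cases huv : G.Adj u v <;> simp [hA, huv]
      · by_cases hu : v = u
        · simp [hu, hAu]
        · by_cases huv : G.Adj u v <;> simp [hA, hu, huv, hBof hA hu]
    have hAB {v w} (hv : v ∈ A) (hw : w ∈ B) : ¬ G.Adj v w := fun h =>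
      (hcut.left.closed v hv w h).elim (hBA hw) (hBne hw)
    have hBA' {v w} (hv : v ∈ B) (hw : w ∈ A) : ¬ G.Adj v w := fun h => hAB hw hv h.symm
    intro v w hne
    have hne' : g v ≠ g w := fun e => hne (Fin.ext e)
    change G.Adj v w ↔ g v + 1 = g w ∨ g w + 1 = g v
    rcases hcases v with ⟨e, hv⟩ | ⟨e, hv⟩ | ⟨e, hv⟩ | ⟨e, hv⟩ | ⟨e, hv⟩ <;>
    rcases hcases w with ⟨e', hw⟩ | ⟨e', hw⟩ | ⟨e', hw⟩ | ⟨e', hw⟩ | ⟨e', hw⟩ <;>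
    rw [e, e'] at hne' ⊢
    · exact absurd rfl hne'
    · simpa using hfA v hv.1 hv.2 w hw.1 hw.2
    · subst hw
      simpa [G.adj_comm] using hv.2
    · simpa using hAB hv.1 hw.1
    · simpa using hAB hv.1 hw.1
    · simpa using (hfA w hw.1 hw.2 v hv.1 hv.2).symm
    · exact absurd rfl hne'
    · subst hw
      simpa [G.adj_comm] using hv.2
    · simpa using hAB hv.1 hw.1
    · simpa using hAB hv.1 hw.1
    · subst hv
      simpa using hw.2
    · subst hv
      simpa using hw.2
    · exact absurd rfl hne'
    · subst hv
      simpa using hw.2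
    · subst hv
      simpa using hw.2
    · simpa using hBA' hv.1 hw.1
    · simpa using hBA' hv.1 hw.1
    · subst hw
      simpa [G.adj_comm] using hv.2
    · exact absurd rfl hne'
    · simpa using (hfB w hw.1 hw.2 v hv.1 hv.2).symm
    · simpa using hBA' hv.1 hw.1
    · simpa using hBA' hv.1 hw.1
    · subst hw
      simpa [G.adj_comm] using hv.2
    · simpa using hfB v hv.1 hv.2 w hw.1 hw.2
    · exact absurd rfl hne'

/-- The parity defect of a side with `c` contacts: a side has at least `d + 1 + parityDefect d c`
vertices. -/
def parityDefect (d c : ℕ) : ℕ := d * c % 2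

/-- A side already has more than `d` vertices. When `d` and `c` are both odd, exactly `d + 1` is
impossible, since `d (d + 1) + c` would be odd. -/
theorem IsSide.le_card (hA : IsSide G u A) (hreg : ∀ v, nbrSum G (fun _ => 1) v = d)
    (hA0 : A.Nonempty) (hc : (contacts G u A).card < d) :
    d + 1 + parityDefect d (contacts G u A).card ≤ A.card := by
  have h1 := hA.lt_card hreg hA0 hc
  have h2 := hA.even_add hreg
  rw [parityDefect]
  rcases Nat.mod_two_eq_zero_or_one (d * (contacts G u A).card) with h | h
  · omega
  · have h3 : Odd (d * (contacts G u A).card) := Nat.odd_iff.mpr h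
    rw [Nat.odd_mul] at h3
    have h4 : A.card ≠ d + 1 := fun e => by
      rw [e] at h2
      have h5 : Even (d * (d + 1)) := Nat.even_mul_succ_self d
      have h6 := h5.add_odd h3.2
      rw [← Nat.not_even_iff_odd] at h6
      exact h6 h2
    omega

end SideCells

/-! ### The extremal graphs for `d ≥ 4` -/

section ExtremalFamily

open scoped Classical

variable {d : ℕ}

theorem cStar_eq (hd : 4 ≤ d) : cStar d = if Even d then 2 * (d / 4) else (d - 1) / 2 := by
  rw [cStar, if_neg (by omega)]

/-- These bounds leave no admissible contact number strictly between `c*` and `d - c*`: for even `d`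
both are even and differ by at most `2`, for odd `d` they are consecutive. -/
theorem cStar_bounds (hd : 4 ≤ d) : 2 ≤ cStar d ∧ 2 * cStar d ≤ d ∧
    (Even d → Even (cStar d) ∧ d ≤ 2 * cStar d + 2) ∧ (¬ Even d → 2 * cStar d + 1 = d) := by
  rw [cStar_eq hd]
  by_cases h : Even d
  · rw [if_pos h]
    have h' := Nat.even_iff.mp h
    refine ⟨by omega, by omega, fun _ => ⟨even_two_mul _, by omega⟩, fun h' => absurd h h'⟩
  · rw [if_neg h]
    have h' := Nat.not_even_iff.mp h
    refine ⟨by omega, by omega, fun h' => absurd h' h, fun _ => by omega⟩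

theorem joinSequences_cStar (hd : 4 ≤ d) : joinSequences d (cStar d) =
    if Even d then {[completeG (d + 1 - cStar d), coMatching (cStar d), completeG 1,
      coMatching (d - cStar d), completeG (cStar d + 1)]}
    else if Odd (cStar d) then {L | ∃ X ∈ coCycles (cStar d),
      L = [coMatching (d + 2 - cStar d), X, completeG 1, coMatching (d - cStar d),
        completeG (cStar d + 1)]}
    else {L | ∃ X ∈ coCycles (d - cStar d),
      L = [completeG (d + 1 - cStar d), coMatching (cStar d), completeG 1, X,
        coMatching (cStar d + 2)]} := by
  obtain ⟨h1, h2, -, h4⟩ := cStar_bounds hd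
  rw [joinSequences]
  by_cases h : Even d
  · simp only [h, if_true]
  · have := h4 h
    rw [if_neg h, if_neg h, if_neg (by omega)]

theorem parityDefect_of_even (hd : Even d) (c : ℕ) : parityDefect d c = 0 :=
  Nat.even_iff.mp (hd.mul_right c)

theorem parityDefect_of_even_right {c : ℕ} (hc : Even c) : parityDefect d c = 0 :=
  Nat.even_iff.mp (hc.mul_left d)

theorem parityDefect_of_odd {c : ℕ} (hd : ¬ Even d) (hc : Odd c) : parityDefect d c = 1 :=
  Nat.odd_iff.mp ((Nat.not_even_iff_odd.mp hd).mul hc)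

/-- The shape of the extremal graphs. -/
theorem exists_shape (hd : 4 ≤ d) {L : List FinGraph} (hL : L ∈ joinSequences d (cStar d)) :
    ∃ X₀ X₁ X₃ X₄ : FinGraph, L = [X₀, X₁, completeG 1, X₃, X₄] ∧ X₁.1 = cStar d ∧
      X₃.1 = d - cStar d ∧ X₀.1 + X₁.1 = d + 1 + parityDefect d (cStar d) ∧
      X₃.1 + X₄.1 = d + 1 + parityDefect d (d - cStar d) ∧
      ∀ x, nbrSum (seqJoin [X₀, X₁, completeG 1, X₃, X₄]) (fun _ => 1) x = d := by
  obtain ⟨h1, h2, h3, h4⟩ := cStar_bounds hd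
  rw [joinSequences_cStar hd] at hL
  set c := cStar d
  obtain ⟨c', hc'⟩ : ∃ c', d = c + c' := ⟨d - c, by omega⟩
  have e1 : d - c = c' := by omega
  have hdr : (d : ℝ) = c + c' := by exact_mod_cast hc'
  by_cases h : Even d
  · rw [if_pos h] at hL
    have hce := (h3 h).1
    have hc'e : Even c' := by
      rw [hc', Nat.even_add] at h
      exact h.mp hce
    rw [e1, show d + 1 - c = c' + 1 by omega] at hL
    refine ⟨_, _, _, _, hL, rfl, e1.symm, ?_, ?_, ?_⟩
    · rw [parityDefect_of_even h]
      simp only [completeG, coMatching]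
      omega
    · rw [parityDefect_of_even h]
      simp only [completeG, coMatching]
      omega
    · refine nbrSum_five (nbrSum_completeG _) (nbrSum_coMatching (h3 h).1) (nbrSum_coMatching hc'e)
        (nbrSum_completeG _) ?_ ?_ ?_ ?_ ?_ <;> simp only [completeG, coMatching] <;> push_cast <;>
        linarith
  · rw [if_neg h] at hL
    have hcc := h4 h
    by_cases ho : Odd c
    · rw [if_pos ho, e1, show d + 2 - c = c' + 2 by omega] at hL
      obtain ⟨X, hX, hL⟩ := hL
      have hc'e : Even c' := by
        rw [hc', Nat.even_add] at h
        have := Nat.not_even_iff_odd.mpr ho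
        tauto
      have hX1 := coCycles_fst hX
      refine ⟨_, _, _, _, hL, hX1, e1.symm, ?_, ?_, ?_⟩
      · rw [parityDefect_of_odd h ho, hX1]
        simp only [coMatching]
        omega
      · rw [e1, parityDefect_of_even_right hc'e]
        simp only [completeG, coMatching]
        omega
      · refine nbrSum_five (nbrSum_coMatching (hc'e.add even_two))
          (fun a => (nbrSum_coCycles hX a).2) (nbrSum_coMatching hc'e)
          (nbrSum_completeG _) ?_ ?_ ?_ ?_ ?_ <;> simp only [completeG, coMatching, hX1] <;>
          push_cast <;> linarith
    · rw [if_neg ho, e1, show d + 1 - c = c' + 1 by omega] at hL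
      obtain ⟨X, hX, hL⟩ := hL
      have hce : Even c := Nat.not_odd_iff_even.mp ho
      have hc'o : Odd c' := by
        rw [hc', Nat.even_add] at h
        rw [← Nat.not_even_iff_odd]
        tauto
      have hX1 := coCycles_fst hX
      refine ⟨_, _, _, _, hL, rfl, hX1.trans e1.symm, ?_, ?_, ?_⟩
      · rw [parityDefect_of_even_right hce]
        simp only [completeG, coMatching]
        omega
      · rw [e1, parityDefect_of_odd h hc'o, hX1]
        simp only [coMatching]
        omega
      · refine nbrSum_five (nbrSum_completeG _) (nbrSum_coMatching hce)
          (fun a => (nbrSum_coCycles hX a).2) (nbrSum_coMatching (hce.add even_two))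
          ?_ ?_ ?_ ?_ ?_ <;> simp only [completeG, coMatching, hX1] <;>
          push_cast <;> linarith

theorem joinSequences_nonempty (hd : 4 ≤ d) : (joinSequences d (cStar d)).Nonempty := by
  obtain ⟨h1, h2, h3, h4⟩ := cStar_bounds hd
  rw [joinSequences_cStar hd]
  split_ifs with h ho
  · exact Set.singleton_nonempty _
  · have := h4 h
    -- An odd `c* ≥ 2` is at least `3`, so a cycle fits; in the even case below, `d - c* = c* + 1`
    -- is at least `3`.
    obtain ⟨X, hX⟩ := coCycles_nonempty (n := cStar d) (by rcases ho with ⟨m, hm⟩; omega)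
    exact ⟨_, X, hX, rfl⟩
  · have := h4 h
    obtain ⟨X, hX⟩ := coCycles_nonempty (n := d - cStar d) (by
      obtain ⟨m, hm⟩ := Nat.not_odd_iff_even.mp ho
      omega)
    exact ⟨_, X, hX, rfl⟩

/-- A graph with fully joined sides of minimal sizes and `c*` contacts on the left is extremal. -/
theorem IsCutDecomposition.exists_extremal_iso {V : Type*} [Fintype V] {G : SimpleGraph V} {u : V}
    {A B : Finset V} (hd : 4 ≤ d) (hcut : IsCutDecomposition G u A B)
    (hreg : ∀ v, nbrSum G (fun _ => 1) v = d) (hfA : IsFullJoin G u A) (hfB : IsFullJoin G u B)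
    (hcA : (contacts G u A).card = cStar d)
    (hnA : A.card = d + 1 + parityDefect d (contacts G u A).card)
    (hnB : B.card = d + 1 + parityDefect d (contacts G u B).card) :
    ∃ L ∈ joinSequences d (cStar d), Nonempty (G ≃g seqJoin L) := by
  obtain ⟨h1, h2, h3, h4⟩ := cStar_bounds hd
  have hsum := hcut.card_contacts hreg
  have hcB : (contacts G u B).card = d - cStar d := by omega
  obtain ⟨a0, a1⟩ := hcut.left.coDegree_eq hfA hreg hnA
  obtain ⟨b0, b1⟩ := hcut.right.coDegree_eq hfB hreg hnB
  have sA := Finset.card_sdiff_add_card_eq_card (contacts_subset G u A)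
  have sB := Finset.card_sdiff_add_card_eq_card (contacts_subset G u B)
  rw [joinSequences_cStar hd]
  by_cases h : Even d
  · rw [parityDefect_of_even h] at a0 a1 b0 b1 hnA hnB
    rw [if_pos h]
    refine ⟨_, rfl, hcut.nonempty_iso hfA hfB
      (nonempty_iso_completeG (by omega) a0) (nonempty_iso_coMatching hcA a1)
      (nonempty_iso_coMatching hcB b1) (nonempty_iso_completeG (by omega) b0)⟩
  · rw [if_neg h]
    have := h4 h
    by_cases ho : Odd (cStar d)
    · have he : Even (d - cStar d) := by
        obtain ⟨m, hm⟩ := ho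
        exact ⟨m + 1, by omega⟩
      rw [hcA, parityDefect_of_odd h ho] at a0 a1 hnA
      rw [hcB, parityDefect_of_even_right he] at b0 b1 hnB
      rw [if_pos ho]
      obtain ⟨X, hX, hiso⟩ := exists_iso_coCycles hcA a1
      exact ⟨_, ⟨X, hX, rfl⟩, hcut.nonempty_iso hfA hfB
        (nonempty_iso_coMatching (by omega) a0) hiso
        (nonempty_iso_coMatching hcB b1) (nonempty_iso_completeG (by omega) b0)⟩
    · have he : Even (cStar d) := Nat.not_odd_iff_even.mp ho
      have ho' : Odd (d - cStar d) := by
        obtain ⟨m, hm⟩ := he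
        exact ⟨m, by omega⟩
      rw [hcA, parityDefect_of_even_right he] at a0 a1 hnA
      rw [hcB, parityDefect_of_odd h ho'] at b0 b1 hnB
      rw [if_neg ho]
      obtain ⟨X, hX, hiso⟩ := exists_iso_coCycles hcB b1
      exact ⟨_, ⟨X, hX, rfl⟩, hcut.nonempty_iso hfA hfB
        (nonempty_iso_completeG (by omega) a0) (nonempty_iso_coMatching hcA a1)
        hiso (nonempty_iso_coMatching (by omega) b0)⟩

end ExtremalFamily

/-- `t (d - t) (H - t) (H' - t)` increases on `[0, 1]`. -/
theorem gap_product_mono {d H H' t s : ℝ} (hd : 4 ≤ d) (hH : 4 ≤ H) (hH' : 4 ≤ H') (ht : 0 ≤ t)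
    (hts : t ≤ s) (hs : s ≤ 1) :
    (d - t) * t * ((H - t) * (H' - t)) ≤ (d - s) * s * ((H - s) * (H' - s)) := by
  have key (X : ℝ) (hX : 4 ≤ X) : (X - t) * (1 - (s - t) / 3) ≤ X - s := by
    nlinarith
  have hpos : 0 ≤ 1 - (s - t) / 3 := by linarith
  have p1 : 0 ≤ d - t := by linarith
  have p2 : 0 ≤ H - t := by linarith
  have p3 : 0 ≤ H' - t := by linarith
  have m1 := mul_le_mul (key H hH) (key H' hH') (mul_nonneg p3 hpos) (by linarith)
  have m2 := mul_le_mul (key d hd) m1 (mul_nonneg (mul_nonneg p2 hpos) (mul_nonneg p3 hpos))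
    (by linarith)
  have hcube : 1 - (s - t) ≤ (1 - (s - t) / 3) ^ 3 := by
    have : 0 ≤ s - t := by linarith
    nlinarith [mul_nonneg this this, mul_nonneg (mul_nonneg this this) hpos]
  have hs' : t ≤ s * (1 - (s - t)) := by nlinarith
  have hQ : 0 ≤ (d - t) * ((H - t) * (H' - t)) := mul_nonneg p1 (mul_nonneg p2 p3)
  calc (d - t) * t * ((H - t) * (H' - t)) = t * ((d - t) * ((H - t) * (H' - t))) := by ring
    _ ≤ s * (1 - (s - t)) * ((d - t) * ((H - t) * (H' - t))) :=
      mul_le_mul_of_nonneg_right hs' hQ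
    _ ≤ s * (1 - (s - t) / 3) ^ 3 * ((d - t) * ((H - t) * (H' - t))) :=
      mul_le_mul_of_nonneg_right (mul_le_mul_of_nonneg_left hcube (by linarith)) hQ
    _ = s * ((d - t) * (1 - (s - t) / 3) * ((H - t) * (1 - (s - t) / 3) *
        ((H' - t) * (1 - (s - t) / 3)))) := by ring
    _ ≤ s * ((d - s) * ((H - s) * (H' - s))) := mul_le_mul_of_nonneg_left m2 (by linarith)
    _ = (d - s) * s * ((H - s) * (H' - s)) := by ring

/-! ### The dichotomy for `d ≥ 4` -/

section Main

open scoped Classical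

variable {d : ℕ}

/-- `δ` is the difference between `d` and the second eigenvalue of the extremal graphs. -/
structure IsGap (d : ℕ) (δ : ℝ) : Prop where
  pos : 0 < δ
  lt_one : δ < 1
  eq : (cStar d : ℝ) * (d - cStar d : ℕ) * ((d + 2 + parityDefect d (cStar d) - δ) +
      (d + 2 + parityDefect d (d - cStar d) - δ) - 1) =
    (d - δ) * δ * ((d + 2 + parityDefect d (cStar d) - δ) *
      (d + 2 + parityDefect d (d - cStar d) - δ))
  le : δ * (d + 2 + parityDefect d (d - cStar d) - δ) ≤ (d - cStar d : ℕ)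

theorem exists_isGap (hd : 4 ≤ d) : ∃ δ, IsGap d δ := by
  obtain ⟨h1, h2, h3, h4⟩ := cStar_bounds hd
  obtain ⟨c', hc'⟩ : ∃ c', d = cStar d + c' := ⟨d - cStar d, by omega⟩
  have e1 : d - cStar d = c' := by omega
  -- For odd `d` the parity defect can favour the wrong side by at most one, which `d - c* = c* + 1`
  -- absorbs.
  have hk : parityDefect d c' + cStar d ≤ c' + parityDefect d (cStar d) := by
    by_cases h : Even d
    · rw [parityDefect_of_even h, parityDefect_of_even h]
      omega
    · have := h4 h
      have : parityDefect d c' < 2 := Nat.mod_lt _ two_pos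
      omega
  have hk' : (parityDefect d c' : ℝ) + cStar d ≤ c' + parityDefect d (cStar d) := by
    exact_mod_cast hk
  obtain ⟨δ, g1, g2, g3, g4⟩ := exists_gap (d := d) (c := cStar d) (c' := c')
    (k := parityDefect d (cStar d)) (k' := parityDefect d c') (by exact_mod_cast hc'.symm)
    (by exact_mod_cast (by omega : 1 ≤ cStar d)) (by exact_mod_cast (by omega : cStar d ≤ c'))
    (Nat.cast_nonneg _) (Nat.cast_nonneg _) (by linarith)
  exact ⟨δ, g1, g2, by rw [e1]; exact g3, by rw [e1]; exact g4⟩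

/-- The structure of the extremal graphs around their cut vertex. -/
theorem exists_extremal_decomposition (hd : 4 ≤ d) {L : List FinGraph}
    (hL : L ∈ joinSequences d (cStar d)) :
    (∀ x, nbrSum (seqJoin L) (fun _ => 1) x = d) ∧ (seqJoin L).Connected ∧
    ∃ u A B, IsCutDecomposition (seqJoin L) u A B ∧ A.Nonempty ∧ B.Nonempty ∧
      IsFullJoin (seqJoin L) u A ∧ IsFullJoin (seqJoin L) u B ∧
      (contacts (seqJoin L) u A).card = cStar d ∧ (contacts (seqJoin L) u B).card = d - cStar d ∧
      A.card = d + 1 + parityDefect d (cStar d) ∧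
      B.card = d + 1 + parityDefect d (d - cStar d) := by
  obtain ⟨h1, h2, -, -⟩ := cStar_bounds hd
  obtain ⟨X₀, X₁, X₃, X₄, rfl, e1, e3, e0, e4, hreg⟩ := exists_shape hd hL
  have hcA := (card_left_five (X₀ := X₀) (X₁ := X₁) (X₃ := X₃) (X₄ := X₄)).1
  have hcB := (card_left_five (X₀ := X₀) (X₁ := X₁) (X₃ := X₃) (X₄ := X₄)).2
  refine ⟨hreg, ?_, middle X₀ X₁ X₃ X₄, leftSide _ 2, rightSide _ 2,
    seqJoin_decomposition (middle X₀ X₁ X₃ X₄) rfl, ?_, ?_, isFullJoin_five.1, isFullJoin_five.2,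
    card_contacts_five.1.trans e1, card_contacts_five.2.trans e3, hcA.trans e0, hcB.trans e4⟩
  · refine seqJoin_connected (by simp) (forall_five ?_ ?_ ?_ ?_ ?_)
    · change 0 < X₀.1
      omega
    · change 0 < X₁.1
      omega
    · exact Nat.one_pos
    · change 0 < X₃.1
      omega
    · change 0 < X₄.1
      omega
  · rw [← Finset.card_pos]
    omega
  · rw [← Finset.card_pos]
    omega

/-- The upper bound is the equality case. For the lower bound the gap is enlarged slightly to `s`:
the left side of the gap equation drops and the right side does not, so the strict lower bound
applies at `s`. -/
theorem IsGap.lambda2_seqJoin {δ : ℝ} (hδ : IsGap d δ) (hd : 4 ≤ d) {L : List FinGraph}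
    (hL : L ∈ joinSequences d (cStar d)) : lambda2 (seqJoin L) = d - δ := by
  obtain ⟨h1, h2, -, -⟩ := cStar_bounds hd
  obtain ⟨hreg, -, u, A, B, hcut, hA0, hB0, hfA, hfB, hcA, hcB, hnA, hnB⟩ :=
    exists_extremal_decomposition hd hL
  have hk : parityDefect d (cStar d) < 2 := Nat.mod_lt _ two_pos
  have hk' : parityDefect d (d - cStar d) < 2 := Nat.mod_lt _ two_pos
  have hnA' : (A.card : ℝ) = d + 1 + parityDefect d (cStar d) := by exact_mod_cast hnA
  have hnB' : (B.card : ℝ) = d + 1 + parityDefect d (d - cStar d) := by exact_mod_cast hnB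
  apply le_antisymm
  · refine hcut.lambda2_le hreg (by omega) hδ.pos hδ.lt_one hA0 hB0 hfA hfB (by omega) (by omega)
      rfl rfl ?_ ?_
    · rw [hcA, hcB, hnA', hnB']
      have := hδ.eq
      ring_nf at this ⊢
      exact this
    · rw [hcB, hnB']
      have := hδ.le
      ring_nf at this ⊢
      exact this
  · by_contra! hlt
    -- Chosen in `(δ, 1)` with `λ₂ ≤ d - s`, so that `λ₂ > d - s` is a contradiction.
    set s := min (d - lambda2 (seqJoin L)) ((1 + δ) / 2)
    have hs1 : δ < s := lt_min (by linarith) (by linarith [hδ.lt_one])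
    have hs2 : s < 1 := (min_le_right _ _).trans_lt (by linarith [hδ.lt_one])
    have hs3 : lambda2 (seqJoin L) ≤ d - s := by
      have : s ≤ d - lambda2 (seqJoin L) := min_le_left _ _
      linarith
    have hd' : (4 : ℝ) ≤ d := by exact_mod_cast hd
    have hc0 : (0 : ℝ) < cStar d := by exact_mod_cast (by omega : 0 < cStar d)
    have hc0' : (0 : ℝ) < (d - cStar d : ℕ) := by exact_mod_cast (by omega : 0 < d - cStar d)
    have hk0 : (0 : ℝ) ≤ parityDefect d (cStar d) := Nat.cast_nonneg _
    have hk0' : (0 : ℝ) ≤ parityDefect d (d - cStar d) := Nat.cast_nonneg _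
    have hmono := gap_product_mono (d := d) (H := d + 2 + parityDefect d (cStar d))
      (H' := d + 2 + parityDefect d (d - cStar d)) hd' (by linarith) (by linarith)
      hδ.pos.le hs1.le hs2.le
    have hstep := mul_lt_mul_of_pos_left hs1 (mul_pos hc0 hc0')
    have heq := hδ.eq
    have hmain : (cStar d : ℝ) * (d - cStar d : ℕ) * ((A.card + 1 - s) + (B.card + 1 - s) - 1) <
        (d - s) * s * ((A.card + 1 - s) * (B.card + 1 - s)) := by
      rw [hnA', hnB']
      have e (k : ℝ) : (d : ℝ) + 1 + k + 1 - s = d + 2 + k - s := by ring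
      rw [e, e]
      linarith
    have := hcut.lt_lambda2 hreg (hδ.pos.trans hs1) hs2 hA0 hB0 rfl rfl
      (by rw [hcA, hcB]; exact hmain.le) (Or.inl (by rw [hcA, hcB]; exact hmain))
    linarith

/-- The dichotomy for graphs with a cut vertex. -/
theorem IsGap.lt_or_iso {δ : ℝ} (hδ : IsGap d δ) (hd : 4 ≤ d) {V : Type*} [Fintype V]
    {G : SimpleGraph V} (hconn : G.Connected) (hreg : ∀ v, nbrSum G (fun _ => 1) v = d) {u : V}
    (hu : IsCutVertex G u) :
    d - δ < lambda2 G ∨ ∃ L ∈ joinSequences d (cStar d), Nonempty (G ≃g seqJoin L) := by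
  obtain ⟨A, B, hcut, hA0, hB0⟩ := hu.exists_decomposition
  obtain ⟨h1, h2, h3, h4⟩ := cStar_bounds hd
  have hsum := hcut.card_contacts hreg
  have hpA := hcut.left.contacts_card_pos hconn hA0
  have hpB := hcut.right.contacts_card_pos hconn hB0
  have hnA := hcut.left.le_card hreg hA0 (by omega)
  have hnB := hcut.right.le_card hreg hB0 (by omega)
  have hevA := hcut.left.even_add hreg
  -- These are all the equality conditions at once. If one of them fails, it supplies the strictness
  -- required by `IsCutDecomposition.lt_lambda2`.
  by_cases hall : ((contacts G u A).card = cStar d ∨ (contacts G u A).card = d - cStar d) ∧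
    A.card = d + 1 + parityDefect d (contacts G u A).card ∧
    B.card = d + 1 + parityDefect d (contacts G u B).card ∧ IsFullJoin G u A ∧ IsFullJoin G u B
  · right
    obtain ⟨hc | hc, hA, hB, hfA, hfB⟩ := hall
    · exact hcut.exists_extremal_iso hd hreg hfA hfB hc hA hB
    · exact hcut.symm.exists_extremal_iso hd hreg hfB hfA (by omega) hB hA
  left
  -- Whatever the contact numbers are, the two parity defects agree with the extremal ones up to
  -- order: both are zero for even `d`, and for odd `d` exactly one contact number is odd. The gap
  -- equation is symmetric, so it carries over.
  have hparity : (parityDefect d (contacts G u A).card = parityDefect d (cStar d) ∧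
      parityDefect d (contacts G u B).card = parityDefect d (d - cStar d)) ∨
      (parityDefect d (contacts G u A).card = parityDefect d (d - cStar d) ∧
      parityDefect d (contacts G u B).card = parityDefect d (cStar d)) := by
    by_cases h : Even d
    · simp only [parityDefect_of_even h, and_self, or_self]
    · have hsumc : cStar d + (d - cStar d) = d := by omega
      have hone (a b : ℕ) (hab : a + b = d) : (parityDefect d a = 0 ∧ parityDefect d b = 1) ∨
          (parityDefect d a = 1 ∧ parityDefect d b = 0) := by
        by_cases ha : Even a
        · have hb : Odd b := by
            rw [← Nat.not_even_iff_odd]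
            intro hb
            exact h (hab ▸ ha.add hb)
          exact Or.inl ⟨parityDefect_of_even_right ha, parityDefect_of_odd h hb⟩
        · have hb : Even b := by
            by_contra hb
            exact h (hab ▸ (Nat.not_even_iff_odd.mp ha).add_odd (Nat.not_even_iff_odd.mp hb))
          exact Or.inr ⟨parityDefect_of_odd h (Nat.not_even_iff_odd.mp ha),
            parityDefect_of_even_right hb⟩
      have i1 := hone _ _ hsum
      have i2 := hone _ _ hsumc
      omega
  have hprod : (contacts G u A).card * (contacts G u B).card ≤ cStar d * (d - cStar d) ∧
      (¬ ((contacts G u A).card = cStar d ∨ (contacts G u A).card = d - cStar d) →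
        (contacts G u A).card * (contacts G u B).card < cStar d * (d - cStar d)) := by
    set a := (contacts G u A).card
    set b := (contacts G u B).card
    obtain ⟨c', hc'⟩ : ∃ c', d = cStar d + c' := ⟨d - cStar d, by omega⟩
    have e1 : d - cStar d = c' := by omega
    rw [e1]
    set c := cStar d
    -- Outside the interval from `c` to `c'` the product is strictly smaller. The one possible
    -- interior value, `c + 1` for even `d`, is excluded because it is odd.
    have hout : a = c ∨ a = c' ∨ a < c ∨ c' < a := by
      by_contra hcon
      push Not at hcon
      by_cases h : Even d
      · have i1 := h3 h
        have i2 : Even a := by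
          rw [Nat.even_add] at hevA
          exact hevA.mp (h.mul_right _)
        obtain ⟨x, hx⟩ := i1.1
        obtain ⟨y, hy⟩ := i2
        omega
      · have := h4 h
        omega
    have hab : a + b = c + c' := by omega
    rcases hout with h | h | h | h
    · have : b = c' := by omega
      simp [h, this]
    · have : b = c := by omega
      rw [h, this, mul_comm]
      simp
    · have : a * b < c * c' := by nlinarith
      exact ⟨this.le, fun _ => this⟩
    · have : a * b < c * c' := by nlinarith
      exact ⟨this.le, fun _ => this⟩
  have hP0 : (0 : ℝ) < (contacts G u A).card * (contacts G u B).card := by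
    exact_mod_cast Nat.mul_pos hpA hpB
  have hP : ((contacts G u A).card : ℝ) * (contacts G u B).card ≤
      cStar d * (d - cStar d : ℕ) := by exact_mod_cast hprod.1
  have hnA' : (d : ℝ) + 1 + parityDefect d (contacts G u A).card ≤ A.card := by exact_mod_cast hnA
  have hnB' : (d : ℝ) + 1 + parityDefect d (contacts G u B).card ≤ B.card := by exact_mod_cast hnB
  have hδ1 := hδ.lt_one
  have hd' : (4 : ℝ) ≤ d := by exact_mod_cast hd
  have hkA : (0 : ℝ) ≤ parityDefect d (contacts G u A).card := Nat.cast_nonneg _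
  have hkB : (0 : ℝ) ≤ parityDefect d (contacts G u B).card := Nat.cast_nonneg _
  have heq : (cStar d : ℝ) * (d - cStar d : ℕ) *
      ((d + 2 + parityDefect d (contacts G u A).card - δ) +
        (d + 2 + parityDefect d (contacts G u B).card - δ) - 1) =
      (d - δ) * δ * ((d + 2 + parityDefect d (contacts G u A).card - δ) *
        (d + 2 + parityDefect d (contacts G u B).card - δ)) := by
    rcases hparity with ⟨e, e'⟩ | ⟨e, e'⟩
    · rw [e, e']
      exact hδ.eq
    · rw [e, e']
      have := hδ.eq
      linarith
  obtain ⟨m1, m2⟩ := determinant_mono hP0 hP (h := A.card + 1 - δ) (h' := B.card + 1 - δ)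
    (by linarith) (by linarith) (by linarith) (by linarith) heq
  refine hcut.lt_lambda2 hreg hδ.pos hδ1 hA0 hB0 rfl rfl m1 ?_
  by_cases hfA : IsFullJoin G u A
  swap
  · exact Or.inr (Or.inl hfA)
  by_cases hfB : IsFullJoin G u B
  swap
  · exact Or.inr (Or.inr hfB)
  refine Or.inl (m2 ?_)
  by_cases hc : (contacts G u A).card = cStar d ∨ (contacts G u A).card = d - cStar d
  swap
  · left
    exact_mod_cast hprod.2 hc
  by_cases hA : A.card = d + 1 + parityDefect d (contacts G u A).card
  swap
  · right; left
    have : (d : ℝ) + 1 + parityDefect d (contacts G u A).card < A.card := by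
      exact_mod_cast lt_of_le_of_ne hnA (Ne.symm hA)
    linarith
  right; right
  have hB : B.card ≠ d + 1 + parityDefect d (contacts G u B).card :=
    fun hB => hall ⟨hc, hA, hB, hfA, hfB⟩
  have : (d : ℝ) + 1 + parityDefect d (contacts G u B).card < B.card := by
    exact_mod_cast lt_of_le_of_ne hnB (Ne.symm hB)
  linarith

end Main

/-! ### The cubic case: bounds at a bridge -/

/-- Weighted Cauchy-Schwarz bound for the adjacency form. -/
theorem mul_le_weighted {x y a b : ℝ} (ha : 0 < a) (hb : 0 < b) :
    x * y ≤ (x ^ 2 * (b / a) + y ^ 2 * (a / b)) / 2 := by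
  have h : (x ^ 2 * (b / a) + y ^ 2 * (a / b)) / 2 - x * y = (b * x - a * y) ^ 2 / (2 * a * b) := by
    field_simp
    ring
  have : 0 ≤ (b * x - a * y) ^ 2 / (2 * a * b) := by positivity
  linarith

/-- The second eigenvalue of the extremal cubic graph. -/
structure IsCubicRoot (θ : ℝ) : Prop where
  lower : 11 / 4 < θ
  upper : θ < 3
  eq : θ ^ 3 - 7 * θ - 2 = 0

theorem exists_isCubicRoot : ∃ θ, IsCubicRoot θ := by
  -- The endpoint `11 / 4` is large enough to make `θ ^ 2 - θ - 4` positive.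
  obtain ⟨θ, ⟨h0, h1⟩, h⟩ : ∃ θ ∈ Set.Icc (11 / 4 : ℝ) 3, θ ^ 3 - 7 * θ - 2 = 0 := by
    refine intermediate_value_Icc (by norm_num) (f := fun θ : ℝ => θ ^ 3 - 7 * θ - 2)
      (by fun_prop) ⟨?_, ?_⟩ <;> norm_num
  refine ⟨θ, lt_of_le_of_ne h0 ?_, lt_of_le_of_ne h1 ?_, h⟩
  · rintro rfl
    norm_num at h
  · rintro rfl
    norm_num at h

section CubicSide

open scoped Classical

variable {V : Type*} [Fintype V] {G : SimpleGraph V} {s r : V} {X : Finset V}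

/-- `X` is a side of `s` attached by the single edge `sr`. -/
structure IsPendant (G : SimpleGraph V) (s r : V) (X : Finset V) : Prop where
  side : IsSide G s X
  contacts_eq : contacts G s X = {r}

theorem IsPendant.mem (h : IsPendant G s r X) : r ∈ X :=
  contacts_subset G s X (h.contacts_eq ▸ Finset.mem_singleton_self r)

theorem IsPendant.adj_iff (h : IsPendant G s r X) {v : V} (hv : v ∈ X) : G.Adj s v ↔ v = r := by
  have : v ∈ contacts G s X ↔ v = r := by rw [h.contacts_eq, Finset.mem_singleton]
  rw [← this, mem_contacts]
  simp [hv]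

theorem IsPendant.adj (h : IsPendant G s r X) : G.Adj s r := (h.adj_iff h.mem).mpr rfl

theorem IsPendant.card_filter_adj (h : IsPendant G s r X)
    (hreg : ∀ v, nbrSum G (fun _ => 1) v = (3 : ℕ)) {v : V} (hv : v ∈ X) :
    (X.filter (G.Adj v)).card + (if v = r then 1 else 0) = 3 := by
  have h1 := h.side.card_filter_adj hreg hv
  simpa only [h.adj_iff hv] using h1

/-- The test vector of a pendant side of a cubic graph. -/
noncomputable def pendantVec (G : SimpleGraph V) (r : V) (X : Finset V) (θ : ℝ) (v : V) : ℝ :=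
  2 * ind X v + ((θ - 3) * ind (X.filter (G.Adj r)) v + (θ ^ 2 - θ - 6) * ind {r} v)

theorem IsPendant.sum_pendantVec (h : IsPendant G s r X)
    (hreg : ∀ v, nbrSum G (fun _ => 1) v = (3 : ℕ)) (θ : ℝ) :
    ∑ v, pendantVec G r X θ v = 2 * (X.card - 5) + (θ ^ 2 + θ - 2) := by
  have hP := h.card_filter_adj hreg h.mem
  rw [if_pos rfl] at hP
  have hP' : (X.filter (G.Adj r)).card = 2 := by omega
  simp only [pendantVec, Finset.sum_add_distrib, ← Finset.mul_sum, sum_ind, hP']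
  push_cast [Finset.card_singleton]
  ring

theorem IsPendant.pendantVec_root (h : IsPendant G s r X) (θ : ℝ) :
    pendantVec G r X θ r = θ ^ 2 - θ - 4 := by
  simp only [pendantVec, ind, h.mem, Finset.mem_filter, G.irrefl, Finset.mem_singleton, if_true]
  simp
  ring

theorem pendantVec_of_notMem {v : V} (hr : r ∈ X) (hv : v ∉ X) (θ : ℝ) :
    pendantVec G r X θ v = 0 := by
  have : v ≠ r := fun e => hv (e ▸ hr)
  simp [pendantVec, ind, hv, this]

/-- The form of the test vector of a pendant side. -/
theorem IsPendant.le_shiftedForm (h : IsPendant G s r X)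
    (hreg : ∀ v, nbrSum G (fun _ => 1) v = (3 : ℕ)) {θ : ℝ} (hθ : θ ^ 3 - 7 * θ - 2 = 0) :
    (θ ^ 2 - θ - 4) ^ 2 + 4 * (3 - θ) * (X.card - 5) ≤
      shiftedForm G θ (pendantVec G r X θ) := by
  have hP := h.card_filter_adj hreg h.mem
  rw [if_pos rfl] at hP
  have hP' : (X.filter (G.Adj r)).card = 2 := by omega
  set P := X.filter (G.Adj r)
  have hPX : P ⊆ X := Finset.filter_subset _ _
  have hrP : r ∉ P := by simp [P]
  have hX (v) (hv : v ∈ X) : nbrSum G (ind X) v = 3 - if v = r then 1 else 0 := by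
    have h1 := h.side.nbrSum_ind_of_mem hreg hv
    simpa only [h.adj_iff hv, Nat.cast_ofNat] using h1
  have hsq (D : Finset V) : ∑ v, ind D v ^ 2 = D.card := by
    rw [← sum_ind]
    refine Finset.sum_congr rfl fun v _ => ?_
    unfold ind
    split_ifs <;> simp
  have hXX : adjForm G (ind X) (ind X) = 3 * X.card - 1 := by
    rw [adjForm, sum_ind_mul, Finset.sum_congr rfl hX, Finset.sum_sub_distrib, Finset.sum_const,
      Finset.sum_ite_eq', if_pos h.mem]
    simp [mul_comm]
  have hPX' : adjForm G (ind P) (ind X) = 6 := by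
    rw [adjForm, sum_ind_mul, Finset.sum_congr rfl fun v hv => hX v (hPX hv),
      Finset.sum_congr rfl fun v hv => by rw [if_neg (fun e : v = r => hrP (e ▸ hv))]]
    rw [Finset.sum_const, hP']
    norm_num
  have hrX : adjForm G (ind {r}) (ind X) = 2 := by
    rw [adjForm, sum_ind_mul, Finset.sum_singleton, hX r h.mem, if_pos rfl]
    norm_num
  have hrP' : adjForm G (ind {r}) (ind P) = 2 := by
    rw [adjForm, sum_ind_mul, Finset.sum_singleton, nbrSum_ind, Finset.filter_true_of_mem, hP']
    · norm_num
    · intro v hv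
      exact (Finset.mem_filter.mp hv).2
  have hrr : adjForm G (ind {r}) (ind {r}) = 0 := by
    rw [adjForm, sum_ind_mul, Finset.sum_singleton, nbrSum_ind]
    simp
  -- Edges between the neighbours of the root only increase the form; this is the only inequality
  -- used.
  have hPP : 0 ≤ adjForm G (ind P) (ind P) := by
    rw [adjForm, sum_ind_mul]
    refine Finset.sum_nonneg fun v _ => ?_
    rw [nbrSum_ind]
    exact Nat.cast_nonneg _
  have hdot {D E : Finset V} (hDE : D ⊆ E) : ∑ v, ind D v * ind E v = D.card := by
    rw [sum_ind_mul, Finset.sum_congr rfl fun v hv => show ind E v = 1 by simp [ind, hDE hv]]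
    simp
  have hdot0 : ∑ v, ind P v * ind {r} v = 0 := by
    rw [sum_ind_mul]
    refine Finset.sum_eq_zero fun v hv => ?_
    have : v ≠ r := fun e => hrP (e ▸ hv)
    simp [ind, this]
  have hcross (x y : V → ℝ) (a b : ℝ) : ∑ v, a * x v * (nbrSum G (fun w => b * y w) v -
      θ * (b * y v)) = a * b * (adjForm G x y - θ * ∑ v, x v * y v) := by
    simp only [adjForm, nbrSum_mul, mul_sub, Finset.mul_sum, ← Finset.sum_sub_distrib]
    exact Finset.sum_congr rfl fun v _ => by ring
  have hcross2 (x y z : V → ℝ) : ∑ v, x v * (nbrSum G (fun w => y w + z w) v -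
      θ * (y v + z v)) = ∑ v, x v * (nbrSum G y v - θ * y v) +
      ∑ v, x v * (nbrSum G z v - θ * z v) := by
    rw [← Finset.sum_add_distrib]
    refine Finset.sum_congr rfl fun v _ => ?_
    rw [nbrSum_add]
    ring
  change _ ≤ shiftedForm G θ (fun v => 2 * ind X v + ((θ - 3) * ind P v +
    (θ ^ 2 - θ - 6) * ind {r} v))
  rw [shiftedForm_add, shiftedForm_add, shiftedForm_mul, shiftedForm_mul, shiftedForm_mul,
    hcross2, hcross, hcross, hcross, adjForm_comm G (ind X), adjForm_comm G (ind X),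
    adjForm_comm G (ind P) (ind {r}), hPX', hrX, hrP', hdot0]
  have d1 : ∑ v, ind X v * ind P v = 2 := by
    simp only [mul_comm (ind X _)]
    rw [hdot hPX, hP']
    norm_num
  have d2 : ∑ v, ind X v * ind {r} v = 1 := by
    simp only [mul_comm (ind X _)]
    rw [hdot (Finset.singleton_subset_iff.mpr h.mem)]
    simp
  rw [d1, d2]
  simp only [shiftedForm, hXX, hrr, hsq, hP', Finset.card_singleton]
  have e : 0 ≤ (θ - 3) ^ 2 * adjForm G (ind P) (ind P) := mul_nonneg (sq_nonneg _) hPP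
  push_cast
  -- The vector has the values `θ ^ 2 - θ - 4` at the root, `θ - 1` next to it and `2` elsewhere.
  -- Each vertex beyond five adds `4 (3 - θ)`, and the cubic equation reduces the rest to the square
  -- of the root value.
  have key : (θ ^ 2 - θ - 4) ^ 2 + 4 * (3 - θ) * ((X.card : ℝ) - 5) =
      2 ^ 2 * (3 * X.card - 1 - θ * X.card) +
      2 * (2 * (θ - 3) * (6 - θ * 2) + 2 * (θ ^ 2 - θ - 6) * (2 - θ * 1)) +
      ((θ - 3) ^ 2 * (0 - θ * 2) + 2 * ((θ - 3) * (θ ^ 2 - θ - 6) * (2 - θ * 0)) +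
      (θ ^ 2 - θ - 6) ^ 2 * (0 - θ * 1)) := by
    linear_combination (θ ^ 2 - θ - 4) * hθ
  linarith

end CubicSide

section CubicBounds

open scoped Classical

variable {V : Type*} [Fintype V] {G : SimpleGraph V} {s r : V} {X Y : Finset V}

/-- The edge `rs` is a bridge with sides `X` and `Y`. -/
structure IsBridgeDecomposition (G : SimpleGraph V) (r s : V) (X Y : Finset V) : Prop where
  left : IsPendant G s r X
  right : IsPendant G r s Y
  disj : Disjoint X Y
  cover : ∀ v, v ∈ X ∨ v ∈ Y

theorem IsBridgeDecomposition.adj_iff (h : IsBridgeDecomposition G r s X Y) {v w : V}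
    (hv : v ∈ X) (hw : w ∈ Y) : G.Adj v w ↔ v = r ∧ w = s := by
  constructor
  · intro hvw
    have hvr : v = r := (h.right.side.closed w hw v hvw.symm).resolve_left
      (Finset.disjoint_left.mp h.disj hv)
    subst hvr
    exact ⟨rfl, (h.right.adj_iff hw).mp hvw⟩
  · rintro ⟨rfl, rfl⟩
    exact h.right.adj

theorem IsBridgeDecomposition.card (h : IsBridgeDecomposition G r s X Y) :
    Fintype.card V = X.card + Y.card := by
  rw [← Finset.card_union_of_disjoint h.disj, ← Finset.card_univ]
  congr 1
  ext v
  simpa using h.cover v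

/-- A cubic graph with a bridge, not both sides of which have five vertices, has a large second
eigenvalue. -/
theorem IsBridgeDecomposition.lt_lambda2 (h : IsBridgeDecomposition G r s X Y)
    (hreg : ∀ v, nbrSum G (fun _ => 1) v = (3 : ℕ)) {θ : ℝ} (hθ : IsCubicRoot θ)
    (hX : 5 ≤ X.card) (hY : 5 ≤ Y.card) (hne : X.card ≠ 5 ∨ Y.card ≠ 5) : θ < lambda2 G := by
  have h1 := hθ.lower
  have h2 := hθ.upper
  have hX' : (5 : ℝ) ≤ X.card := by exact_mod_cast hX
  have hY' : (5 : ℝ) ≤ Y.card := by exact_mod_cast hY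
  have fX := h.left.le_shiftedForm hreg hθ.eq
  have fY := h.right.le_shiftedForm hreg hθ.eq
  have sX := h.left.sum_pendantVec hreg θ
  have sY := h.right.sum_pendantVec hreg θ
  set FX := shiftedForm G θ (pendantVec G r X θ)
  set FY := shiftedForm G θ (pendantVec G s Y θ)
  set SX := 2 * ((X.card : ℝ) - 5) + (θ ^ 2 + θ - 2)
  set SY := 2 * ((Y.card : ℝ) - 5) + (θ ^ 2 + θ - 2)
  have hSX : 0 < SX := by
    have : 0 < θ ^ 2 + θ - 2 := by nlinarith
    linarith
  have hSY : 0 < SY := by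
    have : 0 < θ ^ 2 + θ - 2 := by nlinarith
    linarith
  set σ := θ ^ 2 - θ - 4
  -- The coefficients `SY` and `-SX` make the vector sum to zero, so the mean costs nothing.
  refine lt_lambda2_of_form G hreg ?_ (by exact_mod_cast h2)
    (fun v => SY * pendantVec G r X θ v + -SX * pendantVec G s Y θ v) ?_
  · rw [h.card]
    omega
  have hsum : ∑ v, (SY * pendantVec G r X θ v + -SX * pendantVec G s Y θ v) = 0 := by
    rw [Finset.sum_add_distrib, ← Finset.mul_sum, ← Finset.mul_sum, sX, sY]
    ring
  -- The bridge is the only edge between the two supports, and each of its ends has the value `σ`.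
  have hcross : ∑ v, SY * pendantVec G r X θ v *
      (nbrSum G (fun w => -SX * pendantVec G s Y θ w) v - θ * (-SX * pendantVec G s Y θ v)) =
      -(SX * SY * σ ^ 2) := by
    rw [Finset.sum_eq_single r]
    · have hrY : r ∉ Y := Finset.disjoint_left.mp h.disj h.left.mem
      have hn : nbrSum G (pendantVec G s Y θ) r = σ := by
        rw [nbrSum, Finset.sum_eq_single s, if_pos h.right.adj, h.right.pendantVec_root]
        · intro w _ hw
          split_ifs with hrw
          · by_cases hwY : w ∈ Y
            · exact absurd ((h.right.adj_iff hwY).mp hrw) hw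
            · exact pendantVec_of_notMem h.right.mem hwY θ
          · rfl
        · simp
      rw [nbrSum_mul, hn, h.left.pendantVec_root, pendantVec_of_notMem h.right.mem hrY]
      ring
    · intro v _ hv
      by_cases hvX : v ∈ X
      · have hvY : v ∉ Y := Finset.disjoint_left.mp h.disj hvX
        have hn : nbrSum G (pendantVec G s Y θ) v = 0 := by
          refine Finset.sum_eq_zero fun w _ => ?_
          split_ifs with hvw
          · by_cases hwY : w ∈ Y
            · exact absurd ((h.adj_iff hvX hwY).mp hvw).1 hv
            · exact pendantVec_of_notMem h.right.mem hwY θ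
          · rfl
        rw [nbrSum_mul, hn, pendantVec_of_notMem h.right.mem hvY]
        ring
      · rw [pendantVec_of_notMem h.left.mem hvX]
        ring
    · simp
  rw [hsum, shiftedForm_add, shiftedForm_mul, shiftedForm_mul, hcross]
  have e : (((3 : ℕ) : ℝ) - θ) * 0 ^ 2 / (Fintype.card V : ℝ) = 0 := by simp
  rw [e]
  have m1 := mul_le_mul_of_nonneg_left fX (sq_nonneg SY)
  have m2 := mul_le_mul_of_nonneg_left fY (sq_nonneg SX)
  have hXn : 0 ≤ 4 * (3 - θ) * ((X.card : ℝ) - 5) :=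
    mul_nonneg (by linarith) (by linarith)
  have hYn : 0 ≤ 4 * (3 - θ) * ((Y.card : ℝ) - 5) :=
    mul_nonneg (by linarith) (by linarith)
  -- The two squares and the bridge term combine to this; a side with more than five vertices
  -- contributes the strict surplus.
  have hsq : 0 ≤ σ ^ 2 * (SX - SY) ^ 2 := by positivity
  have hpos : 0 < SY ^ 2 * (4 * (3 - θ) * ((X.card : ℝ) - 5)) +
      SX ^ 2 * (4 * (3 - θ) * ((Y.card : ℝ) - 5)) := by
    rcases hne with hne | hne
    · have : (5 : ℝ) < X.card := by exact_mod_cast lt_of_le_of_ne hX (Ne.symm hne)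
      have i1 : 0 < 4 * (3 - θ) * ((X.card : ℝ) - 5) := mul_pos (by linarith) (by linarith)
      have i2 := mul_pos (pow_pos hSY 2) i1
      have i3 := mul_nonneg (sq_nonneg SX) hYn
      linarith
    · have : (5 : ℝ) < Y.card := by exact_mod_cast lt_of_le_of_ne hY (Ne.symm hne)
      have i1 : 0 < 4 * (3 - θ) * ((Y.card : ℝ) - 5) := mul_pos (by linarith) (by linarith)
      have i2 := mul_pos (pow_pos hSX 2) i1
      have i3 := mul_nonneg (sq_nonneg SY) hXn
      linarith
  linarith

/-- The upper bound for `λ₂` from a positive vector that is almost an eigenvector. -/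
theorem lambda2_le_of_bridge_vector {θ : ℝ} (hV : 1 < Fintype.card V) (hadj : G.Adj r s)
    (f : V → ℝ) (hf : ∀ v, 0 < f v) (hfrs : f r = f s)
    (heig : ∀ v, nbrSum G f v = (θ + 2 * (ind {r} v + ind {s} v)) * f v) : lambda2 G ≤ θ := by
  have hrs := hadj.ne
  refine lambda2_le_of_hyperplane G hV (fun v => ind {r} v + ind {s} v) θ fun x hx => ?_
  have hxs : x s = -x r := by
    simp only [add_mul, Finset.sum_add_distrib, sum_ind_mul, Finset.sum_singleton] at hx
    linarith
  -- On the bridge `x s = -x r`, so the product is `-x r ^ 2` where the weighted bound would give `x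
  -- r ^ 2`. The subtracted term records this difference for both orientations.
  have hpt (v w : V) : x v * (if G.Adj v w then x w else 0) ≤
      (x v ^ 2 * ((if G.Adj v w then f w else 0) / f v) +
        x w ^ 2 * ((if G.Adj w v then f v else 0) / f w)) / 2 -
      2 * x r ^ 2 * (ind {r} v * ind {s} w + ind {s} v * ind {r} w) := by
    by_cases hvw : G.Adj v w
    · simp only [hvw, hvw.symm, if_true]
      by_cases h1 : v = r ∧ w = s
      · obtain ⟨rfl, rfl⟩ := h1
        have := hf v
        rw [← hfrs, div_self this.ne', hxs]
        simp [ind, hrs]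
        linarith
      by_cases h2 : v = s ∧ w = r
      · obtain ⟨rfl, rfl⟩ := h2
        have := hf v
        rw [hfrs, div_self this.ne', hxs]
        simp [ind, hrs]
        linarith
      have h3 : ind {r} v * ind {s} w + ind {s} v * ind {r} w = (0 : ℝ) := by
        simp only [ind, Finset.mem_singleton]
        by_cases a1 : v = r <;> by_cases a2 : w = s <;> by_cases a3 : v = s <;>
          by_cases a4 : w = r <;> simp_all
      rw [h3, mul_zero, sub_zero]
      exact mul_le_weighted (hf v) (hf w)
    · have hwv : ¬ G.Adj w v := fun h => hvw h.symm
      have h3 : ind {r} v * ind {s} w + ind {s} v * ind {r} w = (0 : ℝ) := by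
        have := hadj.symm
        simp only [ind, Finset.mem_singleton]
        by_cases a1 : v = r <;> by_cases a2 : w = s <;> by_cases a3 : v = s <;>
          by_cases a4 : w = r <;> simp_all
      rw [h3]
      simp [hvw, hwv]
  have htot : ∑ v, x v * nbrSum G x v ≤ ∑ v, ∑ w,
      ((x v ^ 2 * ((if G.Adj v w then f w else 0) / f v) +
        x w ^ 2 * ((if G.Adj w v then f v else 0) / f w)) / 2 -
      2 * x r ^ 2 * (ind {r} v * ind {s} w + ind {s} v * ind {r} w)) := by
    simp only [nbrSum, Finset.mul_sum]
    exact Finset.sum_le_sum fun v _ => Finset.sum_le_sum fun w _ => hpt v w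
  refine htot.trans (le_of_eq ?_)
  have hcomm : ∑ v, ∑ w, x w ^ 2 * ((if G.Adj w v then f v else 0) / f w) =
      ∑ v, ∑ w, x v ^ 2 * ((if G.Adj v w then f w else 0) / f v) := Finset.sum_comm
  -- The surplus `2` of `heig` at `r` and `s` adds up to `4 * x r ^ 2`, which the bridge correction
  -- cancels exactly.
  have hmain : ∑ v, ∑ w, x v ^ 2 * ((if G.Adj v w then f w else 0) / f v) =
      θ * ∑ v, x v ^ 2 + 4 * x r ^ 2 := by
    have h1 (v) : ∑ w, x v ^ 2 * ((if G.Adj v w then f w else 0) / f v) =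
        θ * x v ^ 2 + (2 * (ind {r} v * x v ^ 2) + 2 * (ind {s} v * x v ^ 2)) := by
      rw [← Finset.mul_sum, ← Finset.sum_div, ← nbrSum, heig, mul_div_cancel_right₀ _ (hf v).ne']
      ring
    simp only [h1, Finset.sum_add_distrib, ← Finset.mul_sum, sum_ind_mul, Finset.sum_singleton, hxs]
    ring
  have hcorr : ∑ v, ∑ w, (ind {r} v * ind {s} w + ind {s} v * ind {r} w) = (2 : ℝ) := by
    simp only [Finset.sum_add_distrib, ← Finset.mul_sum, ← Finset.sum_mul, sum_ind]
    norm_num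
  have hlin (A B C : V → V → ℝ) (k : ℝ) : ∑ v, ∑ w, ((A v w + B v w) / 2 - k * C v w) =
      ((∑ v, ∑ w, A v w) + ∑ v, ∑ w, B v w) / 2 - k * ∑ v, ∑ w, C v w := by
    simp only [Finset.sum_sub_distrib, ← Finset.sum_div, Finset.sum_add_distrib, ← Finset.mul_sum]
  refine (hlin (fun v w => x v ^ 2 * ((if G.Adj v w then f w else 0) / f v))
    (fun v w => x w ^ 2 * ((if G.Adj w v then f v else 0) / f w))
    (fun v w => ind {r} v * ind {s} w + ind {s} v * ind {r} w) (2 * x r ^ 2)).trans ?_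
  rw [hcomm, hmain, hcorr]
  ring

end CubicBounds

/-! ### The extremal cubic graph -/

section CubicShape

open scoped Classical

variable {V : Type*} [Fintype V] {G : SimpleGraph V} {s r u : V} {X Y : Finset V}

/-- The level of a vertex of a pendant side with root `r`: `2` at the root, `1` at its neighbours
and `0` elsewhere. -/
noncomputable def pendantLevel (G : SimpleGraph V) (r v : V) : ℕ :=
  if v = r then 2 else if G.Adj r v then 1 else 0

theorem pendantLevel_eq_two {v : V} : pendantLevel G r v = 2 ↔ v = r := by
  unfold pendantLevel
  split_ifs <;> simp_all

theorem pendantLevel_eq_one {v : V} : pendantLevel G r v = 1 ↔ G.Adj r v := by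
  unfold pendantLevel
  split_ifs with h
  · subst h
    simp
  · simp_all
  · simp_all

theorem pendantLevel_eq_zero {v : V} : pendantLevel G r v = 0 ↔ v ≠ r ∧ ¬ G.Adj r v := by
  unfold pendantLevel
  split_ifs <;> simp_all

theorem pendantLevel_le (v : V) : pendantLevel G r v ≤ 2 := by
  unfold pendantLevel
  split_ifs <;> norm_num

/-- A vertex other than the root has three neighbours among the four remaining vertices of `X`,
hence a single non-neighbour; at level `0` that is the root. -/
theorem IsPendant.adj_of_level_zero (h : IsPendant G s r X)
    (hreg : ∀ v, nbrSum G (fun _ => 1) v = (3 : ℕ)) (hX : X.card = 5) {v w : V} (hv : v ∈ X)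
    (hv0 : pendantLevel G r v = 0) (hw : w ∈ X) (hwv : w ≠ v) (hwr : w ≠ r) : G.Adj v w := by
  obtain ⟨hvr, hrv⟩ := pendantLevel_eq_zero.mp hv0
  have h1 := h.card_filter_adj hreg hv
  rw [if_neg hvr] at h1
  have h2 := coDegree_add (G := G) hv
  have h3 : coDegree G X v ≤ 1 := by omega
  by_contra hvw
  rw [coDegree, Finset.card_le_one] at h3
  refine hwr (h3 w ?_ r ?_)
  · simp [hw, hwv, hvw]
  · simp [h.mem, hvr.symm, G.adj_comm v r, hrv]

theorem IsPendant.adj_iff_level (h : IsPendant G s r X)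
    (hreg : ∀ v, nbrSum G (fun _ => 1) v = (3 : ℕ)) (hX : X.card = 5) {v w : V} (hv : v ∈ X)
    (hw : w ∈ X) (hne : pendantLevel G r v ≠ pendantLevel G r w) :
    G.Adj v w ↔ pendantLevel G r v + 1 = pendantLevel G r w ∨
      pendantLevel G r w + 1 = pendantLevel G r v := by
  have key {v w : V} (hv : v ∈ X) (hw : w ∈ X) (hlt : pendantLevel G r v < pendantLevel G r w) :
      G.Adj v w ↔ pendantLevel G r v + 1 = pendantLevel G r w := by
    have hle := pendantLevel_le (G := G) (r := r) w
    have hcases : (pendantLevel G r v = 0 ∧ pendantLevel G r w = 1) ∨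
        (pendantLevel G r v = 0 ∧ pendantLevel G r w = 2) ∨
        (pendantLevel G r v = 1 ∧ pendantLevel G r w = 2) := by omega
    rcases hcases with ⟨e, e'⟩ | ⟨e, e'⟩ | ⟨e, e'⟩
    · have hrw := pendantLevel_eq_one.mp e'
      have hwv : w ≠ v := by
        rintro rfl
        omega
      simp [e, e', h.adj_of_level_zero hreg hX hv e hw hwv hrw.ne']
    · obtain rfl := pendantLevel_eq_two.mp e'
      have := (pendantLevel_eq_zero.mp e).2
      simp [e, e', G.adj_comm v, this]
    · obtain rfl := pendantLevel_eq_two.mp e'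
      simp [e, e', (pendantLevel_eq_one.mp e).symm]
  rcases lt_or_gt_of_ne hne with hlt | hlt
  · rw [key hv hw hlt]
    omega
  · rw [G.adj_comm, key hw hv hlt]
    omega

/-- The three cells of a pendant side with five vertices. -/
theorem IsPendant.nonempty_iso_cells (h : IsPendant G s r X)
    (hreg : ∀ v, nbrSum G (fun _ => 1) v = (3 : ℕ)) (hX : X.card = 5) :
    Nonempty (G.induce ((X.filter fun v => pendantLevel G r v = 0 : Finset V) : Set V) ≃g
      (completeG 2).2) ∧
    Nonempty (G.induce ((X.filter fun v => pendantLevel G r v = 1 : Finset V) : Set V) ≃g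
      (coMatching 2).2) ∧
    Nonempty (G.induce ((X.filter fun v => pendantLevel G r v = 2 : Finset V) : Set V) ≃g
      (completeG 1).2) := by
  have hP := h.card_filter_adj hreg h.mem
  rw [if_pos rfl] at hP
  have e1 : (X.filter fun v => pendantLevel G r v = 1) = X.filter (G.Adj r) :=
    Finset.filter_congr fun v _ => pendantLevel_eq_one
  have e2 : (X.filter fun v => pendantLevel G r v = 2) = {r} := by
    ext v
    simp only [Finset.mem_filter, pendantLevel_eq_two, Finset.mem_singleton]
    exact ⟨And.right, fun e => ⟨e ▸ h.mem, e⟩⟩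
  have hcard := Finset.card_eq_sum_card_fiberwise (f := pendantLevel G r) (s := X)
    (t := Finset.range 3) fun v _ => by
      have := pendantLevel_le (G := G) (r := r) v
      simp only [Finset.coe_range, Set.mem_Iio]
      omega
  rw [Finset.sum_range_succ, Finset.sum_range_succ, Finset.sum_range_one, e1, e2,
    Finset.card_singleton] at hcard
  refine ⟨nonempty_iso_completeG (by omega) fun v hv => ?_, ?_, ?_⟩
  · rw [Finset.mem_filter] at hv
    rw [coDegree, Finset.card_eq_zero, Finset.filter_eq_empty_iff]
    rintro w hw ⟨hwv, hvw⟩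
    rw [Finset.mem_filter] at hw
    exact hvw (h.adj_of_level_zero hreg hX hv.1 hv.2 hw.1 hwv (pendantLevel_eq_zero.mp hw.2).1)
  · rw [e1]
    refine nonempty_iso_coMatching (by omega) fun v hv => ?_
    have h1 := coDegree_add (G := G) hv
    rw [Finset.mem_filter] at hv
    have h2 := h.card_filter_adj hreg hv.1
    rw [if_neg hv.2.ne'] at h2
    -- The root and the two vertices at level `0` already exhaust the three neighbours of `v`, so
    -- the two neighbours of the root are not adjacent.
    have h3 : (X.filter (G.Adj r)).filter (G.Adj v) = ∅ := by
      have hsub : insert r (X.filter fun v => pendantLevel G r v = 0) ⊆ X.filter (G.Adj v) := by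
        intro w hw
        rw [Finset.mem_insert, Finset.mem_filter] at hw
        rw [Finset.mem_filter]
        rcases hw with rfl | hw
        · exact ⟨h.mem, hv.2.symm⟩
        · refine ⟨hw.1, (h.adj_of_level_zero hreg hX hw.1 hw.2 hv.1 ?_ hv.2.ne').symm⟩
          rintro rfl
          exact (pendantLevel_eq_zero.mp hw.2).2 hv.2
      have heq := Finset.eq_of_subset_of_card_le hsub (by
        rw [Finset.card_insert_of_notMem fun hr => by
          exact (pendantLevel_eq_zero.mp (Finset.mem_filter.mp hr).2).1 rfl]
        omega)
      rw [Finset.filter_eq_empty_iff]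
      intro w hw hvw
      rw [Finset.mem_filter] at hw
      have hmem : w ∈ X.filter (G.Adj v) := Finset.mem_filter.mpr ⟨hw.1, hvw⟩
      rw [← heq, Finset.mem_insert, Finset.mem_filter] at hmem
      rcases hmem with rfl | hmem
      · exact hw.2.ne rfl
      · exact (pendantLevel_eq_zero.mp hmem.2).2 hw.2
    rw [h3, Finset.card_empty] at h1
    omega
  · rw [e2]
    refine nonempty_iso_completeG (by simp) fun v hv => ?_
    rw [coDegree, Finset.card_eq_zero, Finset.filter_eq_empty_iff]
    intro w hw
    rw [Finset.mem_singleton] at hv hw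
    simp [hv, hw]

/-- The sequence of graphs of the extremal cubic graph. -/
def cubicSequence : List FinGraph :=
  [completeG 2, coMatching 2, completeG 1, completeG 1, coMatching 2, completeG 2]

theorem sum_cubicSequence {M : Type*} [AddCommMonoid M] (F : Fin cubicSequence.length → M) :
    ∑ i, F i = F ⟨0, by decide⟩ + F ⟨1, by decide⟩ + F ⟨2, by decide⟩ + F ⟨3, by decide⟩ +
      F ⟨4, by decide⟩ + F ⟨5, by decide⟩ :=
  Fin.sum_univ_six F

theorem forall_cubicSequence {P : Fin cubicSequence.length → Prop}
    (h0 : P ⟨0, by decide⟩) (h1 : P ⟨1, by decide⟩) (h2 : P ⟨2, by decide⟩)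
    (h3 : P ⟨3, by decide⟩) (h4 : P ⟨4, by decide⟩) (h5 : P ⟨5, by decide⟩) : ∀ i, P i := by
  rintro ⟨i, hi⟩
  have hi' : i < 6 := hi
  interval_cases i
  exacts [h0, h1, h2, h3, h4, h5]

theorem joinSequences_three : joinSequences 3 (cStar 3) = {cubicSequence} := by
  have h : ¬ Even 3 := by decide
  simp [joinSequences, cStar, h, cubicSequence]

/-- A cubic graph with a bridge both sides of which have five vertices is the extremal graph. -/
theorem IsBridgeDecomposition.nonempty_iso (h : IsBridgeDecomposition G r s X Y)
    (hreg : ∀ v, nbrSum G (fun _ => 1) v = (3 : ℕ)) (hX : X.card = 5) (hY : Y.card = 5) :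
    Nonempty (G ≃g seqJoin cubicSequence) := by
  -- The levels run upwards on `X` and downwards on `Y`, so that the two roots occupy the
  -- consecutive cells `2` and `3`.
  let g : V → ℕ := fun v => if v ∈ X then pendantLevel G r v else 5 - pendantLevel G s v
  have hleX := pendantLevel_le (G := G) (r := r)
  have hleY := pendantLevel_le (G := G) (r := s)
  have hgX {v} (hv : v ∈ X) : g v = pendantLevel G r v := if_pos hv
  have hgY {v} (hv : v ∈ Y) : g v = 5 - pendantLevel G s v :=
    if_neg (Finset.disjoint_right.mp h.disj hv)
  have hg (v) : g v < 6 := by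
    have := hleX v
    simp only [g]
    split_ifs <;> omega
  let f : V → Fin cubicSequence.length := fun v => ⟨g v, hg v⟩
  have hsetX (i : ℕ) (hi : i < 3) : {v | f v = ⟨i, show i < 6 by omega⟩} =
      ((X.filter fun v => pendantLevel G r v = i : Finset V) : Set V) := by
    ext v
    rw [Finset.mem_coe, Finset.mem_filter]
    refine Fin.ext_iff.trans ?_
    change g v = i ↔ _
    have := hleY v
    by_cases hv : v ∈ X
    · simp [hgX hv, hv]
    · rw [hgY ((h.cover v).resolve_left hv)]
      simp only [hv, false_and, iff_false]
      omega
  have hsetY (i : ℕ) (hi : i < 3) : {v | f v = ⟨5 - i, show 5 - i < 6 by omega⟩} =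
      ((Y.filter fun v => pendantLevel G s v = i : Finset V) : Set V) := by
    ext v
    rw [Finset.mem_coe, Finset.mem_filter]
    refine Fin.ext_iff.trans ?_
    change g v = 5 - i ↔ _
    have := hleX v
    have := hleY v
    by_cases hv : v ∈ Y
    · rw [hgY hv]
      simp only [hv, true_and]
      omega
    · rw [hgX ((h.cover v).resolve_right hv)]
      simp only [hv, false_and, iff_false]
      omega
  obtain ⟨x0, x1, x2⟩ := h.left.nonempty_iso_cells hreg hX
  obtain ⟨y0, y1, y2⟩ := h.right.nonempty_iso_cells hreg hY
  refine nonempty_iso_seqJoin f (forall_cubicSequence ?_ ?_ ?_ ?_ ?_ ?_) ?_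
  · rw [hsetX 0 (by norm_num)]
    exact x0
  · rw [hsetX 1 (by norm_num)]
    exact x1
  · rw [hsetX 2 (by norm_num)]
    exact x2
  · rw [hsetY 2 (by norm_num)]
    exact y2
  · rw [hsetY 1 (by norm_num)]
    exact y1
  · rw [hsetY 0 (by norm_num)]
    exact y0
  · have hXY {v w : V} (hv : v ∈ X) (hw : w ∈ Y) :
        G.Adj v w ↔ g v + 1 = g w ∨ g w + 1 = g v := by
      have i1 := hleX v
      have i2 := hleY w
      rw [h.adj_iff hv hw, hgX hv, hgY hw, ← pendantLevel_eq_two (G := G) (r := r),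
        ← pendantLevel_eq_two (G := G) (r := s)]
      omega
    intro v w hne
    have hne' : g v ≠ g w := fun e => hne (Fin.ext e)
    change G.Adj v w ↔ g v + 1 = g w ∨ g w + 1 = g v
    rcases h.cover v with hv | hv <;> rcases h.cover w with hw | hw
    · rw [hgX hv, hgX hw] at hne' ⊢
      exact h.left.adj_iff_level hreg hX hv hw hne'
    · exact hXY hv hw
    · rw [G.adj_comm, hXY hw hv, or_comm]
    · have i1 := hleY v
      have i2 := hleY w
      rw [hgY hv, hgY hw] at hne' ⊢
      rw [h.right.adj_iff_level hreg hY hv hw (by omega)]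
      omega

/-- A cut vertex of a cubic graph lies on a bridge. -/
theorem IsCutVertex.exists_bridge (hconn : G.Connected)
    (hreg : ∀ v, nbrSum G (fun _ => 1) v = (3 : ℕ)) (hu : IsCutVertex G u) :
    ∃ r s X Y, IsBridgeDecomposition G r s X Y := by
  -- The contact numbers are positive with sum `3`, so one of them is `1`. The edge from `u` to that
  -- contact is a bridge, and `u` joins the opposite side.
  have key {A B : Finset V} (hcut : IsCutDecomposition G u A B)
      (h1 : (contacts G u A).card = 1) : ∃ r s X Y, IsBridgeDecomposition G r s X Y := by
    obtain ⟨v, hv⟩ := Finset.card_eq_one.mp h1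
    have hA : IsPendant G u v A := ⟨hcut.left, hv⟩
    have hAB {w} (hw : w ∈ A) : w ∉ insert u B := by
      rw [Finset.mem_insert, not_or]
      exact ⟨fun e => hcut.left.notMem (e ▸ hw), Finset.disjoint_left.mp hcut.disj hw⟩
    refine ⟨v, u, A, insert u B, hA, ⟨⟨hAB hA.mem, ?_⟩, ?_⟩, ?_, ?_⟩
    · intro w hw x hwx
      rw [Finset.mem_insert] at hw
      rcases hw with rfl | hw
      · rcases hcut.cover x with hx | hx | hx
        · exact Or.inr ((hA.adj_iff hx).mp hwx)
        · exact Or.inl (Finset.mem_insert_of_mem hx)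
        · exact absurd hx hwx.ne'
      · rcases hcut.right.closed w hw x hwx with hx | hx
        · exact Or.inl (Finset.mem_insert_of_mem hx)
        · exact Or.inl (Finset.mem_insert.mpr (Or.inl hx))
    · ext w
      rw [mem_contacts, Finset.mem_singleton, Finset.mem_insert]
      constructor
      · rintro ⟨rfl | hw, hvw⟩
        · rfl
        · exact (hcut.left.closed v hA.mem w hvw).resolve_left
            (Finset.disjoint_right.mp hcut.disj hw)
      · rintro rfl
        exact ⟨Or.inl rfl, hA.adj.symm⟩
    · exact Finset.disjoint_left.mpr fun w hw => hAB hw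
    · intro w
      rw [Finset.mem_insert]
      have := hcut.cover w
      tauto
  obtain ⟨A, B, hcut, hA0, hB0⟩ := hu.exists_decomposition
  have hsum := hcut.card_contacts hreg
  have hpA := hcut.left.contacts_card_pos hconn hA0
  have hpB := hcut.right.contacts_card_pos hconn hB0
  by_cases h1 : (contacts G u A).card = 1
  · exact key hcut h1
  · exact key hcut.symm (by omega)

/-- Degree and contact number are both odd, so the parity defect raises the minimum from four to
five. -/
theorem IsPendant.five_le_card (h : IsPendant G s r X)
    (hreg : ∀ v, nbrSum G (fun _ => 1) v = (3 : ℕ)) : 5 ≤ X.card := by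
  have h1 : (contacts G s X).card = 1 := by rw [h.contacts_eq, Finset.card_singleton]
  have := h.side.le_card hreg ⟨r, h.mem⟩ (by omega)
  rw [h1] at this
  exact this

/-- The dichotomy for cubic graphs with a cut vertex. -/
theorem IsCubicRoot.lt_or_iso {θ : ℝ} (hθ : IsCubicRoot θ) (hconn : G.Connected)
    (hreg : ∀ v, nbrSum G (fun _ => 1) v = (3 : ℕ)) (hu : IsCutVertex G u) :
    θ < lambda2 G ∨ Nonempty (G ≃g seqJoin cubicSequence) := by
  obtain ⟨r, s, X, Y, h⟩ := hu.exists_bridge hconn hreg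
  by_cases h5 : X.card = 5 ∧ Y.card = 5
  · exact Or.inr (h.nonempty_iso hreg h5.1 h5.2)
  · exact Or.inl (h.lt_lambda2 hreg hθ (h.left.five_le_card hreg) (h.right.five_le_card hreg)
      (by omega))

theorem nbrSum_cubicSequence_cell (i : Fin cubicSequence.length) (a) :
    nbrSum (cubicSequence.get i).2 (fun _ => 1) a = (![1, 0, 0, 0, 0, 1] : Fin 6 → ℝ) i := by
  have h1 (a) : nbrSum (completeG 1).2 (fun _ => 1) a = 0 := by
    rw [nbrSum_completeG]
    norm_num
  have h2 (a) : nbrSum (completeG 2).2 (fun _ => 1) a = 1 := by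
    rw [nbrSum_completeG]
    norm_num
  have h3 (a) : nbrSum (coMatching 2).2 (fun _ => 1) a = 0 := by
    rw [nbrSum_coMatching even_two]
    norm_num
  revert a
  revert i
  exact forall_cubicSequence h2 h3 h1 h1 h3 h2

theorem nbrSum_cubicSequence (x) :
    nbrSum (seqJoin cubicSequence) (fun _ => 1) x = (3 : ℕ) := by
  rw [nbrSum_seqJoin _ (fun _ => 1) nbrSum_cubicSequence_cell, sum_cubicSequence]
  obtain ⟨i, a⟩ := x
  revert i
  refine forall_cubicSequence ?_ ?_ ?_ ?_ ?_ ?_ <;> intro a <;>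
    simp [cubicSequence, completeG, coMatching] <;> norm_num

theorem cubicSequence_connected : (seqJoin cubicSequence).Connected :=
  seqJoin_connected (by decide) (forall_cubicSequence two_pos two_pos one_pos one_pos two_pos
    two_pos)

/-- The left end vertex of the bridge of the extremal cubic graph. -/
def cubicLeft : Σ i : Fin cubicSequence.length, Fin (cubicSequence.get i).1 :=
  ⟨⟨2, by decide⟩, ⟨0, Nat.one_pos⟩⟩

/-- The right end vertex of the bridge of the extremal cubic graph. -/
def cubicRight : Σ i : Fin cubicSequence.length, Fin (cubicSequence.get i).1 :=
  ⟨⟨3, by decide⟩, ⟨0, Nat.one_pos⟩⟩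

theorem isCutVertex_cubicLeft : IsCutVertex (seqJoin cubicSequence) cubicLeft := by
  refine (seqJoin_decomposition cubicLeft rfl).isCutVertex ⟨⟨⟨1, by decide⟩, ⟨0, two_pos⟩⟩, ?_⟩
    ⟨cubicRight, ?_⟩
  · exact Finset.mem_filter.mpr ⟨Finset.mem_univ _, Nat.one_lt_two⟩
  · exact Finset.mem_filter.mpr ⟨Finset.mem_univ _, Nat.lt_succ_self 2⟩

theorem eq_cubicLeft_iff (x : Σ i : Fin cubicSequence.length, Fin (cubicSequence.get i).1) :
    (x = cubicLeft ↔ (x.1 : ℕ) = 2) ∧ (x = cubicRight ↔ (x.1 : ℕ) = 3) := by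
  refine ⟨⟨fun e => e ▸ rfl, fun e => ?_⟩, ⟨fun e => e ▸ rfl, fun e => ?_⟩⟩ <;>
  · obtain ⟨⟨i, hi⟩, a⟩ := x
    subst e
    have ha : a = ⟨0, Nat.one_pos⟩ := Fin.ext (Nat.lt_one_iff.mp a.isLt)
    subst ha
    rfl

/-- The pendant values, mirrored across the bridge, are positive. Negating one half would give an
eigenvector for `θ`; without the sign change the equations at the two bridge ends acquire the
surplus `2`, as `lambda2_le_of_bridge_vector` expects. -/
theorem IsCubicRoot.lambda2_le {θ : ℝ} (hθ : IsCubicRoot θ) :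
    lambda2 (seqJoin cubicSequence) ≤ θ := by
  have h1 := hθ.lower
  have h3 := hθ.eq
  let F : Fin cubicSequence.length → ℝ :=
    (![2, θ - 1, θ ^ 2 - θ - 4, θ ^ 2 - θ - 4, θ - 1, 2] : Fin 6 → ℝ)
  have hσ : 0 < θ ^ 2 - θ - 4 := by nlinarith
  refine lambda2_le_of_bridge_vector (r := cubicLeft) (s := cubicRight) ?_ (Or.inr (Or.inl rfl))
    (fun x => F x.1) ?_ rfl ?_
  · exact Fintype.one_lt_card_iff.mpr ⟨cubicLeft, cubicRight, fun e => by
      have := (eq_cubicLeft_iff cubicLeft).2.mp e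
      simp [cubicLeft] at this⟩
  · rintro ⟨i, a⟩
    revert i
    have h0 : (0 : ℝ) < 2 := two_pos
    have h4 : 0 < θ - 1 := by linarith
    exact forall_cubicSequence (fun _ => h0) (fun _ => h4) (fun _ => hσ) (fun _ => hσ)
      (fun _ => h4) fun _ => h0
  · intro x
    rw [nbrSum_seqJoin _ F nbrSum_cubicSequence_cell, sum_cubicSequence]
    simp only [ind, Finset.mem_singleton, eq_cubicLeft_iff]
    obtain ⟨i, a⟩ := x
    revert i
    refine forall_cubicSequence ?_ ?_ ?_ ?_ ?_ ?_ <;> intro a <;>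
      simp [F, cubicSequence, completeG, coMatching] <;> linarith

end CubicShape

/-! ### The threshold and the theorem -/

section Conclusion

open scoped Classical

variable {V : Type*} [Fintype V] {G : SimpleGraph V} {d : ℕ}

theorem isRegularOfDegree_iff_nbrSum [DecidableRel G.Adj] :
    G.IsRegularOfDegree d ↔ ∀ v, nbrSum G (fun _ => 1) v = d := by
  refine forall_congr' fun v => ?_
  rw [nbrSum_one, Nat.cast_inj]
  convert Iff.rfl

theorem two_lt_card_of_nbrSum [Nonempty V] (hd : 3 ≤ d)
    (hreg : ∀ v, nbrSum G (fun _ => 1) v = d) : 2 < Fintype.card V := by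
  obtain ⟨v⟩ := ‹Nonempty V›
  have h1 := hreg v
  rw [nbrSum_one, Nat.cast_inj] at h1
  have := G.degree_lt_card_verts v
  omega

/-- The extremal graphs are regular and connected, have a cut vertex and a common second
eigenvalue; every other regular graph with a cut vertex has a larger one. -/
theorem exists_threshold (hd : 3 ≤ d) :
    (joinSequences d (cStar d)).Nonempty ∧ ∃ θ : ℝ,
      (∀ L ∈ joinSequences d (cStar d), lambda2 (seqJoin L) = θ ∧
        (∀ x, nbrSum (seqJoin L) (fun _ => 1) x = d) ∧ (seqJoin L).Connected ∧
        ∃ u, IsCutVertex (seqJoin L) u) ∧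
      ∀ (V : Type*) [Fintype V] (G : SimpleGraph V), G.Connected →
        (∀ v, nbrSum G (fun _ => 1) v = d) → ∀ u, IsCutVertex G u →
        θ < lambda2 G ∨ ∃ L ∈ joinSequences d (cStar d), Nonempty (G ≃g seqJoin L) := by
  rcases hd.eq_or_lt with rfl | hd
  · obtain ⟨θ, hθ⟩ := exists_isCubicRoot
    rw [joinSequences_three]
    -- The threshold is the eigenvalue itself and not the cubic root: other graphs exceed the root,
    -- which is at least this eigenvalue, so their equality is not needed.
    refine ⟨Set.singleton_nonempty _, lambda2 (seqJoin cubicSequence), ?_, ?_⟩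
    · rintro L rfl
      exact ⟨rfl, nbrSum_cubicSequence, cubicSequence_connected, cubicLeft, isCutVertex_cubicLeft⟩
    · intro V _ G hconn hreg u hu
      exact (hθ.lt_or_iso hconn hreg hu).imp hθ.lambda2_le.trans_lt fun h => ⟨_, rfl, h⟩
  · obtain ⟨δ, hδ⟩ := exists_isGap hd
    refine ⟨joinSequences_nonempty hd, d - δ, fun L hL => ?_, fun V _ G hconn hreg u hu =>
      hδ.lt_or_iso hd hconn hreg hu⟩
    obtain ⟨hreg, hconn, u, A, B, hcut, hA, hB, -⟩ := exists_extremal_decomposition hd hL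
    exact ⟨hδ.lambda2_seqJoin hd hL, hreg, hconn, u, hcut.isCutVertex hA hB⟩

end Conclusion

theorem mainTheorem1 (d : ℕ) (hd : 3 ≤ d) :
    -- the main implication
    (∀ (V : Type*) [Fintype V] (G : SimpleGraph V) [DecidableRel G.Adj],
      G.Connected → G.IsRegularOfDegree d →
      ∀ L ∈ joinSequences d (cStar d), lambda2 G ≤ lambda2 (seqJoin L) →
      (∀ L' ∈ joinSequences d (cStar d), IsEmpty (G ≃g seqJoin L')) →
      2 ≤ vertexConnectivity G ∧ ∀ u : V, ¬ IsCutVertex G u) ∧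
    -- the extremal graphs exist, have a common second eigenvalue, and show sharpness
    (joinSequences d (cStar d)).Nonempty ∧
    (∀ L ∈ joinSequences d (cStar d), ∀ L' ∈ joinSequences d (cStar d),
      lambda2 (seqJoin L) = lambda2 (seqJoin L')) ∧
    (∀ L ∈ joinSequences d (cStar d), ∀ [DecidableRel (seqJoin L).Adj],
      (seqJoin L).Connected ∧ (seqJoin L).IsRegularOfDegree d ∧
      vertexConnectivity (seqJoin L) = 1 ∧ ∃ u, IsCutVertex (seqJoin L) u) := by
  obtain ⟨hne, θ, hext, hmain⟩ := exists_threshold hd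
  refine ⟨fun V _ G _ hconn hreg L hL hle hiso => ?_, hne, fun L hL L' hL' => ?_,
    fun L hL _ => ?_⟩
  · rw [isRegularOfDegree_iff_nbrSum] at hreg
    have hcut (u : V) : ¬ IsCutVertex G u := fun hu => by
      rcases hmain V G hconn hreg u hu with h | ⟨L', hL', ⟨e⟩⟩
      · rw [← (hext L hL).1] at h
        exact absurd hle (not_le.mpr h)
      · exact (hiso L' hL').false e
    have := hconn.nonempty
    exact ⟨two_le_vertexConnectivity hconn (two_lt_card_of_nbrSum hd hreg) hcut, hcut⟩
  · rw [(hext L hL).1, (hext L' hL').1]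
  · obtain ⟨-, hreg, hconn, u, hu⟩ := hext L hL
    have := hconn.nonempty
    have hV := two_lt_card_of_nbrSum hd hreg
    exact ⟨hconn, isRegularOfDegree_iff_nbrSum.mpr hreg,
      vertexConnectivity_eq_one hconn (by omega) hu, u, hu⟩
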